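/- Let $x_1,\dots,x_n\in\mathbb R^d$, let $\ell_1,\dots,\ell_n:\mathbb R\to\mathbb R$ be convex and twice differentiable, let $\gamma\ge 0$, and let $$f(w)=\frac1n\sum_{j=1}^n \ell_j(w^Tx_j)+\frac{\gamma}{2}\|w\|_2^2$$ be strongly convex, with minimizer $w^\star$ and $H^\star=\nabla^2 f(w^\star)$. Assume that the Hessian is $L$-Lipschitz: $\|\nabla^2 f(w)-\nabla^2 f(w')\|_2\le L\|w-w'\|_2$ for all $w,w'$. Let $w_t\in\mathbb R^d$ be a fixed current iterate, $\Delta_t=w_t-w^\star$, $g_t=\nabla f(w_t)$, and let $A_t\in\mathbb R^{n\times d}$ be the matrix with rows $\sqrt{\ell_j''(w_t^Tx_j)}\,x_j^T$. Let $\mu_t=\frac nd\max_j\|u_j\|_2^2$ be its row coherence, where $u_j$ are the rows of a matrix whose columns form an orthonormal basis of the column space of $A_t$. There are $m\ge 1$ machines, $d\geq 1$, and $md\ge 2$. Machine $i$ holds $s\ge1$ samples; all $ms$ sample indices are drawn independently and uniformly (with replacement) from $\{1,\dots,n\}$. Let $A_{t,i}\in\mathbb R^{s\times d}$ consist of the corresponding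 rows of $A_t$, let $\widetilde H_{t,i}=\frac1s A_{t,i}^TA_{t,i}+\gamma I_d$, and let one GIANT iteration be $$w_{t+1}=w_t-\frac1m\sum_{i=1}^m\widetilde H_{t,i}^{-1}g_t ,\qquad \Delta_{t+1}=w_{t+1}-w^\star .$$ Assume $s\ge\frac{3\mu_t d}{\eta^2}\log\frac{md}{\delta}$ for some $\eta,\delta\in(0,1)$, and that $w_t$ is close to $w^\star$ in the sense that $3L\,\|\Delta_t\|_2\le\sigma_{\min}(H^\star)$. Then, with probability at least $1-\delta$ over the samples, all $\widetilde H_{t,i}$ are invertible and $$\|\Delta_{t+1}\|_2\;\le\;\max\Big\{2\alpha\sqrt{\kappa}\,\|\Delta_t\|_2,\ \frac{3L}{\sigma_{\min}(H^\star)}\|\Delta_t\|_2^2\Big\},$$ where $\alpha=\frac{\eta}{\sqrt m}+\eta^2$ and $\kappa=\sigma_{\max}(H^\star)/\sigma_{\min}(H^\star)$ is the condition number of $H^\star$. -/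

import Mathlib

open MeasureTheory ProbabilityTheory

noncomputable section

namespace Giant

/-- Largest singular value of an operator (singular values are listed in decreasing order,
starting with index `0`). -/
def sigmaMax {E : Type*} [NormedAddCommGroup E] [InnerProductSpace ℝ E] [FiniteDimensional ℝ E]
    (T : E →L[ℝ] E) : ℝ :=
  LinearMap.singularValues (T : E →ₗ[ℝ] E) 0

/-- Smallest of the `dim E` singular values of an operator. -/
def sigmaMin {E : Type*} [NormedAddCommGroup E] [InnerProductSpace ℝ E] [FiniteDimensional ℝ E]
    (T : E →L[ℝ] E) : ℝ :=
  LinearMap.singularValues (T : E →ₗ[ℝ] E) (Module.finrank ℝ E - 1)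

/-- Condition number `σ_max / σ_min`. -/
def condNumber {E : Type*} [NormedAddCommGroup E] [InnerProductSpace ℝ E] [FiniteDimensional ℝ E]
    (T : E →L[ℝ] E) : ℝ :=
  sigmaMax T / sigmaMin T

/-- The Hessian `∇² f (w)`: the derivative of the gradient, as an operator. -/
def hessian {E : Type*} [NormedAddCommGroup E] [InnerProductSpace ℝ E] [CompleteSpace E]
    (f : E → ℝ) (w : E) : E →L[ℝ] E :=
  fderiv ℝ (gradient f) w

/-- The regularized empirical risk
`f (w) = (1/n) ∑ j, ℓ_j (wᵀ x_j) + (γ/2) ‖w‖²`. -/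
def objective {n d : ℕ} (ℓ : Fin n → ℝ → ℝ) (x : Fin n → EuclideanSpace ℝ (Fin d)) (γ : ℝ)
    (w : EuclideanSpace ℝ (Fin d)) : ℝ :=
  (1 / (n : ℝ)) * ∑ j, ℓ j (inner ℝ w (x j)) + γ / 2 * ‖w‖ ^ 2

/-- The matrix `A` at the point `w`, with rows `√(ℓ_j'' (wᵀ x_j)) • x_j`. -/
def scaledData {n d : ℕ} (ℓ : Fin n → ℝ → ℝ) (x : Fin n → EuclideanSpace ℝ (Fin d))
    (w : EuclideanSpace ℝ (Fin d)) : Matrix (Fin n) (Fin d) ℝ :=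
  Matrix.of fun j k => √(deriv (deriv (ℓ j)) (inner ℝ w (x j))) * x j k

/-- The column space of a matrix, as a subspace of Euclidean space. -/
def columnSpace {n d : ℕ} (A : Matrix (Fin n) (Fin d) ℝ) :
    Submodule ℝ (EuclideanSpace ℝ (Fin n)) :=
  Submodule.span ℝ (Set.range fun k : Fin d => WithLp.toLp 2 (fun j => A j k))

/-- A matrix `U` whose columns are an orthonormal basis of the column space of `A`. -/
def columnBasis {n d : ℕ} (A : Matrix (Fin n) (Fin d) ℝ) :
    Matrix (Fin n) (Fin (Module.finrank ℝ (columnSpace A))) ℝ :=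
  Matrix.of fun j k =>
    ((stdOrthonormalBasis ℝ (columnSpace A) k : columnSpace A) : EuclideanSpace ℝ (Fin n)) j

/-- Row coherence `μ(A) = (n/d) max_j ‖u_j‖²`, with `u_j` the rows of `U`; it does not depend on
which orthonormal basis of the column space is taken. -/
def rowCoherence {n d : ℕ} (A : Matrix (Fin n) (Fin d) ℝ) : ℝ :=
  (n : ℝ) / d * ⨆ j : Fin n, ∑ k, columnBasis A j k ^ 2

/-- Local Hessian `(1/s) A_iᵀ A_i + γ I` of a worker that holds the samples with indices
`J 0, …, J (s-1)`; `A_i` consists of the corresponding rows of `A`. -/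
def localHessian {n d s : ℕ} (ℓ : Fin n → ℝ → ℝ) (x : Fin n → EuclideanSpace ℝ (Fin d)) (γ : ℝ)
    (w : EuclideanSpace ℝ (Fin d)) (J : Fin s → Fin n) : Matrix (Fin d) (Fin d) ℝ :=
  (1 / (s : ℝ)) • (((scaledData ℓ x w).submatrix J id).transpose *
    (scaledData ℓ x w).submatrix J id) + γ • (1 : Matrix (Fin d) (Fin d) ℝ)

/-- The approximate Newton direction of one worker: local Hessian inverse times the exact
gradient. -/
def antDirection {n d s : ℕ} (ℓ : Fin n → ℝ → ℝ) (x : Fin n → EuclideanSpace ℝ (Fin d)) (γ : ℝ)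
    (w : EuclideanSpace ℝ (Fin d)) (J : Fin s → Fin n) : EuclideanSpace ℝ (Fin d) :=
  Matrix.toEuclideanLin (localHessian ℓ x γ w J)⁻¹ (gradient (objective ℓ x γ) w)

/-- The globally improved direction: the average of the workers' directions. -/
def giantDirection {n d m s : ℕ} (ℓ : Fin n → ℝ → ℝ) (x : Fin n → EuclideanSpace ℝ (Fin d))
    (γ : ℝ) (w : EuclideanSpace ℝ (Fin d)) (J : Fin m → Fin s → Fin n) :
    EuclideanSpace ℝ (Fin d) :=
  (1 / (m : ℝ)) • ∑ i, antDirection ℓ x γ w (J i)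

/-- One iteration (unit step): the next iterate. -/
def giantStep {n d m s : ℕ} (ℓ : Fin n → ℝ → ℝ) (x : Fin n → EuclideanSpace ℝ (Fin d))
    (γ : ℝ) (w : EuclideanSpace ℝ (Fin d)) (J : Fin m → Fin s → Fin n) :
    EuclideanSpace ℝ (Fin d) :=
  w - giantDirection ℓ x γ w J

end Giant

end

/-! Let H be the Hessian at the current iterate, H_i the local Hessians, K = H⁻¹, and M the average
of the H_i⁻¹. The deterministic half needs only a sandwich p K ≤ M ≤ q K. With c = (p + q)/2, r = (q
- p)/2 and u = K g - Δ, one has Δ - M g = -(c - 1) Δ - c u - (M - c K) g. Here u is the error of the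
exact Newton step, quadratic in ‖Δ‖ by Taylor's formula. The form of M - c K is dominated by r K, so
Cauchy–Schwarz bounds the last term by a constant times r √κ ‖Δ‖. `norm_newton_step_le` carries this
out; `Admissible` records which pairs (p, q) give the required maximum.

In orthonormal coordinates of the column space, H = γ + VᵀV and H_i = γ + Vᵀ S_i V, where S_i is the
Gram matrix of a uniform sample from an isotropic family. Inverses enter through variational
inequalities, so neither γ nor rank deficiency does harm. The lower bound p only needs the pooled
Gram matrix of all ms samples to be at most 1/p, and pooling makes its exponent m times larger. For
the upper bound q, 1/c is majorized on the spectrum of the S_i in one of three ways: by a constant;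
by its chord, whose linear part averages over the machines, so that on [1 - η, 1 + η] with pooled
error ε the bound is (1 + ε)/(1 - η²), which is where η/√m + η² comes from; or by a constant plus an
exponential, whose trace is averaged over machines and controlled by Markov's inequality, gaining a
factor 1/m.

The probabilistic input is a matrix Chernoff bound: Golden–Thompson lets the samples be averaged out
one at a time, giving tails rank · exp(-N h(x)) with h(x) = x log x - x + 1, N = 3T/η² and T =
log(md/δ). Since m d e^{-T} = δ, the failure probability is at most δ times a sum of normalized
costs (`UpperCost`, `LowerCost`), and what remains is the purely numerical claim `exists_costs`:
some admissible pair has total cost at most 1. The prescribed constants leave little room, hence the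
case analysis in m, η and T, settled by Padé bounds for the logarithm and Bernstein certificates for
polynomials. -/

noncomputable section

namespace Giant

/-! ### Trace inequalities and the Golden–Thompson inequality -/

section GoldenThompson

open Matrix

variable {ι : Type*} [Fintype ι] [DecidableEq ι]

lemma trace_mul_self_transpose_eq_sum {ι : Type*} [Fintype ι] (A : Matrix ι ι ℝ) :
    (A * Aᵀ).trace = ∑ i, ∑ j, A i j ^ 2 := by
  simp [Matrix.trace, Matrix.mul_apply, sq]

/-- Entrywise AM–GM for the Frobenius product. The additive form loses nothing below, because the
two terms on the right are equal whenever it is applied. -/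
lemma two_mul_trace_mul_le {ι : Type*} [Fintype ι] (A B : Matrix ι ι ℝ) :
    2 * |(A * B).trace| ≤ (A * Aᵀ).trace + (B * Bᵀ).trace := by
  have h : (B * Bᵀ).trace = ∑ i, ∑ j, B j i ^ 2 := by
    rw [trace_mul_self_transpose_eq_sum, Finset.sum_comm]
  rw [trace_mul_self_transpose_eq_sum, h, ← Finset.sum_add_distrib]
  have : (A * B).trace = ∑ i, ∑ j, A i j * B j i := by
    simp [Matrix.trace, Matrix.mul_apply]
  rw [this]
  have h1 : |∑ i, ∑ j, A i j * B j i| ≤ ∑ i, ∑ j, |A i j * B j i| :=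
    (Finset.abs_sum_le_sum_abs _ _).trans
      (Finset.sum_le_sum fun i _ => Finset.abs_sum_le_sum_abs _ _)
  refine (mul_le_mul_of_nonneg_left h1 zero_le_two).trans ?_
  rw [Finset.mul_sum]
  refine Finset.sum_le_sum fun i _ => ?_
  rw [Finset.mul_sum, ← Finset.sum_add_distrib]
  refine Finset.sum_le_sum fun j _ => ?_
  rw [abs_mul]
  nlinarith [sq_nonneg (|A i j| - |B j i|), sq_abs (A i j), sq_abs (B j i)]

/-- Powers of `A * B` and `B * A` have the same trace. -/
lemma trace_mul_pow_comm (A B : Matrix ι ι ℝ) (k : ℕ) :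
    ((A * B) ^ k).trace = ((B * A) ^ k).trace := by
  cases k with
  | zero => simp
  | succ k =>
    have : (A * B) ^ (k + 1) = A * (B * A) ^ k * B := by
      induction k with
      | zero => simp
      | succ k ih => rw [pow_succ, ih, pow_succ (B * A) k]; simp only [mul_assoc]
    rw [this, Matrix.trace_mul_comm, ← mul_assoc, ← pow_succ']

/-- The Lieb–Thirring trace inequality and its companion for squares, for exponents that are powers
of two. -/
lemma trace_pow_two_pow_le (k : ℕ) :
    (∀ A : Matrix ι ι ℝ, |(A ^ 2 ^ (k + 1)).trace| ≤ ((A * Aᵀ) ^ 2 ^ k).trace) ∧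
    (∀ P Q : Matrix ι ι ℝ, Pᵀ = P → Qᵀ = Q →
      ((P * Q) ^ 2 ^ k).trace ≤ (P ^ 2 ^ k * Q ^ 2 ^ k).trace) := by
  induction k with
  | zero =>
    refine ⟨fun A => ?_, fun P Q _ _ => by simp⟩
    have h := two_mul_trace_mul_le A A
    simp only [zero_add, pow_one, pow_zero, sq] at *
    linarith
  | succ k ih =>
    obtain ⟨hS, hL⟩ := ih
    constructor
    · intro A
      -- The two inequalities feed each other. Here the first, applied to A², is regrouped
      -- cyclically into a power of (A Aᵀ)(Aᵀ A), which the second one splits; powers of the two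
      -- factors have equal trace.
      have e : A ^ 2 ^ (k + 1 + 1) = (A ^ 2) ^ 2 ^ (k + 1) := by
        rw [← pow_mul, pow_succ' 2 (k + 1)]
      rw [e]
      refine (hS (A ^ 2)).trans ?_
      have e2 : ((A ^ 2 * (A ^ 2)ᵀ) ^ 2 ^ k).trace = (((A * Aᵀ) * (Aᵀ * A)) ^ 2 ^ k).trace := by
        rw [show A ^ 2 * (A ^ 2)ᵀ = A * (A * Aᵀ * Aᵀ) by
          rw [sq, Matrix.transpose_mul]; simp only [mul_assoc], trace_mul_pow_comm]
        simp only [mul_assoc]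
      rw [e2]
      refine (hL _ _ (by simp) (by simp)).trans ?_
      have h := two_mul_trace_mul_le ((A * Aᵀ) ^ 2 ^ k) ((Aᵀ * A) ^ 2 ^ k)
      simp only [Matrix.transpose_pow, Matrix.transpose_mul, Matrix.transpose_transpose,
        ← pow_add, ← two_mul] at h
      rw [← pow_succ', trace_mul_pow_comm Aᵀ A] at h
      linarith [le_abs_self ((A * Aᵀ) ^ 2 ^ k * (Aᵀ * A) ^ 2 ^ k).trace]
    · intro P Q hP hQ
      -- Conversely, the first inequality applied to P Q produces P Q Q P, cyclically P² Q², to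
      -- which the second applies one level lower.
      refine ((le_abs_self _).trans (hS (P * Q))).trans ?_
      have e2 : ((P * Q * (P * Q)ᵀ) ^ 2 ^ k).trace = ((P ^ 2 * Q ^ 2) ^ 2 ^ k).trace := by
        rw [Matrix.transpose_mul, hP, hQ, show P * Q * (Q * P) = (P * Q * Q) * P by
          simp only [mul_assoc], trace_mul_pow_comm]
        simp only [mul_assoc, sq]
      rw [e2]
      refine (hL _ _ (by rw [Matrix.transpose_pow, hP]) (by rw [Matrix.transpose_pow, hQ])).trans ?_
      rw [← pow_mul, ← pow_mul, ← pow_succ']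

/-- Difference of powers in a normed ring. -/
lemma norm_pow_sub_pow_le {𝔸 : Type*} [NormedRing 𝔸] [NormOneClass 𝔸] (x y : 𝔸) {M : ℝ}
    (hx : ‖x‖ ≤ M) (hy : ‖y‖ ≤ M) (k : ℕ) :
    ‖x ^ (k + 1) - y ^ (k + 1)‖ ≤ (k + 1) * M ^ k * ‖x - y‖ := by
  have hM : 0 ≤ M := (norm_nonneg x).trans hx
  induction k with
  | zero => simp
  | succ k ih =>
    have e : x ^ (k + 1 + 1) - y ^ (k + 1 + 1)
        = x * (x ^ (k + 1) - y ^ (k + 1)) + (x - y) * y ^ (k + 1) := by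
      rw [pow_succ' x, pow_succ' y (k + 1)]; noncomm_ring
    rw [e]
    have h1 : ‖y ^ (k + 1)‖ ≤ M ^ (k + 1) :=
      (norm_pow_le _ _).trans (pow_le_pow_left₀ (norm_nonneg _) hy _)
    calc _ ≤ ‖x‖ * ‖x ^ (k + 1) - y ^ (k + 1)‖ + ‖x - y‖ * ‖y ^ (k + 1)‖ :=
          (norm_add_le _ _).trans (add_le_add (norm_mul_le _ _) (norm_mul_le _ _))
      _ ≤ M * ((k + 1) * M ^ k * ‖x - y‖) + ‖x - y‖ * M ^ (k + 1) := by gcongr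
      _ = _ := by push_cast; ring

lemma norm_exp_le' {𝔸 : Type*} [NormedRing 𝔸] [NormOneClass 𝔸] [NormedAlgebra ℝ 𝔸]
    [CompleteSpace 𝔸] (x : 𝔸) : ‖NormedSpace.exp x‖ ≤ Real.exp ‖x‖ := by
  have h := NormedSpace.exp_series_hasSum_exp' (𝕂 := ℝ) x
  have h2 := NormedSpace.exp_series_hasSum_exp' (𝕂 := ℝ) ‖x‖
  rw [← Real.exp_eq_exp_ℝ] at h2
  refine h.norm_le_of_bounded h2 fun k => ?_
  rw [norm_smul, smul_eq_mul, Real.norm_of_nonneg (by positivity)]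
  exact mul_le_mul_of_nonneg_left (norm_pow_le _ _) (by positivity)

open Filter Topology in
/-- The Lie–Trotter product formula along any sequence of steps. -/
lemma tendsto_trotter {𝔸 : Type*} [NormedRing 𝔸] [NormOneClass 𝔸] [NormedAlgebra ℝ 𝔸]
    [CompleteSpace 𝔸] (a b : 𝔸) :
    Tendsto (fun k : ℕ => (NormedSpace.exp ((k + 1 : ℝ)⁻¹ • a) *
      NormedSpace.exp ((k + 1 : ℝ)⁻¹ • b)) ^ (k + 1)) atTop (𝓝 (NormedSpace.exp (a + b))) := by
  -- The one-step error. It vanishes to first order at 0, so k F(1/k) → 0, and comparing k-th powers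
  -- costs a factor k times a bounded exponential.
  let F : ℝ → 𝔸 := fun t => NormedSpace.exp (t • a) * NormedSpace.exp (t • b) -
    NormedSpace.exp (t • (a + b))
  have hF : HasDerivAt F 0 0 := by
    have h := ((hasDerivAt_exp_smul_const (𝕂 := ℝ) a 0).mul
      (hasDerivAt_exp_smul_const (𝕂 := ℝ) b 0)).sub
      (hasDerivAt_exp_smul_const (𝕂 := ℝ) (a + b) 0)
    simp only [zero_smul, NormedSpace.exp_zero, one_mul, mul_one, sub_self] at h
    exact h
  have hF0 : F 0 = 0 := by simp [F]
  have hlim : Tendsto (fun k : ℕ => (k + 1 : ℝ) • F ((k + 1 : ℝ)⁻¹)) atTop (𝓝 0) := by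
    have h1 := hF.tendsto_slope_zero
    have h2 : Tendsto (fun k : ℕ => ((k + 1 : ℝ)⁻¹)) atTop (𝓝[≠] 0) := by
      refine tendsto_nhdsWithin_iff.2 ⟨?_, Eventually.of_forall fun k => ?_⟩
      · simpa using tendsto_one_div_add_atTop_nhds_zero_nat (𝕜 := ℝ)
      · simp only [Set.mem_compl_iff, Set.mem_singleton_iff]; positivity
    have := h1.comp h2
    simpa [Function.comp_def, hF0] using this
  rw [tendsto_iff_norm_sub_tendsto_zero]
  have hlim2 := (hlim.norm).const_mul (Real.exp (‖a‖ + ‖b‖))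
  simp only [norm_zero, mul_zero] at hlim2
  refine squeeze_zero (fun _ => norm_nonneg _) (fun k => ?_) hlim2
  set t : ℝ := (k + 1 : ℝ)⁻¹ with ht
  have ht0 : 0 ≤ t := by positivity
  have hk : ((k : ℝ) + 1) * t = 1 := by rw [ht]; field_simp
  have e : NormedSpace.exp (a + b) = NormedSpace.exp (t • (a + b)) ^ (k + 1) := by
    let _ := NormedAlgebra.restrictScalars ℚ ℝ 𝔸
    rw [← NormedSpace.exp_nsmul, ← Nat.cast_smul_eq_nsmul ℝ, smul_smul]
    push_cast
    rw [hk, one_smul]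
  have hn : ∀ c : 𝔸, ‖t • c‖ = t * ‖c‖ := fun c => by
    rw [norm_smul, Real.norm_of_nonneg ht0]
  have hM1 : ‖NormedSpace.exp (t • a) * NormedSpace.exp (t • b)‖
      ≤ Real.exp (t * (‖a‖ + ‖b‖)) := by
    refine (norm_mul_le _ _).trans ?_
    rw [mul_add, Real.exp_add, ← hn, ← hn]
    exact mul_le_mul (norm_exp_le' _) (norm_exp_le' _) (norm_nonneg _) (Real.exp_pos _).le
  have hM2 : ‖NormedSpace.exp (t • (a + b))‖ ≤ Real.exp (t * (‖a‖ + ‖b‖)) := by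
    refine (norm_exp_le' _).trans (Real.exp_le_exp.2 ?_)
    rw [hn]
    exact mul_le_mul_of_nonneg_left (norm_add_le _ _) ht0
  rw [e]
  refine (norm_pow_sub_pow_le _ _ hM1 hM2 k).trans ?_
  rw [norm_smul, Real.norm_of_nonneg (by positivity : (0 : ℝ) ≤ k + 1), ← Real.exp_nat_mul]
  have : (k : ℝ) * (t * (‖a‖ + ‖b‖)) ≤ ‖a‖ + ‖b‖ := by
    have : (k : ℝ) * t ≤ 1 := by nlinarith
    rw [← mul_assoc]
    exact mul_le_of_le_one_left (by positivity) this
  have h3 := Real.exp_le_exp.2 this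
  calc _ ≤ ((k : ℝ) + 1) * Real.exp (‖a‖ + ‖b‖) * ‖F t‖ := by gcongr
    _ = _ := by ring

open Filter Topology in
lemma tendsto_trotter_matrix [Nonempty ι] (A B : Matrix ι ι ℝ) :
    Tendsto (fun k : ℕ => (NormedSpace.exp ((k + 1 : ℝ)⁻¹ • A) *
      NormedSpace.exp ((k + 1 : ℝ)⁻¹ • B)) ^ (k + 1)) atTop (𝓝 (NormedSpace.exp (A + B))) := by
  let _ : NormedRing (Matrix ι ι ℝ) := Matrix.linftyOpNormedRing
  let _ : NormedAlgebra ℝ (Matrix ι ι ℝ) := Matrix.linftyOpNormedAlgebra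
  have _ : NormOneClass (Matrix ι ι ℝ) := Matrix.linfty_opNormOneClass
  exact tendsto_trotter A B

lemma exp_transpose_of_symm {A : Matrix ι ι ℝ} (hA : Aᵀ = A) (t : ℝ) :
    (NormedSpace.exp (t • A))ᵀ = NormedSpace.exp (t • A) := by
  rw [← Matrix.exp_transpose, Matrix.transpose_smul, hA]

lemma exp_inv_smul_pow (C : Matrix ι ι ℝ) {k : ℕ} (hk : k ≠ 0) :
    NormedSpace.exp ((k : ℝ)⁻¹ • C) ^ k = NormedSpace.exp C := by
  rw [← Matrix.exp_nsmul, ← Nat.cast_smul_eq_nsmul ℝ, smul_smul,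
    mul_inv_cancel₀ (by exact_mod_cast hk), one_smul]

open Filter Topology in
/-- **Golden–Thompson inequality** for real symmetric matrices. -/
lemma trace_exp_add_le {A B : Matrix ι ι ℝ} (hA : Aᵀ = A) (hB : Bᵀ = B) :
    (NormedSpace.exp (A + B)).trace ≤ (NormedSpace.exp A * NormedSpace.exp B).trace := by
  rcases isEmpty_or_nonempty ι with h | h
  · simp [Matrix.trace]
  have h1 := tendsto_trotter_matrix A B
  -- The trace inequality is known for dyadic exponents only, and the product formula uses exponent
  -- k + 1, hence the subsequence 2 ^ k - 1.
  have h2 : Tendsto (fun k : ℕ => 2 ^ k - 1) atTop atTop :=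
    tendsto_atTop_mono (fun k => Nat.le_sub_one_of_lt Nat.lt_two_pow_self) tendsto_id
  have h3 := ((continuous_id.matrix_trace (n := ι) (R := ℝ)).tendsto _).comp (h1.comp h2)
  refine le_of_tendsto h3 (Eventually.of_forall fun k => ?_)
  have hk : 2 ^ k - 1 + 1 = 2 ^ k := Nat.sub_add_cancel Nat.one_le_two_pow
  have hk' : ((2 ^ k - 1 : ℕ) : ℝ) + 1 = ((2 ^ k : ℕ) : ℝ) := by exact_mod_cast hk
  simp only [Function.comp_apply, id, hk, hk']
  refine ((trace_pow_two_pow_le k).2 _ _ (exp_transpose_of_symm hA _)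
    (exp_transpose_of_symm hB _)).trans (le_of_eq ?_)
  rw [exp_inv_smul_pow A (by positivity), exp_inv_smul_pow B (by positivity)]

end GoldenThompson

/-! ### Matrix Laplace transform of a sampled Gram matrix -/

section MatrixLaplace

open Matrix

variable {κ : Type*} [Fintype κ] [DecidableEq κ]

/-- Spectral theorem for real symmetric matrices, with the exponentials. -/
lemma exists_diagonalization {S : Matrix κ κ ℝ} (hS : Sᵀ = S) :
    ∃ (U : Matrix κ κ ℝ) (lam : κ → ℝ), Uᵀ * U = 1 ∧ U * Uᵀ = 1 ∧
      S = U * diagonal lam * Uᵀ ∧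
      ∀ t : ℝ, NormedSpace.exp (t • S) = U * diagonal (fun i => Real.exp (t * lam i)) * Uᵀ := by
  have hH : S.IsHermitian := by
    rw [Matrix.IsHermitian, Matrix.conjTranspose_eq_transpose_of_trivial, hS]
  set U : Matrix κ κ ℝ := (hH.eigenvectorUnitary : Matrix κ κ ℝ) with hU
  have hstar : star U = Uᵀ := by
    rw [Matrix.star_eq_conjTranspose, Matrix.conjTranspose_eq_transpose_of_trivial]
  have h1 : Uᵀ * U = 1 := by rw [← hstar]; exact Unitary.coe_star_mul_self _
  have h2 : U * Uᵀ = 1 := by rw [← hstar]; exact Unitary.coe_mul_star_self _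
  have h3 : S = U * diagonal hH.eigenvalues * Uᵀ := by
    have := hH.spectral_theorem
    rw [Unitary.conjStarAlgAut_apply] at this
    rw [← hstar]
    exact this
  refine ⟨U, hH.eigenvalues, h1, h2, h3, fun t => ?_⟩
  have hinv : U⁻¹ = Uᵀ := Matrix.inv_eq_right_inv h2
  have hunit : IsUnit U := IsUnit.of_mul_eq_one _ h2
  conv_lhs => rw [h3]
  rw [← hinv, show t • (U * diagonal hH.eigenvalues * U⁻¹)
    = U * diagonal (t • hH.eigenvalues) * U⁻¹ by
      rw [Matrix.diagonal_smul, Matrix.mul_smul, Matrix.smul_mul],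
    Matrix.exp_conj _ _ hunit, Matrix.exp_diagonal]
  congr 3
  ext i
  rw [Pi.coe_exp]
  simp [Real.exp_eq_exp_ℝ]

lemma dotProduct_conj_diagonal (U : Matrix κ κ ℝ) (lam : κ → ℝ) (v w : κ → ℝ) :
    v ⬝ᵥ ((U * diagonal lam * Uᵀ) *ᵥ w) = ∑ i, lam i * ((Uᵀ *ᵥ v) i * (Uᵀ *ᵥ w) i) := by
  rw [← Matrix.mulVec_mulVec, ← Matrix.mulVec_mulVec, Matrix.dotProduct_mulVec,
    ← Matrix.mulVec_transpose]
  simp only [dotProduct, Matrix.mulVec_diagonal]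
  exact Finset.sum_congr rfl fun i _ => by ring

lemma dotProduct_eq_sum_transpose_mulVec {U : Matrix κ κ ℝ} (hU : U * Uᵀ = 1) (v w : κ → ℝ) :
    v ⬝ᵥ w = ∑ i, (Uᵀ *ᵥ v) i * (Uᵀ *ᵥ w) i := by
  have := dotProduct_conj_diagonal U 1 v w
  rw [show diagonal (1 : κ → ℝ) = 1 from Matrix.diagonal_one, mul_one, hU, Matrix.one_mulVec] at this
  simpa using this

lemma trace_conj_diagonal {U : Matrix κ κ ℝ} (hU : Uᵀ * U = 1) (lam : κ → ℝ) :
    (U * diagonal lam * Uᵀ).trace = ∑ i, lam i := by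
  rw [Matrix.trace_mul_comm, ← mul_assoc, hU, one_mul, Matrix.trace_diagonal]

lemma trace_exp_nonneg {S : Matrix κ κ ℝ} (hS : Sᵀ = S) : 0 ≤ (NormedSpace.exp S).trace := by
  obtain ⟨U, lam, h1, h2, h3, h4⟩ := exists_diagonalization hS
  have := h4 1
  rw [one_smul] at this
  rw [this, trace_conj_diagonal h1]
  exact Finset.sum_nonneg fun i _ => (Real.exp_pos _).le

/-- In an eigenbasis of S the trace is a combination of values of the form D with positive weights
exp(λ_i). -/
lemma trace_mul_exp_nonneg {D S : Matrix κ κ ℝ} (hD : ∀ v, 0 ≤ v ⬝ᵥ (D *ᵥ v)) (hS : Sᵀ = S) :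
    0 ≤ (D * NormedSpace.exp S).trace := by
  obtain ⟨U, lam, h1, h2, h3, h4⟩ := exists_diagonalization hS
  have := h4 1
  rw [one_smul] at this
  have e : ∀ E : Matrix κ κ ℝ, (D * (U * E * Uᵀ)).trace = (E * (Uᵀ * (D * U))).trace := fun E => by
    rw [← Matrix.trace_mul_comm]
    simp only [Matrix.mul_assoc]
    rw [← Matrix.trace_mul_comm]
    simp only [Matrix.mul_assoc]
  rw [this, e, Matrix.trace]
  refine Finset.sum_nonneg fun i _ => ?_
  rw [Matrix.diag_apply, Matrix.diagonal_mul]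
  refine mul_nonneg (Real.exp_pos _).le ?_
  have e : (Uᵀ * (D * U)) i i = U.col i ⬝ᵥ (D *ᵥ U.col i) := by
    simp [Matrix.mul_apply, dotProduct, Matrix.mulVec]
  rw [e]
  exact hD _

/-- One factor of a product of independent exponentials can be averaged out. -/
lemma sum_trace_exp_add_le {β : Type*} [Fintype β] (X : β → Matrix κ κ ℝ) (hX : ∀ j, (X j)ᵀ = X j)
    {b : ℝ} (hb : ∀ v, ∑ j, v ⬝ᵥ (NormedSpace.exp (X j) *ᵥ v) ≤ b * (v ⬝ᵥ v))
    {S : Matrix κ κ ℝ} (hS : Sᵀ = S) :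
    ∑ j, (NormedSpace.exp (X j + S)).trace ≤ b * (NormedSpace.exp S).trace := by
  have h := trace_mul_exp_nonneg (D := b • (1 : Matrix κ κ ℝ) - ∑ j, NormedSpace.exp (X j))
    (fun v => by
      have := hb v
      rw [Matrix.sub_mulVec, dotProduct_sub, Matrix.smul_mulVec, Matrix.one_mulVec,
        dotProduct_smul, Matrix.sum_mulVec, dotProduct_sum, smul_eq_mul]
      linarith) hS
  rw [Matrix.sub_mul, Matrix.trace_sub, Matrix.smul_mul, one_mul, Matrix.trace_smul, smul_eq_mul,
    Finset.sum_mul, Matrix.trace_sum] at h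
  refine (Finset.sum_le_sum fun j _ => trace_exp_add_le (hX j) hS).trans ?_
  linarith

/-- Resampling one coordinate of a uniformly random function does not change averages. -/
lemma sum_sum_update {ι β : Type*} [Fintype ι] [DecidableEq ι] [Fintype β] (a : ι)
    (f : (ι → β) → ℝ) :
    ∑ J : ι → β, ∑ j : β, f (Function.update J a j) = Fintype.card β * ∑ J : ι → β, f J := by
  have hinv : Function.Involutive
      (fun p : (ι → β) × β => (Function.update p.1 a p.2, p.1 a)) := by
    rintro ⟨J, j⟩
    simp
  have h1 := Equiv.sum_comp hinv.toPerm (fun p : (ι → β) × β => f p.1)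
  simp only [Function.Involutive.coe_toPerm] at h1
  rw [Fintype.sum_prod_type, Fintype.sum_prod_type] at h1
  rw [h1]
  simp [Finset.mul_sum]

lemma sum_trace_exp_sum_le {β ι : Type*} [Fintype β] [Nonempty β] [Fintype ι] [DecidableEq ι]
    (X : β → Matrix κ κ ℝ) (hX : ∀ j, (X j)ᵀ = X j) {b : ℝ} (hb0 : 0 ≤ b)
    (hb : ∀ v, ∑ j, v ⬝ᵥ (NormedSpace.exp (X j) *ᵥ v) ≤ Fintype.card β * b * (v ⬝ᵥ v))
    (T : Finset ι) :
    ∑ J : ι → β, (NormedSpace.exp (∑ i ∈ T, X (J i))).trace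
      ≤ (Fintype.card β : ℝ) ^ Fintype.card ι * (b ^ T.card * Fintype.card κ) := by
  have hn : (0 : ℝ) < Fintype.card β := by exact_mod_cast Fintype.card_pos
  induction T using Finset.induction_on with
  | empty => simp
  | insert a T ha ih =>
    -- Resampling the coordinate a turns its average into an inner sum with all other samples
    -- frozen, so Golden–Thompson removes exactly one factor.
    rw [← mul_le_mul_iff_right₀ hn, ← sum_sum_update a]
    have hstep : ∀ J : ι → β, ∑ j, (NormedSpace.exp
        (∑ i ∈ insert a T, X (Function.update J a j i))).trace
        ≤ Fintype.card β * b * (NormedSpace.exp (∑ i ∈ T, X (J i))).trace := by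
      intro J
      refine le_trans (le_of_eq ?_) (sum_trace_exp_add_le X hX hb (S := ∑ i ∈ T, X (J i)) ?_)
      · refine Finset.sum_congr rfl fun j _ => ?_
        rw [Finset.sum_insert ha, Function.update_self]
        congr 3
        refine Finset.sum_congr rfl fun i hi => ?_
        rw [Function.update_of_ne (by rintro rfl; exact ha hi)]
      · rw [Matrix.transpose_sum]
        exact Finset.sum_congr rfl fun i _ => hX _
    refine (Finset.sum_le_sum fun J _ => hstep J).trans ?_
    rw [← Finset.mul_sum, Finset.card_insert_of_notMem ha]
    calc _ ≤ Fintype.card β * b * ((Fintype.card β : ℝ) ^ Fintype.card ι *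
          (b ^ T.card * Fintype.card κ)) := by gcongr
      _ = _ := by ring

/-- Exponential of a multiple of an idempotent up to scaling. -/
lemma exp_smul_of_mul_self {X : Matrix κ κ ℝ} {ρ : ℝ} (hρ : ρ ≠ 0) (hX : X * X = ρ • X) (t : ℝ) :
    NormedSpace.exp (t • X) = 1 + ((Real.exp (t * ρ) - 1) / ρ) • X := by
  let _ : NormedRing (Matrix κ κ ℝ) := Matrix.linftyOpNormedRing
  let _ : NormedAlgebra ℝ (Matrix κ κ ℝ) := Matrix.linftyOpNormedAlgebra
  have hp : ∀ k : ℕ, (t • X) ^ (k + 1) = ((t * ρ) ^ (k + 1) / ρ) • X := by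
    intro k
    induction k with
    | zero => rw [zero_add, pow_one, pow_one, mul_div_cancel_right₀ _ hρ]
    | succ k ih =>
      rw [pow_succ, ih, smul_mul_smul_comm, hX, smul_smul]
      congr 1
      ring
  have h := NormedSpace.exp_series_hasSum_exp' (𝕂 := ℝ) (t • X)
  have h2 := NormedSpace.exp_series_hasSum_exp' (𝕂 := ℝ) (t * ρ)
  rw [← Real.exp_eq_exp_ℝ, ← hasSum_nat_add_iff' 1] at h2
  have h3 := ((h2.div_const ρ).smul_const X)
  have h4 := (hasSum_nat_add_iff' 1).2 h
  have h5 := h4.unique (h3.congr_fun (fun k => ?_))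
  · simp only [Finset.sum_range_one, Nat.factorial_zero, pow_zero, Nat.cast_one, inv_one,
      one_smul] at h5
    exact (sub_eq_iff_eq_add'.1 h5)
  · rw [hp, smul_smul]
    congr 1
    simp only [smul_eq_mul]
    ring

/-- The chord of exp between 0 and tR. The sign of t is free, so the upper and the lower tail are
treated together. -/
lemma exp_mul_sub_one_le {t ρ R : ℝ} (hρ : 0 ≤ ρ) (hR : ρ ≤ R) (hR0 : 0 < R) :
    Real.exp (t * ρ) - 1 ≤ ρ / R * (Real.exp (t * R) - 1) := by
  have h := convexOn_exp.2 (Set.mem_univ (t * R)) (Set.mem_univ 0)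
    (div_nonneg hρ hR0.le : 0 ≤ ρ / R)
    (sub_nonneg.2 ((div_le_one hR0).2 hR) : 0 ≤ 1 - ρ / R) (by ring)
  simp only [smul_eq_mul, mul_zero, add_zero, Real.exp_zero, mul_one] at h
  rw [show ρ / R * (t * R) = t * ρ by field_simp] at h
  linarith

/-- A rank-one matrix is idempotent up to the factor ρ = c |u|², so its exponential is affine in it;
the chord bound then replaces ρ by the uniform bound R, which makes the estimate summable by
isotropy. -/
lemma dotProduct_exp_rankOne_le (u : κ → ℝ) {c R : ℝ} (hc : 0 < c) (hR0 : 0 < R)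
    (hR : c * (u ⬝ᵥ u) ≤ R) (t : ℝ) (v : κ → ℝ) :
    v ⬝ᵥ (NormedSpace.exp (t • (c • vecMulVec u u)) *ᵥ v)
      ≤ v ⬝ᵥ v + (Real.exp (t * R) - 1) / R * (c * (u ⬝ᵥ v) ^ 2) := by
  by_cases hu : u = 0
  · subst hu
    simp
  have huu : 0 < u ⬝ᵥ u := by
    refine lt_of_le_of_ne (by simpa using dotProduct_star_self_nonneg u) fun h => hu ?_
    exact dotProduct_self_eq_zero.1 h.symm
  have hX : (c • vecMulVec u u) * (c • vecMulVec u u) = (c * (u ⬝ᵥ u)) • (c • vecMulVec u u) := by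
    rw [smul_mul_smul_comm, vecMulVec_mul_vecMulVec, smul_smul, vecMulVec_smul, smul_smul]
    congr 1
    ring
  have hv : v ⬝ᵥ (vecMulVec u u *ᵥ v) = (u ⬝ᵥ v) ^ 2 := by
    rw [vecMulVec_mulVec]
    simp [dotProduct_smul, sq, dotProduct_comm v u]
  rw [exp_smul_of_mul_self (by positivity) hX, Matrix.add_mulVec, Matrix.one_mulVec,
    dotProduct_add, Matrix.smul_mulVec, Matrix.smul_mulVec, dotProduct_smul, dotProduct_smul, hv]
  simp only [smul_eq_mul]
  have h := exp_mul_sub_one_le (t := t) (ρ := c * (u ⬝ᵥ u)) (R := R) (by positivity) hR hR0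
  have h2 : (Real.exp (t * (c * (u ⬝ᵥ u))) - 1) / (c * (u ⬝ᵥ u)) ≤ (Real.exp (t * R) - 1) / R := by
    rw [div_le_iff₀ (by positivity)]
    calc _ ≤ _ := h
      _ = _ := by ring
  gcongr

/-- Average of the exponential trace of a sampled, rescaled Gram matrix. The samples with indices in
`T` are used; `N` is a lower bound for the number of samples in units of the coherence. -/
lemma sum_trace_exp_sample_le {β ι : Type*} [Fintype β] [Nonempty β] [Fintype ι] [DecidableEq ι]
    (u : β → κ → ℝ) (hu : ∑ j, vecMulVec (u j) (u j) = 1) {R N : ℝ} (hR0 : 0 < R)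
    (hR : ∀ j, Fintype.card β * (u j ⬝ᵥ u j) ≤ R) (hN : 0 < N) (T : Finset ι)
    (hT : N * R ≤ T.card) (θ : ℝ) :
    ∑ J : ι → β, (NormedSpace.exp (θ • ((Fintype.card β / T.card : ℝ) •
        ∑ i ∈ T, vecMulVec (u (J i)) (u (J i))))).trace
      ≤ (Fintype.card β : ℝ) ^ Fintype.card ι *
        (Fintype.card κ * Real.exp (N * (Real.exp (θ / N) - 1))) := by
  have hn : (0 : ℝ) < Fintype.card β := by exact_mod_cast Fintype.card_pos
  have hT0 : (0 : ℝ) < T.card := lt_of_lt_of_le (by positivity) hT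
  set t : ℝ := θ / T.card with ht
  set X : β → Matrix κ κ ℝ := fun j => t • ((Fintype.card β : ℝ) • vecMulVec (u j) (u j)) with hXdef
  set c : ℝ := (Real.exp (t * R) - 1) / R with hc
  have hX : ∀ j, (X j)ᵀ = X j := fun j => by
    simp only [hXdef, Matrix.transpose_smul, Matrix.transpose_vecMulVec]
  have hsq : ∀ v : κ → ℝ, ∑ j, (u j ⬝ᵥ v) ^ 2 = v ⬝ᵥ v := fun v => by
    have h := congrArg (fun M : Matrix κ κ ℝ => v ⬝ᵥ (M *ᵥ v)) hu
    simp only [Matrix.one_mulVec, Matrix.sum_mulVec, dotProduct_sum, vecMulVec_mulVec] at h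
    rw [← h]
    refine Finset.sum_congr rfl fun j _ => ?_
    simp [dotProduct_smul, sq, dotProduct_comm v (u j)]
  have hvv : ∀ v : κ → ℝ, 0 ≤ v ⬝ᵥ v := fun v => by simpa using dotProduct_star_self_nonneg v
  have hb : ∀ v, ∑ j, v ⬝ᵥ (NormedSpace.exp (X j) *ᵥ v)
      ≤ Fintype.card β * Real.exp c * (v ⬝ᵥ v) := fun v => by
    calc _ ≤ ∑ j, (v ⬝ᵥ v + c * (Fintype.card β * (u j ⬝ᵥ v) ^ 2)) :=
          Finset.sum_le_sum fun j _ => dotProduct_exp_rankOne_le (u j) hn hR0 (hR j) t v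
      _ = Fintype.card β * (c + 1) * (v ⬝ᵥ v) := by
          rw [Finset.sum_add_distrib, ← Finset.mul_sum, ← Finset.mul_sum, hsq]
          simp only [Finset.sum_const, Finset.card_univ, nsmul_eq_mul]
          ring
      -- The inequality 1 + c ≤ exp c makes the one-sample bound multiplicative, which leads to a
      -- moment generating function of Poisson type.
      _ ≤ _ := by
          have := Real.add_one_le_exp c
          have := hvv v
          gcongr
  have h := sum_trace_exp_sum_le (ι := ι) X hX (Real.exp_pos c).le hb T
  refine le_trans (le_of_eq ?_) (h.trans ?_)
  · refine Finset.sum_congr rfl fun J _ => ?_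
    congr 2
    simp only [hXdef, ht]
    rw [← Finset.smul_sum, ← Finset.smul_sum, smul_smul, smul_smul]
    congr 1
    ring
  · rw [← Real.exp_nat_mul, mul_comm (Real.exp _)]
    -- Only |T| ≥ N R is known. The chord bound, with R/|T| ≤ 1/N, shows that having more samples
    -- than necessary can only help.
    have key : (T.card : ℝ) * c ≤ N * (Real.exp (θ / N) - 1) := by
      have h1 := exp_mul_sub_one_le (t := θ) (ρ := R / T.card) (R := 1 / N) (by positivity)
        (by rw [div_le_div_iff₀ hT0 hN]; linarith) (by positivity)
      rw [show θ * (R / T.card) = t * R by rw [ht]; ring, show θ * (1 / N) = θ / N by ring] at h1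
      rw [hc, mul_div_assoc', div_le_iff₀ hR0]
      calc _ ≤ (T.card : ℝ) * (R / T.card / (1 / N) * (Real.exp (θ / N) - 1)) := by gcongr
        _ = _ := by field_simp
    gcongr

end MatrixLaplace

/-! ### Union bounds and Markov's inequality by counting sample configurations -/

section Counting

open scoped Classical in
/-- The number of points of a finite type at which a property fails. -/
def failCount {Λ : Type*} [Fintype Λ] (p : Λ → Prop) : ℝ :=
  ((Finset.univ.filter fun J => ¬ p J).card : ℝ)

variable {Λ : Type*} [Fintype Λ]

lemma failCount_mono {p q : Λ → Prop} (h : ∀ J, p J → q J) : failCount q ≤ failCount p := by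
  classical
  unfold failCount
  refine Nat.cast_le.2 (Finset.card_le_card fun J => ?_)
  simp only [Finset.mem_filter, Finset.mem_univ, true_and]
  exact fun hq hp => hq (h J hp)

lemma failCount_and_le (p q : Λ → Prop) :
    failCount (fun J => p J ∧ q J) ≤ failCount p + failCount q := by
  classical
  simp only [failCount]
  have h : (Finset.univ.filter fun J => ¬ (p J ∧ q J)) ⊆
      (Finset.univ.filter fun J => ¬ p J) ∪ (Finset.univ.filter fun J => ¬ q J) := by
    intro J
    simp only [Finset.mem_filter, Finset.mem_univ, true_and, Finset.mem_union]
    tauto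
  have h2 := (Finset.card_le_card h).trans (Finset.card_union_le _ _)
  exact_mod_cast h2

lemma failCount_forall_le {α : Type*} [Fintype α] (p : α → Λ → Prop) :
    failCount (fun J => ∀ i, p i J) ≤ ∑ i, failCount (p i) := by
  classical
  simp only [failCount]
  have h : (Finset.univ.filter fun J => ¬ ∀ i, p i J) ⊆
      Finset.univ.biUnion fun i => Finset.univ.filter fun J => ¬ p i J := by
    intro J
    simp
  have h2 := (Finset.card_le_card h).trans Finset.card_biUnion_le
  exact_mod_cast h2

lemma failCount_true_le {p : Λ → Prop} (h : ∀ J, p J) : failCount p = 0 := by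
  simp [failCount, h]

/-- Markov's inequality for counting. -/
lemma mul_failCount_le_sum {f : Λ → ℝ} (hf : ∀ J, 0 ≤ f J) (a : ℝ) :
    a * failCount (fun J => f J ≤ a) ≤ ∑ J, f J := by
  classical
  unfold failCount
  rw [mul_comm, ← nsmul_eq_mul]
  refine (Finset.card_nsmul_le_sum _ f a fun J hJ => ?_).trans
    (Finset.sum_le_sum_of_subset_of_nonneg (Finset.subset_univ _) fun J _ _ => hf J)
  simp only [Finset.mem_filter, Finset.mem_univ, true_and, not_le] at hJ
  exact hJ.le

end Counting

/-! ### Chernoff bounds for sampled Gram matrices -/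

section Sampling

open Matrix

variable {κ : Type*} [Fintype κ] [DecidableEq κ]

/-- Each exp(θ λ_i) is one positive term of the trace. The factor θ is kept on both sides so that
its sign selects the largest or the smallest eigenvalue. -/
lemma mul_quadForm_le_of_trace_exp_le {S : Matrix κ κ ℝ} (hS : Sᵀ = S) {θ x : ℝ}
    (h : (NormedSpace.exp (θ • S)).trace ≤ Real.exp (θ * x)) (v : κ → ℝ) :
    θ * (v ⬝ᵥ (S *ᵥ v)) ≤ θ * (x * (v ⬝ᵥ v)) := by
  obtain ⟨U, lam, h1, h2, h3, h4⟩ := exists_diagonalization hS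
  rw [h4, trace_conj_diagonal h1] at h
  have hl : ∀ i, θ * lam i ≤ θ * x := fun i => Real.exp_le_exp.1
    ((Finset.single_le_sum (f := fun i => Real.exp (θ * lam i))
      (fun j _ => (Real.exp_pos _).le) (Finset.mem_univ i)).trans h)
  conv_lhs => rw [h3]
  rw [dotProduct_conj_diagonal, dotProduct_eq_sum_transpose_mulVec h2, Finset.mul_sum,
    Finset.mul_sum, Finset.mul_sum]
  refine Finset.sum_le_sum fun i _ => ?_
  have := mul_le_mul_of_nonneg_right (hl i) (mul_self_nonneg ((Uᵀ *ᵥ v) i))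
  linarith

/-- A bound for the inverse quadratic form (in variational form) from a scalar inequality
on the spectrum. -/
lemma two_mul_sub_quadForm_le {S : Matrix κ κ ℝ} (hS : Sᵀ = S) {A B w θ : ℝ} (hw : 0 ≤ w)
    (h : ∀ c, (∃ v : κ → ℝ, v ⬝ᵥ v = 1 ∧ v ⬝ᵥ (S *ᵥ v) = c) →
      0 < c ∧ 1 / c ≤ A - B * c + w * Real.exp (-θ * c)) (z p : κ → ℝ) :
    2 * (z ⬝ᵥ p) - p ⬝ᵥ (S *ᵥ p) ≤
      A * (z ⬝ᵥ z) - B * (z ⬝ᵥ (S *ᵥ z)) +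
        w * (NormedSpace.exp ((-θ) • S)).trace * (z ⬝ᵥ z) := by
  obtain ⟨U, lam, h1, h2, h3, h4⟩ := exists_diagonalization hS
  have hlam : ∀ i, 0 < lam i ∧ 1 / lam i ≤ A - B * lam i + w * Real.exp (-θ * lam i) := by
    intro i
    refine h _ ⟨U *ᵥ Pi.single i 1, ?_, ?_⟩
    · rw [dotProduct_eq_sum_transpose_mulVec h2, Matrix.mulVec_mulVec, h1, Matrix.one_mulVec]
      simp [Pi.single_apply]
    · conv_lhs => rw [h3]
      rw [dotProduct_conj_diagonal, Matrix.mulVec_mulVec, h1, Matrix.one_mulVec]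
      simp [Pi.single_apply]
  -- Enlarging the matrix exponential to its trace makes this term a multiple of |z|², so a single
  -- scalar event controls all directions z.
  have hE : ∀ i, Real.exp (-θ * lam i) ≤ (NormedSpace.exp ((-θ) • S)).trace := by
    intro i
    rw [h4, trace_conj_diagonal h1]
    exact Finset.single_le_sum (f := fun i => Real.exp (-θ * lam i))
      (fun j _ => (Real.exp_pos _).le) (Finset.mem_univ i)
  set τ := (NormedSpace.exp ((-θ) • S)).trace
  clear_value τ
  rw [h3, dotProduct_conj_diagonal, dotProduct_conj_diagonal, dotProduct_eq_sum_transpose_mulVec h2,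
    dotProduct_eq_sum_transpose_mulVec h2, Finset.mul_sum, Finset.mul_sum, Finset.mul_sum,
    Finset.mul_sum, ← Finset.sum_sub_distrib, ← Finset.sum_sub_distrib, ← Finset.sum_add_distrib]
  refine Finset.sum_le_sum fun i _ => ?_
  obtain ⟨hp, hi⟩ := hlam i
  set a := (Uᵀ *ᵥ z) i
  set b := (Uᵀ *ᵥ p) i
  have k1 : 2 * (a * b) - lam i * (b * b) ≤ 1 / lam i * (a * a) := by
    have : 1 / lam i * (a * a) - (2 * (a * b) - lam i * (b * b))
        = (a - lam i * b) ^ 2 / lam i := by field_simp; ring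
    have h0 : 0 ≤ (a - lam i * b) ^ 2 / lam i := by positivity
    linarith
  have k2 : 1 / lam i ≤ A - B * lam i + w * τ :=
    hi.trans (by have := mul_le_mul_of_nonneg_left (hE i) hw; linarith)
  have := mul_le_mul_of_nonneg_right k2 (mul_self_nonneg a)
  linarith

/-- The rescaled Gram matrix of the sampled rows with sample indices in `T`. -/
def sampleGram {β ι : Type*} [Fintype β] (u : β → κ → ℝ) (T : Finset ι) (J : ι → β) :
    Matrix κ κ ℝ :=
  (Fintype.card β / T.card : ℝ) • ∑ i ∈ T, vecMulVec (u (J i)) (u (J i))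

lemma sampleGram_transpose {κ β ι : Type*} [Fintype β] (u : β → κ → ℝ) (T : Finset ι) (J : ι → β) :
    (sampleGram u T J)ᵀ = sampleGram u T J := by
  unfold sampleGram
  rw [Matrix.transpose_smul, Matrix.transpose_sum]
  simp only [Matrix.transpose_vecMulVec]

/-- The exponent in Chernoff bounds for Poisson-like tails. -/
def poissonRate (x : ℝ) : ℝ := x * Real.log x - x + 1

/-- A uniformly sampled isotropic family of vectors with bounded norms. `N` bounds from below the
number of samples in `T`, in units of the coherence. -/
structure IsSampling {β : Type*} [Fintype β] (u : β → κ → ℝ) (R : ℝ) : Prop where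
  nonempty : Nonempty β
  isotropic : ∑ j, vecMulVec (u j) (u j) = 1
  pos : 0 < R
  bound : ∀ j, Fintype.card β * (u j ⬝ᵥ u j) ≤ R

variable {β ι : Type*} [Fintype β] [Fintype ι] [DecidableEq ι] {u : β → κ → ℝ} {R : ℝ}

lemma IsSampling.sum_trace_exp_le (hu : IsSampling u R) {N : ℝ} (hN : 0 < N) {T : Finset ι}
    (hT : N * R ≤ T.card) (θ : ℝ) :
    ∑ J : ι → β, (NormedSpace.exp (θ • sampleGram u T J)).trace
      ≤ (Fintype.card β : ℝ) ^ Fintype.card ι *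
        (Fintype.card κ * Real.exp (N * (Real.exp (θ / N) - 1))) :=
  haveI := hu.nonempty
  sum_trace_exp_sample_le u hu.isotropic hu.pos hu.bound hN T hT θ

/-- Chernoff bound for the extreme eigenvalues of a sampled Gram matrix. -/
lemma IsSampling.failCount_le (hu : IsSampling u R) {N : ℝ} (hN : 0 < N) {T : Finset ι}
    (hT : N * R ≤ T.card) {x : ℝ} (hx : 0 < x) :
    failCount (fun J : ι → β => ∀ v, Real.log x * (v ⬝ᵥ (sampleGram u T J *ᵥ v)) ≤
        Real.log x * (x * (v ⬝ᵥ v)))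
      ≤ (Fintype.card β : ℝ) ^ Fintype.card ι *
        (Fintype.card κ * Real.exp (-(N * poissonRate x))) := by
  -- The choice θ = N log x minimizes the exponent N (exp(θ/N) - 1) - θ x, and the minimum is -N
  -- h(x).
  have h1 := hu.sum_trace_exp_le hN hT (N * Real.log x)
  rw [mul_div_cancel_left₀ _ hN.ne', Real.exp_log hx] at h1
  have h2 := (mul_failCount_le_sum (fun J : ι → β => trace_exp_nonneg
    (S := (N * Real.log x) • sampleGram u T J)
    (by rw [Matrix.transpose_smul, sampleGram_transpose])) (Real.exp (N * Real.log x * x))).trans h1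
  have h3 : failCount (fun J : ι → β => ∀ v, Real.log x * (v ⬝ᵥ (sampleGram u T J *ᵥ v)) ≤
        Real.log x * (x * (v ⬝ᵥ v))) ≤ failCount (fun J : ι → β =>
        (NormedSpace.exp ((N * Real.log x) • sampleGram u T J)).trace ≤
        Real.exp (N * Real.log x * x)) := by
    refine failCount_mono fun J hJ v => ?_
    have := mul_quadForm_le_of_trace_exp_le (sampleGram_transpose u T J) hJ v
    rw [mul_assoc, mul_assoc] at this
    exact le_of_mul_le_mul_left this hN
  refine h3.trans ?_
  rw [← mul_le_mul_iff_right₀ (Real.exp_pos (N * Real.log x * x))]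
  refine h2.trans (le_of_eq ?_)
  have : Real.exp (N * (x - 1)) =
      Real.exp (N * Real.log x * x) * Real.exp (-(N * poissonRate x)) := by
    rw [← Real.exp_add]
    congr 1
    unfold poissonRate
    ring
  rw [this]
  ring

lemma IsSampling.failCount_lower_le (hu : IsSampling u R) {N : ℝ} (hN : 0 < N) {T : Finset ι}
    (hT : N * R ≤ T.card) {l : ℝ} (hl0 : 0 < l) (hl1 : l < 1) :
    failCount (fun J : ι → β => ∀ v, l * (v ⬝ᵥ v) ≤ v ⬝ᵥ (sampleGram u T J *ᵥ v))
      ≤ (Fintype.card β : ℝ) ^ Fintype.card ι *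
        (Fintype.card κ * Real.exp (-(N * poissonRate l))) := by
  refine (failCount_mono fun J hJ v => ?_).trans (hu.failCount_le hN hT hl0)
  exact (mul_le_mul_left_of_neg (Real.log_neg hl0 hl1)).1 (hJ v)

lemma IsSampling.failCount_upper_le (hu : IsSampling u R) {N : ℝ} (hN : 0 < N) {T : Finset ι}
    (hT : N * R ≤ T.card) {l : ℝ} (hl1 : 1 < l) :
    failCount (fun J : ι → β => ∀ v, v ⬝ᵥ (sampleGram u T J *ᵥ v) ≤ l * (v ⬝ᵥ v))
      ≤ (Fintype.card β : ℝ) ^ Fintype.card ι *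
        (Fintype.card κ * Real.exp (-(N * poissonRate l))) := by
  refine (failCount_mono fun J hJ v => ?_).trans (hu.failCount_le hN hT (by linarith : 0 < l))
  exact (mul_le_mul_iff_right₀ (Real.log_pos hl1)).1 (hJ v)

end Sampling

/-! ### Failure costs of the bounds for local and pooled Gram matrices -/

section Workers

open Matrix

/-- The sample indices of worker `i`. -/
def workerIndices (m s : ℕ) (i : Fin m) : Finset (Fin m × Fin s) :=
  Finset.univ.map ⟨fun k => (i, k), fun _ _ h => (Prod.ext_iff.1 h).2⟩

lemma card_workerIndices (m s : ℕ) (i : Fin m) : (workerIndices m s i).card = s := by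
  simp [workerIndices]

lemma sum_workerIndices {M : Type*} [AddCommMonoid M] {m s : ℕ} (i : Fin m)
    (f : Fin m × Fin s → M) : ∑ p ∈ workerIndices m s i, f p = ∑ k, f (i, k) := by
  rw [workerIndices, Finset.sum_map]
  rfl

variable {κ : Type*} [Fintype κ] [DecidableEq κ] {β : Type*} [Fintype β] {u : β → κ → ℝ} {R : ℝ}

lemma sum_sampleGram_workerIndices {κ β : Type*} [Fintype β] (u : β → κ → ℝ) {m s : ℕ}
    (J : Fin m × Fin s → β) :
    ∑ i, sampleGram u (workerIndices m s i) J = (m : ℝ) • sampleGram u Finset.univ J := by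
  rcases Nat.eq_zero_or_pos m with rfl | hm
  · simp
  have hm' : (m : ℝ) ≠ 0 := by positivity
  simp only [sampleGram, card_workerIndices]
  rw [← Finset.smul_sum, Fintype.sum_prod_type, smul_smul]
  congr 1
  · simp only [Finset.card_univ, Fintype.card_prod, Fintype.card_fin, Nat.cast_mul]
    rw [mul_div_assoc', mul_div_mul_left _ _ hm']
  · refine Finset.sum_congr rfl fun i _ => ?_
    rw [sum_workerIndices]

lemma sum_quadForm_workerIndices {κ : Type*} [Fintype κ] (u : β → κ → ℝ) {m s : ℕ}
    (J : Fin m × Fin s → β) (z : κ → ℝ) :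
    ∑ i, z ⬝ᵥ (sampleGram u (workerIndices m s i) J *ᵥ z) =
      m * (z ⬝ᵥ (sampleGram u (Finset.univ : Finset (Fin m × Fin s)) J *ᵥ z)) := by
  rw [← dotProduct_sum, ← Matrix.sum_mulVec, sum_sampleGram_workerIndices,
    Matrix.smul_mulVec, dotProduct_smul, smul_eq_mul]

/-- The samples of every worker determine its Gram matrix from below, and the averaged inverse
quadratic forms are at most `q` times the identity. The inverse forms enter through upper bounds
`b i` for their variational expressions. -/
def UpperGood {m s : ℕ} (u : β → κ → ℝ) (q : ℝ) (J : Fin m × Fin s → β) : Prop :=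
  (∃ l, 0 < l ∧ ∀ i v, l * (v ⬝ᵥ v) ≤ v ⬝ᵥ (sampleGram u (workerIndices m s i) J *ᵥ v)) ∧
  ∃ b : Fin m → (κ → ℝ) → ℝ,
    (∀ i z p, 2 * (z ⬝ᵥ p) - p ⬝ᵥ (sampleGram u (workerIndices m s i) J *ᵥ p) ≤ b i z) ∧
    ∀ z, ∑ i, b i z ≤ m * (q * (z ⬝ᵥ z))

/-- The averaged Gram matrix is at most `1 / q` times the identity. -/
def LowerGood {m s : ℕ} (u : β → κ → ℝ) (q : ℝ) (J : Fin m × Fin s → β) : Prop :=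
  q ≤ 0 ∨ ∀ v, q * (v ⬝ᵥ (sampleGram u (Finset.univ : Finset (Fin m × Fin s)) J *ᵥ v)) ≤ v ⬝ᵥ v

/-- Available bounds for the (normalized) failure probability of `UpperGood`. -/
inductive UpperCost (m N T q : ℝ) : ℝ → Prop
  | direct (hq : 1 < q) : UpperCost m N T q (Real.exp (T - N * poissonRate (1 / q)))
  | soft (θ A w l : ℝ) (hl0 : 0 < l) (hl1 : l < 1) (hw : 0 < w) (hA : A < q)
      (h : ∀ c, l ≤ c → 1 / c ≤ A + w * Real.exp (-θ * c)) :
      UpperCost m N T q (Real.exp (T - N * poissonRate l) +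
        Real.exp T / m * (w * Real.exp (N * (Real.exp (-θ / N) - 1)) / (q - A)))
  | chord (l r ε : ℝ) (hl0 : 0 < l) (hl1 : l < 1) (hr : 1 < r) (hε0 : 0 < ε) (hε1 : ε < 1)
      (h : (l + r - 1 + ε) / (l * r) ≤ q) :
      UpperCost m N T q (Real.exp (T - N * poissonRate l) + Real.exp (T - N * poissonRate r) +
        Real.exp (T - m * N * poissonRate (1 - ε)) / m)

/-- Available bounds for the (normalized) failure probability of `LowerGood`. -/
inductive LowerCost (m N T q : ℝ) : ℝ → Prop
  | trivial (hq : q ≤ 0) : LowerCost m N T q 0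
  | tail (hq0 : 0 < q) (hq : q < 1) :
      LowerCost m N T q (Real.exp (T - m * N * poissonRate (1 / q)) / m)

lemma exp_neg_eq_mul_exp_sub (T a : ℝ) : Real.exp (-a) = Real.exp (-T) * Real.exp (T - a) := by
  rw [← Real.exp_add]; congr 1; ring

variable {m s : ℕ} {N T q c : ℝ}

lemma failCount_workers_lower_le (hu : IsSampling u R) (hN : 0 < N) (hs : N * R ≤ s)
    {l : ℝ} (hl0 : 0 < l) (hl1 : l < 1) :
    failCount (fun J : Fin m × Fin s → β => ∀ i v,
        l * (v ⬝ᵥ v) ≤ v ⬝ᵥ (sampleGram u (workerIndices m s i) J *ᵥ v))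
      ≤ (Fintype.card β : ℝ) ^ (m * s) * (m * Fintype.card κ * Real.exp (-T)) *
        Real.exp (T - N * poissonRate l) := by
  refine (failCount_forall_le _).trans ((Finset.sum_le_sum fun i _ =>
    hu.failCount_lower_le hN (by rwa [card_workerIndices]) hl0 hl1).trans (le_of_eq ?_))
  simp only [Finset.sum_const, Finset.card_univ, Fintype.card_prod, Fintype.card_fin, nsmul_eq_mul]
  rw [exp_neg_eq_mul_exp_sub T]
  ring

lemma failCount_workers_upper_le (hu : IsSampling u R) (hN : 0 < N) (hs : N * R ≤ s)
    {l : ℝ} (hl1 : 1 < l) :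
    failCount (fun J : Fin m × Fin s → β => ∀ i v,
        v ⬝ᵥ (sampleGram u (workerIndices m s i) J *ᵥ v) ≤ l * (v ⬝ᵥ v))
      ≤ (Fintype.card β : ℝ) ^ (m * s) * (m * Fintype.card κ * Real.exp (-T)) *
        Real.exp (T - N * poissonRate l) := by
  refine (failCount_forall_le _).trans ((Finset.sum_le_sum fun i _ =>
    hu.failCount_upper_le hN (by rwa [card_workerIndices]) hl1).trans (le_of_eq ?_))
  simp only [Finset.sum_const, Finset.card_univ, Fintype.card_prod, Fintype.card_fin, nsmul_eq_mul]
  rw [exp_neg_eq_mul_exp_sub T]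
  ring

lemma failCount_average_lower_le (hu : IsSampling u R) (hm : 0 < m) (hN : 0 < N) (hs : N * R ≤ s)
    {l : ℝ} (hl0 : 0 < l) (hl1 : l < 1) :
    failCount (fun J : Fin m × Fin s → β => ∀ v, l * (v ⬝ᵥ v) ≤
        v ⬝ᵥ (sampleGram u (Finset.univ : Finset (Fin m × Fin s)) J *ᵥ v))
      ≤ (Fintype.card β : ℝ) ^ (m * s) * (m * Fintype.card κ * Real.exp (-T)) *
        (Real.exp (T - m * N * poissonRate l) / m) := by
  have hm' : (0 : ℝ) < m := by exact_mod_cast hm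
  refine (hu.failCount_lower_le (N := m * N) (by positivity) ?_ hl0 hl1).trans (le_of_eq ?_)
  · simp only [Finset.card_univ, Fintype.card_prod, Fintype.card_fin, Nat.cast_mul, mul_assoc]
    gcongr
  · simp only [Fintype.card_prod, Fintype.card_fin]
    rw [exp_neg_eq_mul_exp_sub T]
    field_simp

lemma failCount_average_upper_le (hu : IsSampling u R) (hm : 0 < m) (hN : 0 < N) (hs : N * R ≤ s)
    {l : ℝ} (hl1 : 1 < l) :
    failCount (fun J : Fin m × Fin s → β => ∀ v,
        v ⬝ᵥ (sampleGram u (Finset.univ : Finset (Fin m × Fin s)) J *ᵥ v) ≤ l * (v ⬝ᵥ v))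
      ≤ (Fintype.card β : ℝ) ^ (m * s) * (m * Fintype.card κ * Real.exp (-T)) *
        (Real.exp (T - m * N * poissonRate l) / m) := by
  have hm' : (0 : ℝ) < m := by exact_mod_cast hm
  refine (hu.failCount_upper_le (N := m * N) (by positivity) ?_ hl1).trans (le_of_eq ?_)
  · simp only [Finset.card_univ, Fintype.card_prod, Fintype.card_fin, Nat.cast_mul, mul_assoc]
    gcongr
  · simp only [Fintype.card_prod, Fintype.card_fin]
    rw [exp_neg_eq_mul_exp_sub T]
    field_simp

lemma LowerCost.failCount_le (hc : LowerCost m N T q c) (hu : IsSampling u R) (hm : 0 < m)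
    (hN : 0 < N) (hs : N * R ≤ s) :
    failCount (fun J : Fin m × Fin s → β => LowerGood u q J)
      ≤ (Fintype.card β : ℝ) ^ (m * s) * (m * Fintype.card κ * Real.exp (-T)) * c := by
  cases hc with
  | trivial hq =>
    rw [failCount_true_le (p := fun J : Fin m × Fin s → β => LowerGood u q J) fun J => Or.inl hq]
    simp
  | tail hq0 hq =>
    refine (failCount_mono fun J hJ => Or.inr fun v => ?_).trans
      (failCount_average_upper_le hu hm hN hs ((one_lt_div hq0).2 hq))
    have := mul_le_mul_of_nonneg_left (hJ v) hq0.le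
    rwa [← mul_assoc, mul_one_div_cancel hq0.ne', one_mul] at this

/-- A lower bound for the Gram matrices and a scalar inequality bound the variational expressions. -/
lemma UpperGood.of_scalar {J : Fin m × Fin s → β} {l A B w θ : ℝ} (hl : 0 < l) (hw : 0 ≤ w)
    (h1 : ∀ i v, l * (v ⬝ᵥ v) ≤ v ⬝ᵥ (sampleGram u (workerIndices m s i) J *ᵥ v))
    (h2 : ∀ i c, l ≤ c → (∃ v : κ → ℝ, v ⬝ᵥ v = 1 ∧
      v ⬝ᵥ (sampleGram u (workerIndices m s i) J *ᵥ v) = c) →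
      1 / c ≤ A - B * c + w * Real.exp (-θ * c))
    (h3 : ∀ z : κ → ℝ, A * (m * (z ⬝ᵥ z)) -
      B * (m * (z ⬝ᵥ (sampleGram u (Finset.univ : Finset (Fin m × Fin s)) J *ᵥ z))) +
      w * (∑ i, (NormedSpace.exp ((-θ) • sampleGram u (workerIndices m s i) J)).trace) * (z ⬝ᵥ z)
        ≤ m * (q * (z ⬝ᵥ z))) : UpperGood u q J := by
  refine ⟨⟨l, hl, h1⟩, fun i z => A * (z ⬝ᵥ z) -
      B * (z ⬝ᵥ (sampleGram u (workerIndices m s i) J *ᵥ z)) +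
        w * (NormedSpace.exp ((-θ) • sampleGram u (workerIndices m s i) J)).trace * (z ⬝ᵥ z),
    fun i z p => ?_, fun z => le_trans (le_of_eq ?_) (h3 z)⟩
  · refine two_mul_sub_quadForm_le (sampleGram_transpose _ _ _) hw ?_ z p
    rintro c ⟨v, hv1, hv2⟩
    have hc : l ≤ c := by simpa [hv1, hv2] using h1 i v
    exact ⟨hl.trans_le hc, h2 i c hc ⟨v, hv1, hv2⟩⟩
  · rw [Finset.sum_add_distrib, Finset.sum_sub_distrib, ← Finset.mul_sum, ← Finset.sum_mul,
      ← Finset.mul_sum, sum_quadForm_workerIndices, ← Finset.mul_sum]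
    simp only [Finset.sum_const, Finset.card_univ, Fintype.card_fin, nsmul_eq_mul]

lemma UpperCost.failCount_le (hc : UpperCost m N T q c) (hu : IsSampling u R) (hm : 0 < m)
    (hN : 0 < N) (hs : N * R ≤ s) :
    failCount (fun J : Fin m × Fin s → β => UpperGood u q J)
      ≤ (Fintype.card β : ℝ) ^ (m * s) * (m * Fintype.card κ * Real.exp (-T)) * c := by
  have hm' : (0 : ℝ) < m := by exact_mod_cast hm
  have hvv : ∀ v : κ → ℝ, 0 ≤ v ⬝ᵥ v := fun v => by simpa using dotProduct_star_self_nonneg v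
  cases hc with
  -- Every S_i is at least 1/q, so every inverse is at most q separately; nothing is gained from
  -- averaging.
  | direct hq =>
    have hq0 : 0 < q := by linarith
    refine (failCount_mono fun J hJ => ?_).trans (failCount_workers_lower_le hu hN hs
      (l := 1 / q) (by positivity) ((div_lt_one hq0).2 hq))
    refine UpperGood.of_scalar (A := q) (B := 0) (w := 0) (θ := 0) (by positivity) le_rfl hJ ?_ ?_
    · intro i c hc _
      have : 1 / c ≤ q := by
        rw [div_le_comm₀ (lt_of_lt_of_le (by positivity) hc) hq0]
        exact hc
      simpa using this
    · intro z
      have : q * (m * (z ⬝ᵥ z)) ≤ m * (q * (z ⬝ᵥ z)) := le_of_eq (by ring)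
      simpa using this
  -- The average of A + w tr exp(-θ S_i) must stay below q. Markov's inequality is applied to the
  -- sum of the traces over the machines at the threshold m (q - A)/w; compared with a union bound
  -- over machines this gains a factor 1/m. The cruder event S_i ≥ l only ensures that the majorant
  -- of 1/c is valid.
  | soft θ A w l hl0 hl1 hw hA h =>
    have h1 := failCount_workers_lower_le (m := m) (T := T) hu hN hs hl0 hl1
    have htr : ∀ (i : Fin m) (J : Fin m × Fin s → β),
        0 ≤ (NormedSpace.exp ((-θ) • sampleGram u (workerIndices m s i) J)).trace := fun i J =>
      trace_exp_nonneg (by rw [Matrix.transpose_smul, sampleGram_transpose])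
    have h2 := mul_failCount_le_sum (Λ := Fin m × Fin s → β)
      (f := fun J => ∑ i, (NormedSpace.exp ((-θ) • sampleGram u (workerIndices m s i) J)).trace)
      (fun J => Finset.sum_nonneg fun i _ => htr i J) (m * ((q - A) / w))
    have h3 : ∑ J : Fin m × Fin s → β, ∑ i,
        (NormedSpace.exp ((-θ) • sampleGram u (workerIndices m s i) J)).trace ≤
        m * ((Fintype.card β : ℝ) ^ (m * s) *
        (Fintype.card κ * Real.exp (N * (Real.exp (-θ / N) - 1)))) := by
      rw [Finset.sum_comm]
      refine (Finset.sum_le_sum fun i _ => hu.sum_trace_exp_le hN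
        (by rwa [card_workerIndices]) (-θ)).trans (le_of_eq ?_)
      simp [Fintype.card_prod]
    have hqA : 0 < q - A := sub_pos.2 hA
    have h4 : failCount (fun J : Fin m × Fin s → β => ∑ i,
        (NormedSpace.exp ((-θ) • sampleGram u (workerIndices m s i) J)).trace ≤
          m * ((q - A) / w)) ≤
        (Fintype.card β : ℝ) ^ (m * s) * (m * Fintype.card κ * Real.exp (-T)) *
          (Real.exp T / m * (w * Real.exp (N * (Real.exp (-θ / N) - 1)) / (q - A))) := by
      rw [← mul_le_mul_iff_right₀ (show 0 < m * ((q - A) / w) by positivity)]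
      refine (h2.trans h3).trans (le_of_eq ?_)
      have : Real.exp (-T) * Real.exp T = 1 := by rw [← Real.exp_add]; simp
      calc _ = (Real.exp (-T) * Real.exp T) * (m * ((Fintype.card β : ℝ) ^ (m * s) *
        (Fintype.card κ * Real.exp (N * (Real.exp (-θ / N) - 1))))) := by rw [this, one_mul]
        _ = _ := by field_simp
    rw [mul_add]
    refine (failCount_mono fun J hJ => ?_).trans ((failCount_and_le _ _).trans (add_le_add h1 h4))
    refine UpperGood.of_scalar (A := A) (B := 0) (θ := θ) hl0 hw.le hJ.1 ?_ ?_
    · intro i c hc _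
      simpa using h c hc
    · intro z
      have := mul_le_mul_of_nonneg_right (mul_le_mul_of_nonneg_left hJ.2 hw.le) (hvv z)
      rw [show w * (m * ((q - A) / w)) = m * (q - A) by field_simp] at this
      linarith
  -- On [l, r] the convex function 1/c lies below its chord (l + r - c)/(l r). The chord is linear
  -- in the Gram matrix, so after averaging only the pooled matrix, at least 1 - ε, matters.
  | chord l r ε hl0 hl1 hr hε0 hε1 h =>
    have h1 := failCount_workers_lower_le (m := m) (T := T) hu hN hs hl0 hl1
    have h2 := failCount_workers_upper_le (m := m) (T := T) hu hN hs hr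
    have h3 := failCount_average_lower_le (m := m) (T := T) hu hm hN hs
      (l := 1 - ε) (by linarith) (by linarith)
    rw [mul_add, mul_add]
    refine (failCount_mono fun J hJ => ?_).trans ((failCount_and_le _ _).trans
      (add_le_add ((failCount_and_le _ _).trans (add_le_add h1 h2)) h3))
    obtain ⟨⟨hJ1, hJ2⟩, hJ3⟩ := hJ
    have hr0 : 0 < r := by linarith
    refine UpperGood.of_scalar (A := (l + r) / (l * r)) (B := 1 / (l * r)) (w := 0) (θ := 0)
      hl0 le_rfl hJ1 ?_ ?_
    · rintro i c hc ⟨v, hv1, hv2⟩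
      have hcr : c ≤ r := by simpa [hv1, hv2] using hJ2 i v
      have hc0 : 0 < c := hl0.trans_le hc
      rw [zero_mul, add_zero, one_div_mul_eq_div, ← sub_div, div_le_div_iff₀ hc0 (by positivity)]
      nlinarith [mul_nonneg (sub_nonneg.2 hc) (sub_nonneg.2 hcr)]
    · intro z
      have h4 := hJ3 z
      rw [zero_mul, zero_mul, add_zero]
      have h5 : (l + r) / (l * r) * (z ⬝ᵥ z) - 1 / (l * r) * ((1 - ε) * (z ⬝ᵥ z))
          ≤ q * (z ⬝ᵥ z) := by
        refine le_trans (le_of_eq ?_) (mul_le_mul_of_nonneg_right h (hvv z))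
        ring
      have h6 : 1 / (l * r) * ((1 - ε) * (z ⬝ᵥ z)) ≤ 1 / (l * r) *
        (z ⬝ᵥ (sampleGram u (Finset.univ : Finset (Fin m × Fin s)) J *ᵥ z)) := by gcongr
      have h7 := mul_le_mul_of_nonneg_left (h5.trans' (sub_le_sub_left h6 _)) hm'.le
      linarith

end Workers

/-! ### Contraction of a sandwiched approximate Newton step -/

section Deterministic

/-- Pairs of bounds `q₁ ≤ M ≤ q₂` on the preconditioned averaged inverse (relative to the inverse
Hessian) that suffice for the contraction rate `2 α √κ`. -/
inductive Admissible (α : ℝ) : ℝ → ℝ → Prop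
  | symm (a : ℝ) (ha : 0 < a) (h : a ^ 2 * (1 + 3 / 4 * α) ≤ 3 / 2 * α ^ 2) :
      Admissible α (1 - a) (1 + a)
  | large (p q : ℝ) (hα : 1 / 2 ≤ α) (hp : p ≤ 1) (hpq : 2 ≤ p + q)
      (h : 1.25 * ((p + q) / 2) - 1 + 1.4362 * ((q - p) / 2) ≤ 2 * α) : Admissible α p q

lemma Admissible.le {α p q : ℝ} (h : Admissible α p q) : p ≤ 1 ∧ 2 ≤ p + q := by
  cases h with
  | symm a ha h => constructor <;> linarith
  | large _ _ hα hp hpq h => exact ⟨hp, hpq⟩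

/-- Here K stands for √κ and θ for L ‖Δ‖/σ. Let x be the maximum on the right. In the symmetric case
α ≤ x/2 and θ ≤ x/3, so the Newton error uses x/4, and the condition on a is exactly what makes the
spectral term at most 3x/4. In the other case 2αK ≥ 1 ≥ 3θ, so the first entry of the maximum is the
target. -/
lemma Admissible.rate_le {α p q K θ : ℝ} (h : Admissible α p q) (hα : 0 < α) (hK : 1 ≤ K)
    (hθ0 : 0 ≤ θ) (hθ : θ ≤ 1 / 3) :
    (p + q) / 2 - 1 + 3 / 4 * ((p + q) / 2) * θ +
      (q - p) / 2 * √(3 / 2 * (K ^ 2 + 9 / 8 * θ)) ≤ max (2 * α * K) (3 * θ) := by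
  cases h with
  | symm a ha h =>
    have hc : (1 - a + (1 + a)) / 2 = 1 := by ring
    have hr : (1 + a - (1 - a)) / 2 = a := by ring
    rw [hc, hr]
    set x := max (2 * α * K) (3 * θ) with hx
    have hx1 : 2 * α * K ≤ x := le_max_left _ _
    have hx2 : 3 * θ ≤ x := le_max_right _ _
    have hαK : 0 < α * K := by positivity
    have hx0 : 0 < x := by linarith
    have hxα : 2 * α ≤ x := by nlinarith
    have key : a * √(3 / 2 * (K ^ 2 + 9 / 8 * θ)) ≤ 3 / 4 * x := by
      rw [← Real.sqrt_sq ha.le, ← Real.sqrt_mul (sq_nonneg a)]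
      refine Real.sqrt_le_iff.2 ⟨by positivity, ?_⟩
      have h1 : K ^ 2 * α ^ 2 ≤ x ^ 2 / 4 := by nlinarith
      have h2 : θ * α ≤ x ^ 2 / 6 := by nlinarith
      have h3 : α ^ 2 * (K ^ 2 + 9 / 8 * θ) ≤ x ^ 2 / 4 * (1 + 3 / 4 * α) := by nlinarith
      have h4 : a ^ 2 * (α ^ 2 * (K ^ 2 + 9 / 8 * θ)) ≤ x ^ 2 / 4 * (3 / 2 * α ^ 2) :=
        calc _ ≤ a ^ 2 * (x ^ 2 / 4 * (1 + 3 / 4 * α)) := by gcongr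
          _ = x ^ 2 / 4 * (a ^ 2 * (1 + 3 / 4 * α)) := by ring
          _ ≤ _ := by gcongr
      have hα2 : 0 < α ^ 2 := by positivity
      have h5 : α ^ 2 * (a ^ 2 * (3 / 2 * (K ^ 2 + 9 / 8 * θ))) ≤ α ^ 2 * (3 / 4 * x) ^ 2 := by
        linarith
      exact le_of_mul_le_mul_left h5 hα2
    linarith
  | large _ _ hα hp hpq h =>
    refine le_trans ?_ (le_max_left _ _)
    have hr : 0 ≤ (q - p) / 2 := by linarith
    -- The worst case is θ = 1/3, K = 1, where the root is √33/4 < 1.4362.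
    have h1 : √(3 / 2 * (K ^ 2 + 9 / 8 * θ)) ≤ 1.4362 * K := by
      refine Real.sqrt_le_iff.2 ⟨by positivity, ?_⟩
      nlinarith
    have h2 : (q - p) / 2 * √(3 / 2 * (K ^ 2 + 9 / 8 * θ)) ≤ (q - p) / 2 * (1.4362 * K) :=
      mul_le_mul_of_nonneg_left h1 hr
    have h3 : 3 / 4 * ((p + q) / 2) * θ ≤ 3 / 4 * ((p + q) / 2) * (1 / 3) :=
      mul_le_mul_of_nonneg_left hθ (by linarith)
    have h4 := mul_le_mul_of_nonneg_right h (by linarith : 0 ≤ K)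
    have h5 : 1.25 * ((p + q) / 2) - 1 ≤ (1.25 * ((p + q) / 2) - 1) * K :=
      le_mul_of_one_le_right (by linarith) hK
    linarith

variable {E : Type*} [NormedAddCommGroup E] [InnerProductSpace ℝ E]

/-- Cauchy–Schwarz for a symmetric form dominated by a positive one. -/
lemma abs_inner_le_of_dominated {Q K : E →ₗ[ℝ] E} (hQ : Q.IsSymmetric) (hK : K.IsSymmetric)
    (hKpos : ∀ v, 0 ≤ inner ℝ v (K v)) {r : ℝ} (hr : 0 ≤ r) (h : ∀ v, |inner ℝ v (Q v)| ≤ r * inner ℝ v (K v)) (a b : E) :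
    |inner ℝ a (Q b)| ≤ r * (√(inner ℝ a (K a)) * √(inner ℝ b (K b))) := by
  -- Polarization: combining the bounds at ta + b and ta - b leaves a quadratic in t that is
  -- nonnegative; its discriminant is the claim.
  have hq : ∀ t : ℝ, 0 ≤ (r * inner ℝ a (K a)) * (t * t) + (-2 * inner ℝ a (Q b)) * t + r * inner ℝ b (K b) := by
    intro t
    have h1 := (abs_le.1 (h (t • a + b))).2
    have h2 := (abs_le.1 (h (t • a - b))).1
    have e1 : inner ℝ b (Q a) = inner ℝ a (Q b) := by rw [← hQ, real_inner_comm]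
    have e2 : inner ℝ b (K a) = inner ℝ a (K b) := by rw [← hK, real_inner_comm]
    simp only [map_add, map_sub, map_smul, inner_add_left, inner_add_right, inner_sub_left,
      inner_sub_right, real_inner_smul_left, real_inner_smul_right, e1, e2] at h1 h2
    nlinarith
  have hd := discrim_le_zero hq
  unfold discrim at hd
  have h3 : inner ℝ a (Q b) ^ 2 ≤ (r * (√(inner ℝ a (K a)) * √(inner ℝ b (K b)))) ^ 2 := by
    rw [mul_pow, mul_pow, Real.sq_sqrt (hKpos a), Real.sq_sqrt (hKpos b)]
    nlinarith
  exact abs_le_of_sq_le_sq h3 (by positivity)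

/-- Contraction of an approximate Newton step whose averaged inverse is sandwiched. -/
lemma norm_newton_step_le {H K M : E →ₗ[ℝ] E} (hH : H.IsSymmetric) (hM : M.IsSymmetric)
    (hHK : ∀ v, H (K v) = v) {α p q : ℝ} (hadm : Admissible α p q) (hα : 0 < α)
    (hlow : ∀ v, p * inner ℝ v (K v) ≤ inner ℝ v (M v)) (hup : ∀ v, inner ℝ v (M v) ≤ q * inner ℝ v (K v))
    {σ σ' L : ℝ} (hσ : 0 < σ) (hσ' : σ ≤ σ') (hL : 0 ≤ L) {Δ g : E} (hΔ : 3 * L * ‖Δ‖ ≤ σ)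
    (hHσ : ∀ v, 2 / 3 * σ * ‖v‖ ^ 2 ≤ inner ℝ v (H v))
    (hg : ‖g - H Δ‖ ≤ L / 2 * ‖Δ‖ ^ 2)
    (hΔg : inner ℝ Δ g ≤ σ' * ‖Δ‖ ^ 2 + L / 2 * ‖Δ‖ ^ 3) :
    ‖Δ - M g‖ ≤ max (2 * α * √(σ' / σ) * ‖Δ‖) (3 * L / σ * ‖Δ‖ ^ 2) := by
  obtain ⟨hp1, hpq⟩ := hadm.le
  set D := ‖Δ‖ with hD
  have hD0 : 0 ≤ D := norm_nonneg _
  have hKs : K.IsSymmetric := fun a b => by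
    conv_lhs => rw [← hHK b]
    rw [← hH, hHK]
  have hKH : ∀ v, inner ℝ v (K v) = inner ℝ (K v) (H (K v)) := fun v => by rw [hHK, real_inner_comm]
  have hKpos : ∀ v, 0 ≤ inner ℝ v (K v) := fun v => by
    rw [hKH]
    exact le_trans (by positivity) (hHσ (K v))
  have hKup : ∀ v, inner ℝ v (K v) ≤ 3 / 2 / σ * ‖v‖ ^ 2 := fun v => by
    have h1 := hHσ (K v)
    rw [hHK, real_inner_comm] at h1
    have h2 := real_inner_le_norm v (K v)
    have h3 : 2 / 3 * σ * ‖K v‖ ≤ ‖v‖ := by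
      by_contra hcon
      push Not at hcon
      have hpos : 0 < ‖K v‖ := by
        by_contra h0
        have : ‖K v‖ = 0 := le_antisymm (not_lt.1 h0) (norm_nonneg _)
        rw [this] at hcon
        linarith [norm_nonneg v, mul_zero (2 / 3 * σ)]
      nlinarith
    rw [div_mul_eq_mul_div, le_div_iff₀ hσ]
    nlinarith [norm_nonneg v]
  set u := K g - Δ with hu
  have hHu : H u = g - H Δ := by rw [hu, map_sub, hHK]
  have hu1 : σ * ‖u‖ ≤ 3 / 4 * L * D ^ 2 := by
    have h1 := hHσ u
    have h2 := real_inner_le_norm u (H u)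
    rw [hHu] at h2
    rw [hHu] at h1
    rcases eq_or_lt_of_le (norm_nonneg u) with h0 | h0
    · rw [← h0]
      nlinarith [mul_nonneg hL (sq_nonneg D)]
    · have h4 : ‖u‖ * ‖g - H Δ‖ ≤ ‖u‖ * (L / 2 * D ^ 2) := mul_le_mul_of_nonneg_left hg h0.le
      have h5 : ‖u‖ * (2 / 3 * σ * ‖u‖) ≤ ‖u‖ * (L / 2 * D ^ 2) := by nlinarith
      have := le_of_mul_le_mul_left h5 h0
      linarith
  set θ := L * D / σ with hθ
  have hθ0 : 0 ≤ θ := by positivity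
  have hθ1 : θ ≤ 1 / 3 := by
    rw [hθ, div_le_iff₀ hσ]
    linarith
  have hθσ : θ * σ = L * D := by rw [hθ]; field_simp
  have hu2 : ‖u‖ ≤ 3 / 4 * θ * D := by
    have : σ * ‖u‖ ≤ σ * (3 / 4 * θ * D) := by
      calc _ ≤ 3 / 4 * L * D ^ 2 := hu1
        _ = 3 / 4 * (L * D) * D := by ring
        _ = _ := by rw [← hθσ]; ring
    exact le_of_mul_le_mul_left this hσ
  set κ := σ' / σ with hκ
  have hκσ : κ * σ = σ' := by rw [hκ]; field_simp
  have hκ1 : 1 ≤ κ := (one_le_div hσ).2 hσ'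
  -- Split off ⟪Δ, g⟫, the only term that sees κ. It is bounded through σ', so the condition number
  -- at the minimizer enters rather than that of H. The constant 9/8 is 1 + (3/8)(1/3), using θ ≤
  -- 1/3.
  have hG : inner ℝ g (K g) ≤ σ * D ^ 2 * (κ + 9 / 8 * θ) := by
    have e1 : inner ℝ g (K g) = inner ℝ Δ g + inner ℝ Δ (g - H Δ) + inner ℝ u (g - H Δ) := by
      have e2 : K g = Δ + u := by rw [hu]; abel
      have e3 : inner ℝ u (H Δ) = inner ℝ Δ (g - H Δ) := by rw [← hHu, ← hH, real_inner_comm]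
      rw [e2, inner_add_right, real_inner_comm Δ g, real_inner_comm u g]
      rw [inner_sub_right u, e3]
      ring
    have h1 : inner ℝ Δ (g - H Δ) ≤ D * (L / 2 * D ^ 2) :=
      (real_inner_le_norm _ _).trans (mul_le_mul_of_nonneg_left hg hD0)
    have h2 : inner ℝ u (g - H Δ) ≤ 3 / 4 * θ * D * (L / 2 * D ^ 2) :=
      (real_inner_le_norm _ _).trans (mul_le_mul hu2 hg (norm_nonneg _) (by positivity))
    have h3 : inner ℝ g (K g) ≤ σ * D ^ 2 * (κ + θ + 3 / 8 * θ ^ 2) := by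
      rw [e1]
      have e5 : σ * D ^ 2 * (κ + θ + 3 / 8 * θ ^ 2) =
        κ * σ * D ^ 2 + (θ * σ) * D ^ 2 + 3 / 8 * θ * (θ * σ) * D ^ 2 := by ring
      rw [e5, hκσ, hθσ]
      linarith
    refine h3.trans (mul_le_mul_of_nonneg_left ?_ (by positivity))
    nlinarith
  set c := (p + q) / 2 with hc
  set r := (q - p) / 2 with hr
  have hr0 : 0 ≤ r := by rw [hr]; linarith
  have hc1 : 1 ≤ c := by rw [hc]; linarith
  set Q : E →ₗ[ℝ] E := M - c • K with hQdef
  have hQa : ∀ v, Q v = M v - c • K v := fun v => by simp [hQdef]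
  have hQs : Q.IsSymmetric := fun a b => by
    rw [hQa, hQa, inner_sub_left, inner_sub_right, real_inner_smul_left, real_inner_smul_right,
      hM, hKs]
  have hQ : ∀ v, |inner ℝ v (Q v)| ≤ r * inner ℝ v (K v) := fun v => by
    rw [hQa, inner_sub_right, real_inner_smul_right, abs_le]
    have h1 := hlow v
    have h2 := hup v
    constructor
    · have : -(r * inner ℝ v (K v)) = p * inner ℝ v (K v) - c * inner ℝ v (K v) := by rw [hr, hc]; ring
      linarith
    · have : (r * inner ℝ v (K v)) = q * inner ℝ v (K v) - c * inner ℝ v (K v) := by rw [hr, hc]; ring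
      linarith
  have hQg : ‖Q g‖ ≤ r * (D * √(3 / 2 * (√κ ^ 2 + 9 / 8 * θ))) := by
    rw [Real.sq_sqrt (by linarith)]
    have h1 := (le_abs_self _).trans (abs_inner_le_of_dominated hQs hKs hKpos hr0 hQ (Q g) g)
    rw [real_inner_self_eq_norm_sq] at h1
    have h2 : √(inner ℝ (Q g) (K (Q g))) * √(inner ℝ g (K g)) ≤ ‖Q g‖ * (D * √(3 / 2 * (κ + 9 / 8 * θ))) := by
      rw [← Real.sqrt_mul (hKpos _)]
      refine Real.sqrt_le_iff.2 ⟨by positivity, ?_⟩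
      rw [mul_pow, mul_pow, Real.sq_sqrt (by positivity)]
      calc _ ≤ 3 / 2 / σ * ‖Q g‖ ^ 2 * (σ * D ^ 2 * (κ + 9 / 8 * θ)) :=
            mul_le_mul (hKup _) hG (hKpos _) (by positivity)
        _ = _ := by field_simp
    rcases eq_or_lt_of_le (norm_nonneg (Q g)) with h0 | h0
    · rw [← h0]
      positivity
    · have h3 : ‖Q g‖ * ‖Q g‖ ≤ ‖Q g‖ * (r * (D * √(3 / 2 * (κ + 9 / 8 * θ)))) := by
        calc _ = ‖Q g‖ ^ 2 := (sq _).symm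
          _ ≤ _ := h1
          _ ≤ r * (‖Q g‖ * (D * √(3 / 2 * (κ + 9 / 8 * θ)))) := mul_le_mul_of_nonneg_left h2 hr0
          _ = _ := by ring
      exact le_of_mul_le_mul_left h3 h0
  have e : Δ - M g = (-(c - 1)) • Δ - c • u - Q g := by
    rw [hQa, hu]
    module
  have hn : ‖Δ - M g‖ ≤ (c - 1) * D + c * ‖u‖ + ‖Q g‖ := by
    rw [e]
    refine (norm_sub_le _ _).trans (add_le_add_left ((norm_sub_le _ _).trans (le_of_eq ?_)) _)
    rw [norm_smul, norm_smul, norm_neg, Real.norm_of_nonneg (by linarith : 0 ≤ c - 1),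
      Real.norm_of_nonneg (by linarith : 0 ≤ c)]
  have hfin := mul_le_mul_of_nonneg_right
    (hadm.rate_le hα (Real.one_le_sqrt.2 hκ1) hθ0 hθ1) hD0
  rw [max_mul_of_nonneg _ _ hD0] at hfin
  have e2 : 3 * θ * D = 3 * L / σ * D ^ 2 := by rw [hθ]; ring
  rw [e2] at hfin
  refine le_trans ?_ hfin
  have h3 : c * ‖u‖ ≤ c * (3 / 4 * θ * D) := mul_le_mul_of_nonneg_left hu2 (by linarith)
  rw [← hc, ← hr]
  linarith

end Deterministic

/-! ### Extreme singular values and quadratic forms -/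

section SingularValues

variable {E : Type*} [NormedAddCommGroup E] [InnerProductSpace ℝ E] [FiniteDimensional ℝ E]

/-- Expansion in an eigenbasis of the adjoint times T; the bounds by the extreme singular values
become termwise comparisons. -/
lemma norm_apply_sq_eq_sum (T : E →ₗ[ℝ] E) (v : E) :
    ‖T v‖ ^ 2 = ∑ i : Fin (Module.finrank ℝ E), T.singularValues i ^ 2 *
      (T.isSymmetric_adjoint_comp_self.eigenvectorBasis rfl).repr v i ^ 2 := by
  set hA := T.isSymmetric_adjoint_comp_self
  set e := hA.eigenvectorBasis rfl
  have h1 : ‖T v‖ ^ 2 = inner ℝ v ((LinearMap.adjoint T ∘ₗ T) v) := by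
    rw [LinearMap.comp_apply, LinearMap.adjoint_inner_right, real_inner_self_eq_norm_sq]
  rw [h1, ← e.repr.inner_map_map, PiLp.inner_apply]
  refine Finset.sum_congr rfl fun i _ => ?_
  rw [hA.eigenvectorBasis_apply_self_apply rfl v i, T.sq_singularValues_fin rfl i]
  simp only [RCLike.inner_apply, conj_trivial, RCLike.ofReal_real_eq_id, id]
  ring

lemma norm_sq_eq_sum_repr {E : Type*} [NormedAddCommGroup E] [InnerProductSpace ℝ E] {n : ℕ} (e : OrthonormalBasis (Fin n) ℝ E) (v : E) :
    ‖v‖ ^ 2 = ∑ i, e.repr v i ^ 2 := by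
  rw [← e.repr.norm_map, EuclideanSpace.norm_sq_eq]
  simp

lemma norm_apply_le_sigmaMax (T : E →L[ℝ] E) (v : E) : ‖T v‖ ≤ sigmaMax T * ‖v‖ := by
  have h0 : 0 ≤ sigmaMax T := LinearMap.singularValues_nonneg _ _
  refine le_of_sq_le_sq ?_ (by positivity)
  rw [mul_pow, norm_sq_eq_sum_repr ((T : E →ₗ[ℝ] E).isSymmetric_adjoint_comp_self.eigenvectorBasis
    rfl) v, ← ContinuousLinearMap.coe_coe, norm_apply_sq_eq_sum, Finset.mul_sum]
  refine Finset.sum_le_sum fun i _ => mul_le_mul_of_nonneg_right ?_ (sq_nonneg _)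
  exact pow_le_pow_left₀ (LinearMap.singularValues_nonneg _ _)
    (LinearMap.singularValues_antitone _ (Nat.zero_le _)) 2

lemma sigmaMin_mul_norm_le (T : E →L[ℝ] E) (v : E) : sigmaMin T * ‖v‖ ≤ ‖T v‖ := by
  have h0 : 0 ≤ sigmaMin T := LinearMap.singularValues_nonneg _ _
  refine le_of_sq_le_sq ?_ (norm_nonneg _)
  rw [mul_pow, norm_sq_eq_sum_repr ((T : E →ₗ[ℝ] E).isSymmetric_adjoint_comp_self.eigenvectorBasis
    rfl) v, ← ContinuousLinearMap.coe_coe, norm_apply_sq_eq_sum, Finset.mul_sum]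
  refine Finset.sum_le_sum fun i _ => mul_le_mul_of_nonneg_right ?_ (sq_nonneg _)
  exact pow_le_pow_left₀ h0 (LinearMap.singularValues_antitone _ (by omega)) 2

lemma sigmaMin_le_sigmaMax (T : E →L[ℝ] E) : sigmaMin T ≤ sigmaMax T :=
  LinearMap.singularValues_antitone _ (Nat.zero_le _)

lemma sigmaMin_pos [Nontrivial E] {T : E →L[ℝ] E} (hT : Function.Injective T) : 0 < sigmaMin T :=
  (LinearMap.injective_iff_forall_lt_finrank_singularValues_pos (T : E →ₗ[ℝ] E)).1 hT _
    (Nat.sub_lt Module.finrank_pos one_pos)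

/-- For a positive symmetric operator each eigenvalue is the norm of T at a unit eigenvector, hence
at least the smallest singular value. -/
lemma sigmaMin_mul_norm_sq_le_inner {T : E →L[ℝ] E} (hT : (T : E →ₗ[ℝ] E).IsSymmetric)
    (hpos : ∀ v, 0 ≤ inner ℝ v (T v)) (v : E) : sigmaMin T * ‖v‖ ^ 2 ≤ inner ℝ v (T v) := by
  set e := hT.eigenvectorBasis rfl
  have h1 : ∀ i, sigmaMin T ≤ hT.eigenvalues rfl i := fun i => by
    have he : T (e i) = hT.eigenvalues rfl i • e i := hT.apply_eigenvectorBasis rfl i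
    have hn : ‖e i‖ = 1 := e.orthonormal.1 i
    have h2 := sigmaMin_mul_norm_le T (e i)
    have h3 := hpos (e i)
    rw [he, inner_smul_right, real_inner_self_eq_norm_sq, hn, one_pow, mul_one] at h3
    rwa [he, norm_smul, hn, mul_one, mul_one, Real.norm_of_nonneg h3] at h2
  rw [← e.repr.inner_map_map, PiLp.inner_apply, norm_sq_eq_sum_repr e, Finset.mul_sum]
  refine Finset.sum_le_sum fun i _ => ?_
  have := hT.eigenvectorBasis_apply_self_apply rfl v i
  rw [ContinuousLinearMap.coe_coe] at this
  rw [this]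
  simp only [RCLike.inner_apply, conj_trivial, RCLike.ofReal_real_eq_id, id]
  have := mul_le_mul_of_nonneg_right (h1 i) (sq_nonneg (e.repr v i))
  linarith

lemma inner_le_sigmaMax_mul_norm_sq (T : E →L[ℝ] E) (v : E) :
    inner ℝ v (T v) ≤ sigmaMax T * ‖v‖ ^ 2 := by
  have h1 := real_inner_le_norm v (T v)
  have h2 := mul_le_mul_of_nonneg_left (norm_apply_le_sigmaMax T v) (norm_nonneg v)
  linarith

end SingularValues

/-! ### Taylor estimate under a Lipschitz derivative -/

section Taylor

/-- First-order Taylor estimate for a map with Lipschitz derivative. -/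
lemma norm_sub_sub_fderiv_le {E F : Type*} [NormedAddCommGroup E] [NormedSpace ℝ E]
    [NormedAddCommGroup F] [NormedSpace ℝ F] {G : E → F} (hG : Differentiable ℝ G) {L : ℝ}
    (hL : ∀ u v, ‖fderiv ℝ G u - fderiv ℝ G v‖ ≤ L * ‖u - v‖) (x y : E) :
    ‖G y - G x - fderiv ℝ G x (y - x)‖ ≤ L / 2 * ‖y - x‖ ^ 2 := by
  set v := y - x with hv
  let φ : ℝ → F := fun t => G (x + t • v) - G x - t • fderiv ℝ G x v
  have hφ : ∀ t, HasDerivAt φ (fderiv ℝ G (x + t • v) v - fderiv ℝ G x v) t := fun t => by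
    have h1 : HasDerivAt (fun t : ℝ => x + t • v) v t := by
      simpa using ((hasDerivAt_id t).smul_const v).const_add x
    have h2 := ((hG _).hasFDerivAt.comp_hasDerivAt t h1).sub_const (G x)
    have h3 := h2.sub ((hasDerivAt_id t).smul_const (fderiv ℝ G x v))
    rw [one_smul] at h3
    exact h3
  have hB : ∀ t : ℝ, HasDerivAt (fun t : ℝ => L / 2 * ‖v‖ ^ 2 * t ^ 2) (L * ‖v‖ ^ 2 * t) t := by
    intro t
    have := (hasDerivAt_pow 2 t).const_mul (L / 2 * ‖v‖ ^ 2)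
    exact this.congr_deriv (by simp; ring)
  have h := image_norm_le_of_norm_deriv_right_le_deriv_boundary (a := 0) (b := 1) (f := φ)
    (fun t _ => (hφ t).continuousAt.continuousWithinAt) (fun t _ => (hφ t).hasDerivWithinAt)
    (by simp [φ]) hB (fun t ht => ?_) (x := 1) (by simp)
  · have e : φ 1 = G y - G x - fderiv ℝ G x v := by simp [φ, hv]
    rw [e] at h
    simpa using h
  · rw [← sub_apply]
    refine (ContinuousLinearMap.le_opNorm _ _).trans ?_
    have h1 := mul_le_mul_of_nonneg_right (hL (x + t • v) x) (norm_nonneg v)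
    rw [add_sub_cancel_left, norm_smul, Real.norm_of_nonneg ht.1] at h1
    linarith

end Taylor

/-! ### From Gram matrix bounds to the averaged inverse -/

section Sandwich

open Matrix

variable {E : Type*} [NormedAddCommGroup E] [InnerProductSpace ℝ E] {κ : Type*} [Fintype κ]
  {m : ℕ} {H K : E →ₗ[ℝ] E} {Ht Kt : Fin m → E →ₗ[ℝ] E} {V : E →ₗ[ℝ] (κ → ℝ)}
  {S : Fin m → Matrix κ κ ℝ} {γ : ℝ}

/-- Put y = K v and x = Kt i v. Testing H y = v and Ht i x = v against x computes ⟪v, x⟫ in two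
ways; twice the first minus the second gives 2γ⟪x, y⟫ - γ‖x‖² plus the variational expression of S i
at V y. The first part is at most γ‖y‖², so since q ≥ 1 the regularization costs nothing. -/
lemma sum_inner_inverse_le (hγ : 0 ≤ γ)
    (hH : ∀ x y, inner ℝ x (H y) = γ * inner ℝ x y + V x ⬝ᵥ V y)
    (hHt : ∀ i x y, inner ℝ x (Ht i y) = γ * inner ℝ x y + V x ⬝ᵥ (S i *ᵥ V y))
    (hK : ∀ v, H (K v) = v) (hKt : ∀ i v, Ht i (Kt i v) = v)
    {b : Fin m → (κ → ℝ) → ℝ} (hb : ∀ i z p, 2 * (z ⬝ᵥ p) - p ⬝ᵥ (S i *ᵥ p) ≤ b i z)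
    {q : ℝ} (hq : 1 ≤ q) (hbq : ∀ z, ∑ i, b i z ≤ m * (q * (z ⬝ᵥ z))) (v : E) :
    ∑ i, inner ℝ v (Kt i v) ≤ m * (q * inner ℝ v (K v)) := by
  set y := K v
  have h1 : ∀ i, inner ℝ v (Kt i v) ≤ γ * ‖y‖ ^ 2 + b i (V y) := fun i => by
    set x := Kt i v with hx
    have e1 : inner ℝ v x = γ * inner ℝ x y + V x ⬝ᵥ V y := by
      rw [← hH, hK, real_inner_comm]
    have e2 : inner ℝ v x = γ * ‖x‖ ^ 2 + V x ⬝ᵥ (S i *ᵥ V x) := by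
      rw [← real_inner_self_eq_norm_sq, ← hHt, hKt, real_inner_comm]
    have h2 := hb i (V y) (V x)
    rw [dotProduct_comm (V y)] at h2
    have h3 : 0 ≤ γ * ‖x - y‖ ^ 2 := by positivity
    rw [norm_sub_sq_real] at h3
    linarith
  have h2 : inner ℝ v y = γ * ‖y‖ ^ 2 + V y ⬝ᵥ V y := by
    rw [← real_inner_self_eq_norm_sq, ← hH, hK, real_inner_comm]
  calc _ ≤ ∑ i, (γ * ‖y‖ ^ 2 + b i (V y)) := Finset.sum_le_sum fun i _ => h1 i
    _ = m * (γ * ‖y‖ ^ 2) + ∑ i, b i (V y) := by simp [Finset.sum_add_distrib]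
    _ ≤ m * (q * (γ * ‖y‖ ^ 2)) + m * (q * (V y ⬝ᵥ V y)) := by
        refine add_le_add (mul_le_mul_of_nonneg_left ?_ (Nat.cast_nonneg m)) (hbq _)
        exact le_mul_of_one_le_left (by positivity) hq
    _ = _ := by rw [h2]; ring

/-- Positivity of Ht i at p y - Kt i v, with y = K v, bounds ⟪v, Kt i v⟫ below by an expression
linear in S i. Summing leaves only the pooled Gram matrix; this is convexity of the inverse, tested
at p y. For p ≤ 0 positivity alone suffices. -/
lemma le_sum_inner_inverse (hγ : 0 ≤ γ)
    (hH : ∀ x y, inner ℝ x (H y) = γ * inner ℝ x y + V x ⬝ᵥ V y)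
    (hHt : ∀ i x y, inner ℝ x (Ht i y) = γ * inner ℝ x y + V x ⬝ᵥ (S i *ᵥ V y))
    (hHts : ∀ i, (Ht i).IsSymmetric) (hS : ∀ i z, 0 ≤ z ⬝ᵥ (S i *ᵥ z))
    (hK : ∀ v, H (K v) = v) (hKt : ∀ i v, Ht i (Kt i v) = v)
    {p : ℝ} (hp : p ≤ 1) (hpS : 0 < p → ∀ z, p * ∑ i, z ⬝ᵥ (S i *ᵥ z) ≤ m * (z ⬝ᵥ z)) (v : E) :
    m * (p * inner ℝ v (K v)) ≤ ∑ i, inner ℝ v (Kt i v) := by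
  set y := K v
  have h2 : inner ℝ v y = γ * ‖y‖ ^ 2 + V y ⬝ᵥ V y := by
    rw [← real_inner_self_eq_norm_sq, ← hH, hK, real_inner_comm]
  have hvv : 0 ≤ V y ⬝ᵥ V y := by simpa using dotProduct_star_self_nonneg (V y)
  have hpos : ∀ i x, 0 ≤ inner ℝ x (Ht i x) := fun i x => by
    rw [hHt, real_inner_self_eq_norm_sq]
    exact add_nonneg (by positivity) (hS i _)
  rcases le_or_gt p 0 with hp0 | hp0
  · have h3 : m * (p * inner ℝ v y) ≤ 0 :=
      mul_nonpos_of_nonneg_of_nonpos (Nat.cast_nonneg m)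
        (mul_nonpos_of_nonpos_of_nonneg hp0 (by rw [h2]; positivity))
    refine h3.trans (Finset.sum_nonneg fun i _ => ?_)
    have := hpos i (Kt i v)
    rwa [hKt, real_inner_comm] at this
  · have h1 : ∀ i, 2 * (p * inner ℝ v y) - p ^ 2 * (γ * ‖y‖ ^ 2 + V y ⬝ᵥ (S i *ᵥ V y))
        ≤ inner ℝ v (Kt i v) := fun i => by
      have h3 := hpos i (p • y - Kt i v)
      have e1 : inner ℝ y (Ht i y) = γ * ‖y‖ ^ 2 + V y ⬝ᵥ (S i *ᵥ V y) := by
        rw [hHt, real_inner_self_eq_norm_sq]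
      have e2 : inner ℝ (Kt i v) (Ht i y) = inner ℝ v y := by rw [← hHts i, hKt]
      simp only [map_sub, map_smul, inner_sub_left, inner_sub_right, real_inner_smul_left,
        real_inner_smul_right, hKt, e1, e2] at h3
      rw [real_inner_comm v y, real_inner_comm v (Kt i v)] at h3
      linarith
    refine le_trans ?_ (Finset.sum_le_sum fun i _ => h1 i)
    rw [Finset.sum_sub_distrib, ← Finset.mul_sum _ _ (p ^ 2), Finset.sum_add_distrib]
    simp only [Finset.sum_const, Finset.card_univ, Fintype.card_fin, nsmul_eq_mul]
    have h6 := hpS hp0 (V y)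
    have h7 : p * ((m : ℝ) * (γ * ‖y‖ ^ 2) + ∑ i, V y ⬝ᵥ (S i *ᵥ V y)) ≤
        m * inner ℝ v y := by
      have : p * ((m : ℝ) * (γ * ‖y‖ ^ 2)) ≤ m * (γ * ‖y‖ ^ 2) :=
        mul_le_of_le_one_left (by positivity) hp
      rw [h2]
      linarith
    have h8 := mul_le_mul_of_nonneg_left h7 hp0.le
    linarith

end Sandwich

/-! ### Gradient and Hessian of the regularized risk -/

section Objective

variable {n d : ℕ}

/-- Closed form of the gradient of the objective. -/
def objectiveGrad (ℓ : Fin n → ℝ → ℝ) (x : Fin n → EuclideanSpace ℝ (Fin d)) (γ : ℝ)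
    (w : EuclideanSpace ℝ (Fin d)) : EuclideanSpace ℝ (Fin d) :=
  (1 / (n : ℝ)) • ∑ j, deriv (ℓ j) (inner ℝ w (x j)) • x j + γ • w

lemma hasDerivAt_inner_left {E : Type*} [NormedAddCommGroup E] [InnerProductSpace ℝ E] (a w : E) :
    HasFDerivAt (fun w : E => inner ℝ w a) (innerSL ℝ a) w := by
  have : (fun w : E => inner ℝ w a) = innerSL ℝ a := by
    ext w
    rw [innerSL_apply_apply, real_inner_comm]
  rw [this]
  exact (innerSL ℝ a).hasFDerivAt

variable {ℓ : Fin n → ℝ → ℝ} (x : Fin n → EuclideanSpace ℝ (Fin d)) (γ : ℝ)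

lemma hasFDerivAt_objective (hdiff : ∀ j, Differentiable ℝ (ℓ j)) (w : EuclideanSpace ℝ (Fin d)) :
    HasFDerivAt (objective ℓ x γ) (innerSL ℝ (objectiveGrad ℓ x γ w)) w := by
  have h1 : ∀ j, HasFDerivAt (fun w => ℓ j (inner ℝ w (x j)))
      (deriv (ℓ j) (inner ℝ w (x j)) • innerSL ℝ (x j)) w := fun j =>
    (hdiff j _).hasDerivAt.comp_hasFDerivAt w (hasDerivAt_inner_left (x j) w)
  have h2 := ((HasFDerivAt.fun_sum fun j (_ : j ∈ Finset.univ) => h1 j).const_mul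
    (1 / (n : ℝ))).add (((hasStrictFDerivAt_norm_sq w).hasFDerivAt).const_mul (γ / 2))
  refine HasFDerivAt.congr_fderiv h2 ?_
  ext v
  simp [objectiveGrad]
  ring

lemma gradient_objective (hdiff : ∀ j, Differentiable ℝ (ℓ j)) :
    gradient (objective ℓ x γ) = objectiveGrad ℓ x γ := by
  refine gradient_eq fun w => ?_
  rw [hasGradientAt_iff_hasFDerivAt]
  refine (hasFDerivAt_objective x γ hdiff w).congr_fderiv ?_
  ext v
  simp

lemma hasFDerivAt_objectiveGrad (hdiff2 : ∀ j, Differentiable ℝ (deriv (ℓ j)))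
    (w : EuclideanSpace ℝ (Fin d)) :
    HasFDerivAt (objectiveGrad ℓ x γ)
      ((1 / (n : ℝ)) • ∑ j, (deriv (deriv (ℓ j)) (inner ℝ w (x j)) • innerSL ℝ (x j)).smulRight (x j)
        + γ • ContinuousLinearMap.id ℝ _) w := by
  have h1 : ∀ j, HasFDerivAt (fun w => deriv (ℓ j) (inner ℝ w (x j)) • x j)
      ((deriv (deriv (ℓ j)) (inner ℝ w (x j)) • innerSL ℝ (x j)).smulRight (x j)) w := fun j =>
    ((hdiff2 j _).hasDerivAt.comp_hasFDerivAt w (hasDerivAt_inner_left (x j) w)).smul_const (x j)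
  exact ((HasFDerivAt.fun_sum fun j (_ : j ∈ Finset.univ) => h1 j).const_smul
    (1 / (n : ℝ))).add ((hasFDerivAt_id w).const_smul γ)

lemma hessian_objective_apply (hdiff : ∀ j, Differentiable ℝ (ℓ j))
    (hdiff2 : ∀ j, Differentiable ℝ (deriv (ℓ j))) (w v : EuclideanSpace ℝ (Fin d)) :
    hessian (objective ℓ x γ) w v = (1 / (n : ℝ)) •
      ∑ j, (deriv (deriv (ℓ j)) (inner ℝ w (x j)) * inner ℝ (x j) v) • x j + γ • v := by
  rw [hessian, gradient_objective x γ hdiff, (hasFDerivAt_objectiveGrad x γ hdiff2 w).fderiv]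
  simp

lemma inner_hessian_objective (hdiff : ∀ j, Differentiable ℝ (ℓ j))
    (hdiff2 : ∀ j, Differentiable ℝ (deriv (ℓ j))) (w u v : EuclideanSpace ℝ (Fin d)) :
    inner ℝ u (hessian (objective ℓ x γ) w v) = (1 / (n : ℝ)) *
      ∑ j, deriv (deriv (ℓ j)) (inner ℝ w (x j)) * (inner ℝ (x j) u * inner ℝ (x j) v)
        + γ * inner ℝ u v := by
  rw [hessian_objective_apply x γ hdiff hdiff2, inner_add_right, real_inner_smul_right,
    real_inner_smul_right, inner_sum]
  congr 2
  refine Finset.sum_congr rfl fun j _ => ?_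
  rw [real_inner_smul_right, real_inner_comm (x j) u]
  ring

lemma hessian_objective_isSymmetric (hdiff : ∀ j, Differentiable ℝ (ℓ j))
    (hdiff2 : ∀ j, Differentiable ℝ (deriv (ℓ j))) (w : EuclideanSpace ℝ (Fin d)) :
    (hessian (objective ℓ x γ) w : EuclideanSpace ℝ (Fin d) →ₗ[ℝ] _).IsSymmetric := by
  intro u v
  rw [ContinuousLinearMap.coe_coe, real_inner_comm, inner_hessian_objective x γ hdiff hdiff2,
    inner_hessian_objective x γ hdiff hdiff2, real_inner_comm]
  simp only [mul_comm (inner ℝ (x _) v)]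

/-- A convex objective has positive semidefinite Hessian. -/
lemma inner_hessian_nonneg_of_convexOn (hdiff : ∀ j, Differentiable ℝ (ℓ j))
    (hdiff2 : ∀ j, Differentiable ℝ (deriv (ℓ j)))
    (hconv : ConvexOn ℝ Set.univ (objective ℓ x γ)) (w v : EuclideanSpace ℝ (Fin d)) :
    0 ≤ inner ℝ v (hessian (objective ℓ x γ) w v) := by
  -- On a line the derivative is monotone, and its derivative at 0 is the Hessian form; no
  -- continuity of the second derivative is needed.
  set h : ℝ → ℝ := fun t => objective ℓ x γ (w + t • v) with hh
  have hl : ∀ t : ℝ, HasDerivAt (fun t : ℝ => w + t • v) v t := fun t => by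
    simpa using ((hasDerivAt_id t).smul_const v).const_add w
  have h1 : ∀ t, HasDerivAt h (inner ℝ (objectiveGrad ℓ x γ (w + t • v)) v) t := fun t =>
    (hasFDerivAt_objective x γ hdiff _).comp_hasDerivAt t (hl t)
  have hd : deriv h = fun t => inner ℝ (objectiveGrad ℓ x γ (w + t • v)) v :=
    funext fun t => (h1 t).deriv
  have hcv : ConvexOn ℝ Set.univ h := by
    have := hconv.comp_affineMap (AffineMap.lineMap w (w + v) : ℝ →ᵃ[ℝ] _)
    have e : h = objective ℓ x γ ∘ (AffineMap.lineMap w (w + v) : ℝ →ᵃ[ℝ] _) := by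
      ext t
      simp [hh, AffineMap.lineMap_apply, add_comm]
    rw [e]
    exact this
  have hmono : Monotone (deriv h) := by
    have := hcv.monotoneOn_deriv fun t _ => (h1 t).differentiableAt
    exact monotoneOn_univ.1 this
  have h2 := hmono.deriv_nonneg (x := 0)
  have h3 : HasDerivAt (deriv h) (inner ℝ v (hessian (objective ℓ x γ) w v)) 0 := by
    rw [hd]
    have e0 : w + (0 : ℝ) • v = w := by simp
    have hG := hasFDerivAt_objectiveGrad x γ hdiff2 w
    have e1 : hessian (objective ℓ x γ) w = fderiv ℝ (objectiveGrad ℓ x γ) w := by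
      rw [hessian, gradient_objective x γ hdiff]
    rw [e1]
    have hG' := hG.differentiableAt.hasFDerivAt
    rw [← e0] at hG'
    have h4 := hG'.comp_hasDerivAt (0 : ℝ) (hl 0)
    have h5 := (innerSL ℝ v).hasFDerivAt.comp_hasDerivAt (0 : ℝ) h4
    rw [e0] at h5
    refine (h5.congr_of_eventuallyEq (Filter.Eventually.of_forall fun t => ?_))
    simp [real_inner_comm]
  rwa [h3.deriv] at h2

/-- Subtracting (c/2)‖·‖² gives the same kind of objective with parameter γ - c. That parameter may
be negative, so the preceding lemma imposes no sign on it. -/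
lemma inner_hessian_ge_of_strongConvexOn (hdiff : ∀ j, Differentiable ℝ (ℓ j))
    (hdiff2 : ∀ j, Differentiable ℝ (deriv (ℓ j))) {c : ℝ}
    (hstrong : StrongConvexOn Set.univ c (objective ℓ x γ)) (w v : EuclideanSpace ℝ (Fin d)) :
    c * ‖v‖ ^ 2 ≤ inner ℝ v (hessian (objective ℓ x γ) w v) := by
  have h1 : ConvexOn ℝ Set.univ (objective ℓ x (γ - c)) := by
    have := strongConvexOn_iff_convex.1 hstrong
    have e : objective ℓ x (γ - c) = fun u => objective ℓ x γ u - c / 2 * ‖u‖ ^ 2 := by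
      ext u
      simp only [objective]
      ring
    rw [e]
    exact this
  have h2 := inner_hessian_nonneg_of_convexOn x (γ - c) hdiff hdiff2 h1 w v
  rw [inner_hessian_objective x _ hdiff hdiff2, real_inner_self_eq_norm_sq] at h2
  rw [inner_hessian_objective x _ hdiff hdiff2, real_inner_self_eq_norm_sq]
  linarith

lemma deriv_deriv_nonneg_of_convexOn {f : ℝ → ℝ} (hconv : ConvexOn ℝ Set.univ f)
    (hdiff : Differentiable ℝ f) (t : ℝ) : 0 ≤ deriv (deriv f) t :=
  (monotoneOn_univ.1 (hconv.monotoneOn_deriv fun t _ => hdiff t)).deriv_nonneg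

lemma objectiveGrad_eq_zero_of_isMinOn (hdiff : ∀ j, Differentiable ℝ (ℓ j))
    {w : EuclideanSpace ℝ (Fin d)} (hw : IsMinOn (objective ℓ x γ) Set.univ w) :
    objectiveGrad ℓ x γ w = 0 := by
  have h1 : IsLocalMin (objective ℓ x γ) w := hw.isLocalMin Filter.univ_mem
  have h2 := h1.hasFDerivAt_eq_zero (hasFDerivAt_objective x γ hdiff w)
  have h3 := congrArg (fun T => T (objectiveGrad ℓ x γ w)) h2
  simpa using h3

end Objective

/-! ### Orthonormal coordinates of the column space -/

section ColumnBasis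

open Matrix

variable {n d : ℕ} (A : Matrix (Fin n) (Fin d) ℝ)

lemma sum_columnBasis_mul (a b : Fin (Module.finrank ℝ (columnSpace A))) :
    ∑ j, columnBasis A j a * columnBasis A j b = if a = b then 1 else 0 := by
  have h := (stdOrthonormalBasis ℝ (columnSpace A)).inner_eq_ite a b
  rw [Submodule.coe_inner, PiLp.inner_apply] at h
  rw [← h]
  refine Finset.sum_congr rfl fun j _ => ?_
  simp only [columnBasis, Matrix.of_apply, RCLike.inner_apply, conj_trivial]
  ring

lemma sum_vecMulVec_columnBasis :
    ∑ j, vecMulVec (columnBasis A j) (columnBasis A j) = 1 := by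
  ext a b
  rw [Matrix.sum_apply, Matrix.one_apply]
  exact sum_columnBasis_mul A a b

lemma toLp_mulVec_mem_columnSpace (y : Fin d → ℝ) : WithLp.toLp 2 (A *ᵥ y) ∈ columnSpace A := by
  have e : WithLp.toLp 2 (A *ᵥ y) = ∑ k, y k • WithLp.toLp 2 (fun j => A j k) := by
    ext j
    simp [Matrix.mulVec, dotProduct, mul_comm]
  rw [e]
  exact Submodule.sum_mem _ fun k _ => Submodule.smul_mem _ _ (Submodule.subset_span ⟨k, rfl⟩)

/-- U Uᵀ is the orthogonal projection onto the column space, so it fixes A y. No full-rank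
assumption on A is needed. -/
lemma columnBasis_mulVec_transpose (y : Fin d → ℝ) :
    columnBasis A *ᵥ ((columnBasis A)ᵀ *ᵥ (A *ᵥ y)) = A *ᵥ y := by
  set p : columnSpace A := ⟨_, toLp_mulVec_mem_columnSpace A y⟩ with hp
  set e := stdOrthonormalBasis ℝ (columnSpace A)
  have h := congrArg (fun z : columnSpace A => (z : EuclideanSpace ℝ (Fin n))) (e.sum_repr p)
  have h2 : ∀ k, e.repr p k = ((columnBasis A)ᵀ *ᵥ (A *ᵥ y)) k := fun k => by
    rw [e.repr_apply_apply, Submodule.coe_inner, PiLp.inner_apply]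
    simp only [Matrix.mulVec, dotProduct, columnBasis, Matrix.of_apply, RCLike.inner_apply,
      conj_trivial, Matrix.transpose_apply, hp]
    exact Finset.sum_congr rfl fun j _ => mul_comm _ _
  simp only [h2, Submodule.coe_sum, Submodule.coe_smul] at h
  funext j
  have h3 := congrArg (fun z : EuclideanSpace ℝ (Fin n) => z j) h
  simp only [hp] at h3
  rw [← h3]
  simp [Matrix.mulVec, dotProduct, columnBasis, e, mul_comm]

lemma finrank_columnSpace_le : Module.finrank ℝ (columnSpace A) ≤ d := by
  have := finrank_range_le_card (R := ℝ) (fun k : Fin d => WithLp.toLp 2 (fun j => A j k))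
  rw [Fintype.card_fin] at this
  exact this

lemma card_mul_sq_columnBasis_le (hd : 0 < d) (j : Fin n) :
    n * (columnBasis A j ⬝ᵥ columnBasis A j) ≤ rowCoherence A * d := by
  have hd' : (d : ℝ) ≠ 0 := by positivity
  have h1 : columnBasis A j ⬝ᵥ columnBasis A j ≤ ⨆ j : Fin n, ∑ k, columnBasis A j k ^ 2 := by
    refine le_trans (le_of_eq ?_) (le_ciSup (f := fun j : Fin n => ∑ k, columnBasis A j k ^ 2)
      (Set.finite_range _).bddAbove j)
    simp [dotProduct, sq]
  have h2 : rowCoherence A * d = n * ⨆ j : Fin n, ∑ k, columnBasis A j k ^ 2 := by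
    rw [rowCoherence]
    field_simp
  rw [h2]
  exact mul_le_mul_of_nonneg_left h1 (Nat.cast_nonneg n)

/-- Coordinates of the scaled data in the orthonormal basis of the column space. -/
def whitened (A : Matrix (Fin n) (Fin d) ℝ) :
    EuclideanSpace ℝ (Fin d) →ₗ[ℝ] (Fin (Module.finrank ℝ (columnSpace A)) → ℝ) where
  toFun y := (1 / √(n : ℝ)) • ((columnBasis A)ᵀ *ᵥ (A *ᵥ y.ofLp))
  map_add' y z := by simp [Matrix.mulVec_add]
  map_smul' c y := by simp [Matrix.mulVec_smul, smul_comm c]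

lemma columnBasis_dotProduct_whitened (j : Fin n) (y : EuclideanSpace ℝ (Fin d)) :
    columnBasis A j ⬝ᵥ whitened A y = (1 / √(n : ℝ)) * (A *ᵥ y.ofLp) j := by
  rw [whitened, LinearMap.coe_mk, AddHom.coe_mk, dotProduct_smul, smul_eq_mul]
  congr 1
  exact congrFun (columnBasis_mulVec_transpose A y.ofLp) j

lemma whitened_dotProduct (hn : 0 < n) (y z : EuclideanSpace ℝ (Fin d)) :
    whitened A y ⬝ᵥ whitened A z = (1 / (n : ℝ)) * ∑ j, (A *ᵥ y.ofLp) j * (A *ᵥ z.ofLp) j := by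
  have hn' : (0 : ℝ) < n := by exact_mod_cast hn
  have h := congrArg (fun M => whitened A y ⬝ᵥ (M *ᵥ whitened A z)) (sum_vecMulVec_columnBasis A)
  simp only [Matrix.one_mulVec, Matrix.sum_mulVec, dotProduct_sum, vecMulVec_mulVec] at h
  rw [← h, Finset.mul_sum]
  refine Finset.sum_congr rfl fun j _ => ?_
  have hs : 1 / √(n : ℝ) * (1 / √(n : ℝ)) = 1 / n := by
    rw [div_mul_div_comm, one_mul, Real.mul_self_sqrt hn'.le]
  simp only [op_smul_eq_smul, dotProduct_smul, smul_eq_mul]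
  rw [dotProduct_comm (whitened A y), columnBasis_dotProduct_whitened,
    columnBasis_dotProduct_whitened, ← hs]
  ring

/-- The row u_j paired with the whitened y is (A y)_j/√n, and the normalization n/s of the Gram
matrix turns the resulting 1/n into 1/s. This is the unregularized part of the local Hessian. -/
lemma whitened_sampleGram {m s : ℕ} (hn : 0 < n) (J : Fin m × Fin s → Fin n) (i : Fin m)
    (y z : EuclideanSpace ℝ (Fin d)) :
    whitened A y ⬝ᵥ (sampleGram (columnBasis A) (workerIndices m s i) J *ᵥ whitened A z) =
      (1 / (s : ℝ)) * ∑ k, (A *ᵥ y.ofLp) (J (i, k)) * (A *ᵥ z.ofLp) (J (i, k)) := by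
  have hn' : (0 : ℝ) < n := by exact_mod_cast hn
  unfold sampleGram
  rw [card_workerIndices, Matrix.smul_mulVec, dotProduct_smul, Matrix.sum_mulVec,
    dotProduct_sum, sum_workerIndices, smul_eq_mul, Finset.mul_sum, Finset.mul_sum]
  refine Finset.sum_congr rfl fun k _ => ?_
  have hs : 1 / √(n : ℝ) * (1 / √(n : ℝ)) = 1 / n := by
    rw [div_mul_div_comm, one_mul, Real.mul_self_sqrt hn'.le]
  rw [vecMulVec_mulVec]
  simp only [op_smul_eq_smul, dotProduct_smul, smul_eq_mul,
    Fintype.card_fin]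
  rw [dotProduct_comm (whitened A y), columnBasis_dotProduct_whitened,
    columnBasis_dotProduct_whitened]
  calc _ = (n : ℝ) / s * (1 / √(n : ℝ) * (1 / √(n : ℝ))) *
        ((A *ᵥ y.ofLp) (J (i, k)) * (A *ᵥ z.ofLp) (J (i, k))) := by ring
    _ = _ := by rw [hs]; field_simp

end ColumnBasis

/-! ### Quadratic form of the local Hessian -/

section LocalHessian

open Matrix

variable {n d s : ℕ} (ℓ : Fin n → ℝ → ℝ) (x : Fin n → EuclideanSpace ℝ (Fin d)) (γ : ℝ)
  (w : EuclideanSpace ℝ (Fin d))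

lemma scaledData_mulVec (y : EuclideanSpace ℝ (Fin d)) (j : Fin n) :
    (scaledData ℓ x w *ᵥ y.ofLp) j =
      √(deriv (deriv (ℓ j)) (inner ℝ w (x j))) * inner ℝ (x j) y := by
  rw [PiLp.inner_apply (x j) y, Finset.mul_sum, Matrix.mulVec, dotProduct]
  refine Finset.sum_congr rfl fun k _ => ?_
  simp only [scaledData, Matrix.of_apply, RCLike.inner_apply, conj_trivial]
  ring

lemma inner_toEuclideanLin (M : Matrix (Fin d) (Fin d) ℝ) (y z : EuclideanSpace ℝ (Fin d)) :
    inner ℝ y (Matrix.toEuclideanLin M z) = y.ofLp ⬝ᵥ (M *ᵥ z.ofLp) := by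
  rw [PiLp.inner_apply, Matrix.toLpLin_apply]
  simp [dotProduct, mul_comm]

lemma inner_localHessian (J : Fin s → Fin n) (y z : EuclideanSpace ℝ (Fin d)) :
    inner ℝ y (Matrix.toEuclideanLin (localHessian ℓ x γ w J) z) = γ * inner ℝ y z +
      (1 / (s : ℝ)) * ∑ k, (scaledData ℓ x w *ᵥ y.ofLp) (J k) * (scaledData ℓ x w *ᵥ z.ofLp) (J k) := by
  rw [inner_toEuclideanLin, localHessian, Matrix.add_mulVec, dotProduct_add, Matrix.smul_mulVec,
    Matrix.smul_mulVec, Matrix.one_mulVec, dotProduct_smul, dotProduct_smul, ← Matrix.mulVec_mulVec,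
    Matrix.dotProduct_mulVec, Matrix.vecMul_transpose, add_comm]
  congr 2
  simp only [PiLp.inner_apply, dotProduct, RCLike.inner_apply, conj_trivial]
  exact Finset.sum_congr rfl fun k _ => mul_comm _ _

end LocalHessian

/-! ### One iteration on the good sampling event -/

section Step

open Matrix

variable {n d m s : ℕ}

lemma eq_zero_of_mul_norm_sq_le {E : Type*} [NormedAddCommGroup E] {c : ℝ} (hc : 0 < c) {v : E}
    (h : c * ‖v‖ ^ 2 ≤ 0) : v = 0 := by
  have h2 : ‖v‖ ^ 2 ≤ 0 := by
    by_contra hcon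
    push Not at hcon
    linarith [mul_pos hc hcon]
  exact norm_eq_zero.1 (pow_eq_zero_iff two_ne_zero |>.1 (le_antisymm h2 (sq_nonneg _)))

section Abstract

variable {E : Type*} [NormedAddCommGroup E] [InnerProductSpace ℝ E]
  {κ : Type*} [Fintype κ] {H : E →ₗ[ℝ] E} {Ht Kt : Fin m → E →ₗ[ℝ] E} {V : E →ₗ[ℝ] (κ → ℝ)}
  {S : Fin m → Matrix κ κ ℝ} {γ σ l : ℝ}

/-- If Ht i v = 0, then γ‖v‖² = 0, and V v = 0 because S i is bounded below; so the form of H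
vanishes at v, and H is positive definite. -/
lemma injective_of_quadForm (hγ : 0 ≤ γ) (hσ : 0 < σ) (hl0 : 0 < l)
    (hH : ∀ x y, inner ℝ x (H y) = γ * inner ℝ x y + V x ⬝ᵥ V y)
    (hHt : ∀ i x y, inner ℝ x (Ht i y) = γ * inner ℝ x y + V x ⬝ᵥ (S i *ᵥ V y))
    (hHσ : ∀ v, 2 / 3 * σ * ‖v‖ ^ 2 ≤ inner ℝ v (H v))
    (hl : ∀ i z, l * (z ⬝ᵥ z) ≤ z ⬝ᵥ (S i *ᵥ z)) (i : Fin m) : Function.Injective (Ht i) := by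
  refine (injective_iff_map_eq_zero (Ht i)).2 fun v hv => ?_
  have h1 := hHt i v v
  rw [hv, inner_zero_right, real_inner_self_eq_norm_sq] at h1
  have h2 := hl i (V v)
  have h3 := hHσ v
  rw [hH, real_inner_self_eq_norm_sq] at h3
  have hvv : 0 ≤ V v ⬝ᵥ V v := by simpa using dotProduct_star_self_nonneg (V v)
  have hγv : 0 ≤ γ * ‖v‖ ^ 2 := by positivity
  have h4 : 0 ≤ l * (V v ⬝ᵥ V v) := by positivity
  have h6 : V v ⬝ᵥ V v ≤ 0 := by
    by_contra hcon
    push Not at hcon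
    linarith [mul_pos hl0 hcon]
  have h8 : 2 / 3 * σ * ‖v‖ ^ 2 ≤ 0 := by linarith
  exact eq_zero_of_mul_norm_sq_le (by positivity) h8

variable [FiniteDimensional ℝ E]

/-- One averaged approximate Newton step, with the worker Hessians given by quadratic forms. -/
lemma norm_averaged_step_le (hm : 0 < m) (hγ : 0 ≤ γ) (hσ : 0 < σ) (hl0 : 0 < l)
    (hH : ∀ x y, inner ℝ x (H y) = γ * inner ℝ x y + V x ⬝ᵥ V y)
    (hHt : ∀ i x y, inner ℝ x (Ht i y) = γ * inner ℝ x y + V x ⬝ᵥ (S i *ᵥ V y))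
    (hS : ∀ i, (S i)ᵀ = S i) (hHσ : ∀ v, 2 / 3 * σ * ‖v‖ ^ 2 ≤ inner ℝ v (H v))
    (hl : ∀ i z, l * (z ⬝ᵥ z) ≤ z ⬝ᵥ (S i *ᵥ z)) (hHK : ∀ i v, Ht i (Kt i v) = v)
    {α p q : ℝ} (hα : 0 < α) (hadm : Admissible α p q)
    {b : Fin m → (κ → ℝ) → ℝ} (hb : ∀ i z p, 2 * (z ⬝ᵥ p) - p ⬝ᵥ (S i *ᵥ p) ≤ b i z)
    (hbq : ∀ z, ∑ i, b i z ≤ m * (q * (z ⬝ᵥ z)))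
    (hpS : 0 < p → ∀ z, p * ∑ i, z ⬝ᵥ (S i *ᵥ z) ≤ m * (z ⬝ᵥ z))
    {σ' L : ℝ} (hσ' : σ ≤ σ') (hL : 0 ≤ L) {Δ g : E} (hΔ : 3 * L * ‖Δ‖ ≤ σ)
    (hg : ‖g - H Δ‖ ≤ L / 2 * ‖Δ‖ ^ 2)
    (hΔg : inner ℝ Δ g ≤ σ' * ‖Δ‖ ^ 2 + L / 2 * ‖Δ‖ ^ 3) :
    ‖Δ - (1 / (m : ℝ)) • ∑ i, Kt i g‖ ≤ max (2 * α * √(σ' / σ) * ‖Δ‖) (3 * L / σ * ‖Δ‖ ^ 2) := by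
  have hm' : (0 : ℝ) < m := by exact_mod_cast hm
  have hSpos : ∀ i z, 0 ≤ z ⬝ᵥ (S i *ᵥ z) := fun i z =>
    (mul_nonneg hl0.le (by simpa using dotProduct_star_self_nonneg z)).trans (hl i z)
  have hHinj : Function.Injective H := (injective_iff_map_eq_zero H).2 fun v hv => by
    have h1 := hHσ v
    rw [hv, inner_zero_right] at h1
    exact eq_zero_of_mul_norm_sq_le (by positivity) h1
  obtain ⟨K, hHKv⟩ : ∃ K : E →ₗ[ℝ] E, ∀ v, H (K v) = v :=
    ⟨(LinearEquiv.ofInjectiveEndo _ hHinj).symm.toLinearMap, fun v =>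
      (LinearEquiv.ofInjectiveEndo _ hHinj).apply_symm_apply v⟩
  have hHsymm : H.IsSymmetric := fun u v => by
    rw [real_inner_comm, hH, hH, real_inner_comm, dotProduct_comm]
  have hHtsymm : ∀ i, (Ht i).IsSymmetric := fun i u v => by
    rw [real_inner_comm, hHt, hHt, real_inner_comm, Matrix.dotProduct_mulVec,
      ← Matrix.mulVec_transpose, hS, dotProduct_comm]
  have hKtsymm : ∀ i, (Kt i).IsSymmetric := fun i u v => by
    conv_lhs => rw [← hHK i v]
    rw [← hHtsymm, hHK]
  have hadm' := hadm.le
  have hupper : ∀ v, ∑ i, inner ℝ v (Kt i v) ≤ m * (q * inner ℝ v (K v)) :=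
    sum_inner_inverse_le hγ hH hHt hHKv hHK hb (by linarith) hbq
  have hlower : ∀ v, m * (p * inner ℝ v (K v)) ≤ ∑ i, inner ℝ v (Kt i v) :=
    le_sum_inner_inverse hγ hH hHt hHtsymm hSpos hHKv hHK hadm'.1 hpS
  obtain ⟨M, hMv⟩ : ∃ M : E →ₗ[ℝ] E, ∀ v, M v = (1 / (m : ℝ)) • ∑ i, Kt i v :=
    ⟨(1 / (m : ℝ)) • ∑ i, Kt i, fun v => by simp [LinearMap.sum_apply]⟩
  have hMin : ∀ v, inner ℝ v (M v) = (∑ i, inner ℝ v (Kt i v)) / m := fun v => by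
    rw [hMv, real_inner_smul_right, inner_sum]
    ring
  have hMs : M.IsSymmetric := fun u v => by
    rw [hMv, hMv, real_inner_smul_left, real_inner_smul_right, inner_sum, sum_inner]
    simp only [hKtsymm _ u v]
  rw [← hMv]
  refine norm_newton_step_le hHsymm hMs hHKv hadm hα ?_ ?_ hσ hσ' hL hΔ hHσ hg hΔg
  · intro v
    rw [hMin, le_div_iff₀ hm']
    linarith [hlower v]
  · intro v
    rw [hMin, div_le_iff₀ hm']
    linarith [hupper v]

end Abstract

/-- Properties of the Hessians at the minimizer and at a nearby point. -/
lemma hessian_bounds (hd : 0 < d)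
    {ℓ : Fin n → ℝ → ℝ} (x : Fin n → EuclideanSpace ℝ (Fin d)) (γ : ℝ)
    (hdiff : ∀ j, Differentiable ℝ (ℓ j)) (hdiff2 : ∀ j, Differentiable ℝ (deriv (ℓ j)))
    (hstrong : ∃ c : ℝ, 0 < c ∧ StrongConvexOn Set.univ c (objective ℓ x γ))
    {wstar : EuclideanSpace ℝ (Fin d)} (hwstar : IsMinOn (objective ℓ x γ) Set.univ wstar)
    {w : EuclideanSpace ℝ (Fin d)} {L : ℝ}
    (hLip : ∀ u v : EuclideanSpace ℝ (Fin d),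
      ‖hessian (objective ℓ x γ) u - hessian (objective ℓ x γ) v‖ ≤ L * ‖u - v‖)
    (hclose : 3 * L * ‖w - wstar‖ ≤ sigmaMin (hessian (objective ℓ x γ) wstar)) :
    0 ≤ L ∧ 0 < sigmaMin (hessian (objective ℓ x γ) wstar) ∧
    (∀ v, 2 / 3 * sigmaMin (hessian (objective ℓ x γ) wstar) * ‖v‖ ^ 2 ≤
      inner ℝ v (hessian (objective ℓ x γ) w v)) ∧
    ‖objectiveGrad ℓ x γ w - hessian (objective ℓ x γ) w (w - wstar)‖ ≤
      L / 2 * ‖w - wstar‖ ^ 2 ∧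
    inner ℝ (w - wstar) (objectiveGrad ℓ x γ w) ≤
      sigmaMax (hessian (objective ℓ x γ) wstar) * ‖w - wstar‖ ^ 2 +
        L / 2 * ‖w - wstar‖ ^ 3 := by
  obtain ⟨c, hc, hstrong⟩ := hstrong
  have : Nonempty (Fin d) := ⟨⟨0, hd⟩⟩
  have hge := inner_hessian_ge_of_strongConvexOn x γ hdiff hdiff2 hstrong wstar
  have hsymm := hessian_objective_isSymmetric x γ hdiff hdiff2 wstar
  have hT := norm_sub_sub_fderiv_le (G := objectiveGrad ℓ x γ)
    (fun v => (hasFDerivAt_objectiveGrad x γ hdiff2 v).differentiableAt) (L := L)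
    (fun u v => by
      have := hLip u v
      rwa [hessian, hessian, gradient_objective x γ hdiff] at this)
  have hfd : ∀ u, fderiv ℝ (objectiveGrad ℓ x γ) u = hessian (objective ℓ x γ) u := fun u => by
    rw [hessian, gradient_objective x γ hdiff]
  simp only [hfd] at hT
  have hz := objectiveGrad_eq_zero_of_isMinOn x γ hdiff hwstar
  generalize objectiveGrad ℓ x γ = G at *
  generalize hessian (objective ℓ x γ) = Hess at *
  have hinj : Function.Injective (Hess wstar) :=
    (injective_iff_map_eq_zero (Hess wstar)).2 fun v hv => by
      have h1 := hge v
      rw [hv, inner_zero_right] at h1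
      exact eq_zero_of_mul_norm_sq_le hc h1
  have hσ : 0 < sigmaMin (Hess wstar) := sigmaMin_pos hinj
  have hL : 0 ≤ L := by
    obtain ⟨u, hu⟩ := exists_ne (0 : EuclideanSpace ℝ (Fin d))
    have h1 := (norm_nonneg _).trans (hLip u 0)
    rw [sub_zero] at h1
    exact nonneg_of_mul_nonneg_left h1 (norm_pos_iff.2 hu)
  refine ⟨hL, hσ, fun v => ?_, ?_, ?_⟩
  · have h0 : sigmaMin (Hess wstar) * ‖v‖ ^ 2 ≤ inner ℝ v (Hess wstar v) :=
      sigmaMin_mul_norm_sq_le_inner hsymm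
        (fun v => (by positivity : 0 ≤ c * ‖v‖ ^ 2).trans (hge v)) v
    -- Closeness gives L‖w - wstar‖ ≤ σ_min/3, so moving the Hessian from wstar to w loses a third
    -- of σ_min.
    have h1 : inner ℝ v (Hess wstar v) - inner ℝ v (Hess w v) ≤
        sigmaMin (Hess wstar) / 3 * ‖v‖ ^ 2 := by
      rw [← inner_sub_right, ← _root_.sub_apply]
      refine (real_inner_le_norm _ _).trans ?_
      have h2 : ‖(Hess wstar - Hess w) v‖ ≤ L * ‖w - wstar‖ * ‖v‖ := by
        refine ((Hess wstar - Hess w).le_opNorm v).trans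
          (mul_le_mul_of_nonneg_right ?_ (norm_nonneg _))
        rw [norm_sub_rev w]
        exact hLip wstar w
      have h3 : L * ‖w - wstar‖ * ‖v‖ ≤ sigmaMin (Hess wstar) / 3 * ‖v‖ :=
        mul_le_mul_of_nonneg_right (by linarith) (norm_nonneg _)
      have := mul_le_mul_of_nonneg_left (h2.trans h3) (norm_nonneg v)
      linarith
    linarith
  · have h1 := hT w wstar
    have e : G wstar - G w - Hess w (wstar - w) = -(G w - Hess w (w - wstar)) := by
      rw [hz, ← neg_sub w wstar, map_neg]
      abel
    rwa [e, norm_neg, norm_sub_rev wstar w] at h1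
  -- This expansion is about wstar rather than w, so that the quadratic term is governed by σ_max at
  -- the minimizer.
  · have h0 := hT wstar w
    rw [hz, sub_zero] at h0
    have h1 : inner ℝ (w - wstar) (G w) = inner ℝ (w - wstar) (Hess wstar (w - wstar)) +
        inner ℝ (w - wstar) (G w - Hess wstar (w - wstar)) := by
      rw [inner_sub_right]; ring
    have h2 := inner_le_sigmaMax_mul_norm_sq (Hess wstar) (w - wstar)
    have h3 := (real_inner_le_norm (w - wstar) (G w - Hess wstar (w - wstar))).trans
      (mul_le_mul_of_nonneg_left h0 (norm_nonneg _))
    rw [h1]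
    linarith

lemma inner_hessian_eq_whitened (hn : 0 < n) (ℓ : Fin n → ℝ → ℝ)
    (x : Fin n → EuclideanSpace ℝ (Fin d)) (γ : ℝ) (hconv : ∀ j, ConvexOn ℝ Set.univ (ℓ j))
    (hdiff : ∀ j, Differentiable ℝ (ℓ j)) (hdiff2 : ∀ j, Differentiable ℝ (deriv (ℓ j)))
    (w u v : EuclideanSpace ℝ (Fin d)) :
    inner ℝ u (hessian (objective ℓ x γ) w v) = γ * inner ℝ u v +
      whitened (scaledData ℓ x w) u ⬝ᵥ whitened (scaledData ℓ x w) v := by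
  rw [inner_hessian_objective x γ hdiff hdiff2, whitened_dotProduct _ hn, add_comm]
  congr 2
  refine Finset.sum_congr rfl fun j _ => ?_
  rw [scaledData_mulVec, scaledData_mulVec]
  have := Real.mul_self_sqrt (deriv_deriv_nonneg_of_convexOn (hconv j) (hdiff j) (inner ℝ w (x j)))
  conv_lhs => rw [← this]
  ring

/-- On the good sampling events, the local Hessians are invertible and the step contracts. -/
lemma giantStep_bound (hm : 0 < m) (hd : 0 < d) (hn : 0 < n)
    (ℓ : Fin n → ℝ → ℝ) (x : Fin n → EuclideanSpace ℝ (Fin d)) (γ : ℝ) (hγ : 0 ≤ γ)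
    (hconv : ∀ j, ConvexOn ℝ Set.univ (ℓ j))
    (hdiff : ∀ j, Differentiable ℝ (ℓ j))
    (hdiff2 : ∀ j, Differentiable ℝ (deriv (ℓ j)))
    (hstrong : ∃ c : ℝ, 0 < c ∧ StrongConvexOn Set.univ c (objective ℓ x γ))
    (wstar : EuclideanSpace ℝ (Fin d))
    (hwstar : IsMinOn (objective ℓ x γ) Set.univ wstar)
    (w : EuclideanSpace ℝ (Fin d)) (L : ℝ)
    (hLip : ∀ u v : EuclideanSpace ℝ (Fin d),
      ‖hessian (objective ℓ x γ) u - hessian (objective ℓ x γ) v‖ ≤ L * ‖u - v‖)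
    (hclose : 3 * L * ‖w - wstar‖ ≤ sigmaMin (hessian (objective ℓ x γ) wstar))
    {α p q : ℝ} (hα : 0 < α) (hadm : Admissible α p q) (J : Fin m × Fin s → Fin n)
    (hup : UpperGood (columnBasis (scaledData ℓ x w)) q J)
    (hlow : LowerGood (columnBasis (scaledData ℓ x w)) p J) :
    (∀ i, IsUnit (localHessian ℓ x γ w (fun k => J (i, k)))) ∧
      ‖giantStep ℓ x γ w (fun i k => J (i, k)) - wstar‖
        ≤ max (2 * α * √(condNumber (hessian (objective ℓ x γ) wstar)) * ‖w - wstar‖)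
          (3 * L / sigmaMin (hessian (objective ℓ x γ) wstar) * ‖w - wstar‖ ^ 2) := by
  obtain ⟨hL, hσ, hHσ, hg, hΔg⟩ := hessian_bounds hd x γ hdiff hdiff2 hstrong hwstar hLip hclose
  have hm' : (0 : ℝ) < m := by exact_mod_cast hm
  obtain ⟨⟨l, hl0, hl⟩, b, hb, hbq⟩ := hup
  have hHt : ∀ i u v, inner ℝ u (Matrix.toEuclideanLin
      (localHessian ℓ x γ w (fun k => J (i, k))) v) = γ * inner ℝ u v +
      whitened (scaledData ℓ x w) u ⬝ᵥ (sampleGram (columnBasis (scaledData ℓ x w))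
        (workerIndices m s i) J *ᵥ whitened (scaledData ℓ x w) v) := fun i u v => by
    rw [inner_localHessian, whitened_sampleGram _ hn]
  have hH := inner_hessian_eq_whitened hn ℓ x γ hconv hdiff hdiff2 w
  have hunit : ∀ i, IsUnit (localHessian ℓ x γ w (fun k => J (i, k))) := fun i => by
    rw [← Matrix.mulVec_injective_iff_isUnit]
    intro y z hyz
    have hinj := injective_of_quadForm (H := (hessian (objective ℓ x γ) w).toLinearMap)
      hγ hσ hl0 hH hHt hHσ hl i
    have := @hinj (WithLp.toLp 2 y) (WithLp.toLp 2 z) (by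
      simp only [Matrix.toLpLin_apply]
      rw [hyz])
    simpa using this
  refine ⟨hunit, ?_⟩
  have hstep : giantStep ℓ x γ w (fun i k => J (i, k)) - wstar = (w - wstar) - (1 / (m : ℝ)) •
      ∑ i, Matrix.toEuclideanLin (localHessian ℓ x γ w (fun k => J (i, k)))⁻¹
        (objectiveGrad ℓ x γ w) := by
    rw [giantStep, giantDirection]
    simp only [antDirection, gradient_objective x γ hdiff]
    abel
  rw [hstep]
  refine norm_averaged_step_le (H := (hessian (objective ℓ x γ) w).toLinearMap) hm hγ hσ hl0 hH hHt
    (fun i => sampleGram_transpose _ _ _) hHσ hl (fun i v => ?_) hα hadm hb hbq (fun hp z => ?_)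
    (sigmaMin_le_sigmaMax _) hL hclose hg hΔg
  · simp only [Matrix.toLpLin_apply, Matrix.mulVec_mulVec]
    rw [Matrix.mul_nonsing_inv _ ((Matrix.isUnit_iff_isUnit_det _).1 (hunit i)),
      Matrix.one_mulVec]
  · have h1 := hlow.resolve_left (not_le.2 hp) z
    have h2 := sum_quadForm_workerIndices (columnBasis (scaledData ℓ x w)) J z
    refine (congrArg (fun t => p * t) h2).le.trans ?_
    have := mul_le_mul_of_nonneg_left h1 hm'.le
    linarith

end Step

/-! ### Independent uniform samples as counting -/

section Law

variable {Ω : Type*} [MeasurableSpace Ω] {P : Measure Ω} [IsProbabilityMeasure P] {n : ℕ}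
  {ι : Type*} [Fintype ι] [DecidableEq ι]

/-- Independent uniform samples: failure probabilities are normalized counts. -/
lemma one_sub_failCount_le (J : ι → Ω → Fin n) (hJ : iIndepFun J P)
    (hJunif : ∀ i j, P.real {ω | J i ω = j} = 1 / (n : ℝ)) (G : (ι → Fin n) → Prop) :
    1 - failCount G * (1 / (n : ℝ)) ^ Fintype.card ι ≤ P.real {ω | G (fun i => J i ω)} := by
  classical
  have hpt : ∀ j : ι → Fin n, P.real {ω | ∀ i, J i ω = j i} = (1 / (n : ℝ)) ^ Fintype.card ι := by
    intro j
    have h1 := hJ.measure_inter_preimage_eq_mul Finset.univ (sets := fun i => {j i})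
      (fun i _ => measurableSet_singleton _)
    have e : (⋂ i ∈ Finset.univ, J i ⁻¹' {j i}) = {ω | ∀ i, J i ω = j i} := by
      ext ω; simp
    rw [e] at h1
    rw [measureReal_def, h1, ENNReal.toReal_prod]
    have : ∀ i, (P (J i ⁻¹' {j i})).toReal = 1 / (n : ℝ) := fun i => hJunif i (j i)
    simp [this]
  -- Subadditivity over the failing configurations suffices, so the good event need not be shown
  -- measurable.
  have hsub : (Set.univ : Set Ω) ⊆ {ω | G (fun i => J i ω)} ∪
      ⋃ j ∈ (Finset.univ.filter fun j : ι → Fin n => ¬ G j), {ω | ∀ i, J i ω = j i} := by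
    intro ω _
    by_cases h : G (fun i => J i ω)
    · exact Or.inl h
    · right
      simp only [Set.mem_iUnion, Finset.mem_filter, Finset.mem_univ, true_and]
      exact ⟨_, h, fun i => rfl⟩
  have h1 := (measureReal_mono (μ := P) hsub).trans (measureReal_union_le _ _)
  rw [probReal_univ] at h1
  have h2 := measureReal_biUnion_finset_le (μ := P)
    (Finset.univ.filter fun j : ι → Fin n => ¬ G j) (fun j => {ω | ∀ i, J i ω = j i})
  simp only [hpt, Finset.sum_const, nsmul_eq_mul] at h2
  have h3 : failCount G = ((Finset.univ.filter fun j : ι → Fin n => ¬ G j).card : ℝ) := by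
    unfold failCount
    congr!
  rw [h3]
  linarith

end Law

/-! ### Rational bounds for the logarithm and the Poisson rate -/

/-- The [2/1] Padé approximant at 1. The derivative of the difference has the sign of (t - 1)³, so
the minimum is at 1. -/
lemma log_le_pade {x : ℝ} (hx : 0 < x) : Real.log x ≤ (x - 1) * (x + 5) / (4 * x + 2) := by
  set F : ℝ → ℝ := fun x => (x - 1) * (x + 5) / (4 * x + 2) - Real.log x with hF
  have hder : ∀ t : ℝ, 0 < t → HasDerivAt F (4 * (t - 1) ^ 3 / (t * (4 * t + 2) ^ 2)) t := by
    intro t ht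
    have h1 : HasDerivAt (fun x : ℝ => (x - 1) * (x + 5)) (1 * (t + 5) + (t - 1) * 1) t :=
      ((hasDerivAt_id t).sub_const 1).mul ((hasDerivAt_id t).add_const 5)
    have h2 : HasDerivAt (fun x : ℝ => 4 * x + 2) (4 * 1) t :=
      ((hasDerivAt_id t).const_mul 4).add_const 2
    have h3 := (h1.div h2 (by positivity)).sub (Real.hasDerivAt_log ht.ne')
    refine h3.congr_deriv ?_
    field_simp
    ring
  have hcont : ∀ s : Set ℝ, (∀ t ∈ s, 0 < t) → ContinuousOn F s := fun s hs t ht =>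
    (hder t (hs t ht)).continuousAt.continuousWithinAt
  have hF1 : F 1 = 0 := by simp [hF]
  have key : F 1 ≤ F x := by
    rcases le_total 1 x with h | h
    · refine monotoneOn_of_deriv_nonneg (convex_Ici 1)
        (hcont _ fun t ht => by linarith [Set.mem_Ici.1 ht]) ?_ ?_ Set.self_mem_Ici h h
      · rw [interior_Ici]
        exact fun t ht => (hder t (by linarith [Set.mem_Ioi.1 ht])).differentiableAt
          |>.differentiableWithinAt
      · rw [interior_Ici]
        intro t ht
        have ht : 1 < t := ht
        rw [(hder t (by linarith)).deriv]
        have : 0 < t - 1 := by linarith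
        positivity
    · refine antitoneOn_of_deriv_nonpos (convex_Ioc 0 1)
        (hcont _ fun t ht => ht.1) ?_ ?_ ⟨hx, h⟩ ⟨one_pos, le_rfl⟩ h
      · rw [interior_Ioc]
        exact fun t ht => (hder t ht.1).differentiableAt.differentiableWithinAt
      · rw [interior_Ioc]
        intro t ht
        rw [(hder t ht.1).deriv]
        have h0 := ht.1
        have h3 : (t - 1) ^ 3 ≤ 0 := by
          have : (t - 1) ^ 3 = -((1 - t) ^ 3) := by ring
          rw [this]
          have : 0 ≤ 1 - t := by linarith [ht.2]
          have : 0 ≤ (1 - t) ^ 3 := by positivity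
          linarith
        exact div_nonpos_of_nonpos_of_nonneg (by linarith) (by positivity)
  rw [hF1] at key
  simp only [hF] at key
  linarith

lemma pade_le_log {x : ℝ} (hx : 0 < x) :
    (x - 1) * (5 * x + 1) / (x * (2 * x + 4)) ≤ Real.log x := by
  have h := log_le_pade (inv_pos.2 hx)
  rw [Real.log_inv] at h
  have e : (x⁻¹ - 1) * (x⁻¹ + 5) / (4 * x⁻¹ + 2) =
      -((x - 1) * (5 * x + 1) / (x * (2 * x + 4))) := by
    field_simp
    ring
  linarith

/-- A Bernstein-type rational bound, with the exact leading behaviour (x - 1)²/2 at 1. -/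
lemma le_poissonRate {x : ℝ} (hx : 0 < x) : 3 * (x - 1) ^ 2 / (4 + 2 * x) ≤ poissonRate x := by
  have h := mul_le_mul_of_nonneg_left (pade_le_log hx) hx.le
  have e : x * ((x - 1) * (5 * x + 1) / (x * (2 * x + 4))) - x + 1 =
      3 * (x - 1) ^ 2 / (4 + 2 * x) := by
    field_simp
    ring
  unfold poissonRate
  linarith

lemma le_poissonRate_inv {q : ℝ} (hq : 0 < q) :
    3 * (q - 1) ^ 2 / (q * (4 * q + 2)) ≤ poissonRate (1 / q) := by
  refine le_of_eq_of_le ?_ (le_poissonRate (one_div_pos.2 hq))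
  field_simp
  ring

lemma poissonRate_inv {q : ℝ} (hq : q ≠ 0) :
    poissonRate (1 / q) = (q - 1 - Real.log q) / q := by
  unfold poissonRate
  rw [one_div, Real.log_inv]
  field_simp
  ring

/-- Recentred at c: away from 1 the Padé bound is too weak, so it is used near points whose
logarithm is known. -/
lemma log_le_log_add_pade {c x : ℝ} (hc : 0 < c) (hx : 0 < x) :
    Real.log x ≤ Real.log c + (x - c) * (x + 5 * c) / (c * (4 * x + 2 * c)) := by
  have h := log_le_pade (div_pos hx hc)
  rw [Real.log_div hx.ne' hc.ne'] at h
  have e : (x / c - 1) * (x / c + 5) / (4 * (x / c) + 2) =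
      (x - c) * (x + 5 * c) / (c * (4 * x + 2 * c)) := by
    field_simp
  linarith

lemma exp_neg_le {c : ℝ} (hc : 0 ≤ c) :
    Real.exp (-c) ≤ (1 + c + c ^ 2 / 2 + c ^ 3 / 6 + c ^ 4 / 24 + c ^ 5 / 120 + c ^ 6 / 720)⁻¹ := by
  rw [Real.exp_neg]
  refine inv_anti₀ (by positivity) ?_
  have := Real.sum_le_exp_of_nonneg hc 7
  simpa [Finset.sum_range_succ, Nat.factorial] using this

lemma exp_neg_le_of {c b r : ℝ} (hb : 0 ≤ b) (hbc : b ≤ c)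
    (h : (1 + b + b ^ 2 / 2 + b ^ 3 / 6 + b ^ 4 / 24 + b ^ 5 / 120 + b ^ 6 / 720)⁻¹ ≤ r) :
    Real.exp (-c) ≤ r :=
  (Real.exp_le_exp.2 (neg_le_neg hbc)).trans ((exp_neg_le hb).trans h)

/-! ### The tangent bound behind the soft minimum -/

/-- For x = x₀, the difference of logarithms decreases up to its zero at 1, increases up to x₀ - 1
and decreases afterwards, so on (0, Y] it suffices to check the endpoint Y. Bernoulli's inequality
with exponent x/x₀ extends the result to x ≥ x₀. -/
lemma one_add_mul_le_exp_of_tangent {x₀ Y x y : ℝ} (hx₀ : 2 < x₀) (hY : x₀ - 1 ≤ Y)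
    (hend : 1 + x₀ * (Y - 1) ≤ Real.exp (x₀ * (1 - 1 / Y))) (hx : x₀ ≤ x) (hy : 0 < y)
    (hyY : y ≤ Y) : 1 + x * (y - 1) ≤ Real.exp (x * (1 - 1 / y)) := by
  have base : 1 + x₀ * (y - 1) ≤ Real.exp (x₀ * (1 - 1 / y)) := by
    rcases le_or_gt (1 + x₀ * (y - 1)) 0 with h0 | h0
    · exact h0.trans (Real.exp_pos _).le
    set F : ℝ → ℝ := fun t => x₀ * (1 - 1 / t) - Real.log (1 + x₀ * (t - 1)) with hF
    set y₀ : ℝ := 1 - 1 / x₀ with hy₀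
    have hx0 : 0 < x₀ := by linarith
    have hdom : ∀ t, y₀ < t ↔ 0 < 1 + x₀ * (t - 1) := by
      intro t
      have : 1 + x₀ * (t - 1) = x₀ * (t - y₀) := by rw [hy₀]; field_simp; ring
      rw [this, mul_pos_iff_of_pos_left hx0, sub_pos]
    have hy₀0 : 0 < y₀ := by
      rw [hy₀, sub_pos, div_lt_one hx0]; linarith
    have hy₀1 : y₀ < 1 := by rw [hy₀]; linarith [one_div_pos.2 hx0]
    have hder : ∀ t : ℝ, y₀ < t →
        HasDerivAt F (x₀ * ((t - 1) * (x₀ - 1 - t)) / (t ^ 2 * (1 + x₀ * (t - 1)))) t := by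
      intro t ht
      have ht0 : 0 < t := hy₀0.trans ht
      have ht1 := (hdom t).1 ht
      have h1 : HasDerivAt (fun t : ℝ => x₀ * (1 - 1 / t)) (x₀ * (1 / t ^ 2)) t := by
        have := ((hasDerivAt_inv ht0.ne').const_sub 1).const_mul x₀
        simpa [one_div] using this
      have h2 : HasDerivAt (fun t : ℝ => 1 + x₀ * (t - 1)) (x₀ * 1) t :=
        (((hasDerivAt_id t).sub_const 1).const_mul x₀).const_add 1
      have h3 := h1.sub (h2.log ht1.ne')
      refine h3.congr_deriv ?_
      field_simp
      ring
    have hcont : ∀ s : Set ℝ, (∀ t ∈ s, y₀ < t) → ContinuousOn F s := fun s hs t ht =>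
      (hder t (hs t ht)).continuousAt.continuousWithinAt
    have hdiff : ∀ s : Set ℝ, (∀ t ∈ s, y₀ < t) → DifferentiableOn ℝ F s := fun s hs t ht =>
      (hder t (hs t ht)).differentiableAt.differentiableWithinAt
    have hF1 : F 1 = 0 := by simp [hF]
    have hyd : y₀ < y := (hdom y).2 h0
    have hYd : y₀ < Y := by linarith
    have key : 0 ≤ F y := by
      rcases le_total y 1 with h | h
      · rw [← hF1]
        refine antitoneOn_of_deriv_nonpos (convex_Ioc y₀ 1) (hcont _ fun t ht => ht.1) ?_ ?_
          ⟨hyd, h⟩ ⟨hy₀1, le_rfl⟩ h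
        · rw [interior_Ioc]; exact hdiff _ fun t ht => ht.1
        · rw [interior_Ioc]
          intro t ht
          rw [(hder t ht.1).deriv]
          have h1 := (hdom t).1 ht.1
          have h2 : (t - 1) * (x₀ - 1 - t) ≤ 0 :=
            mul_nonpos_of_nonpos_of_nonneg (by linarith [ht.2]) (by linarith [ht.2])
          have h3 : 0 < t := hy₀0.trans ht.1
          exact div_nonpos_of_nonpos_of_nonneg (mul_nonpos_of_nonneg_of_nonpos hx0.le h2)
            (by positivity)
      rcases le_total y (x₀ - 1) with h' | h'
      · rw [← hF1]
        refine monotoneOn_of_deriv_nonneg (convex_Icc 1 (x₀ - 1))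
          (hcont _ fun t ht => by linarith [ht.1]) ?_ ?_ ⟨le_rfl, by linarith⟩ ⟨h, h'⟩ h
        · rw [interior_Icc]; exact hdiff _ fun t ht => by linarith [ht.1]
        · rw [interior_Icc]
          intro t ht
          rw [(hder t (by linarith [ht.1])).deriv]
          have h1 := (hdom t).1 (by linarith [ht.1])
          have h2 : 0 ≤ (t - 1) * (x₀ - 1 - t) :=
            mul_nonneg (by linarith [ht.1]) (by linarith [ht.2])
          positivity
      · have hFY : 0 ≤ F Y := by
          have := Real.log_le_log ((hdom Y).1 hYd) hend
          rw [Real.log_exp] at this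
          simp only [hF]; linarith
        refine hFY.trans ?_
        refine antitoneOn_of_deriv_nonpos (convex_Icc (x₀ - 1) Y)
          (hcont _ fun t ht => by linarith [ht.1]) ?_ ?_ ⟨h', hyY⟩ ⟨hY, le_rfl⟩ hyY
        · rw [interior_Icc]; exact hdiff _ fun t ht => by linarith [ht.1]
        · rw [interior_Icc]
          intro t ht
          rw [(hder t (by linarith [ht.1])).deriv]
          have h1 := (hdom t).1 (by linarith [ht.1])
          have h2 : (t - 1) * (x₀ - 1 - t) ≤ 0 :=
            mul_nonpos_of_nonneg_of_nonpos (by linarith [ht.1]) (by linarith [ht.1])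
          exact div_nonpos_of_nonpos_of_nonneg (mul_nonpos_of_nonneg_of_nonpos hx0.le h2)
            (by positivity)
    simp only [hF] at key
    exact (Real.log_le_iff_le_exp h0).1 (by linarith)
  have hx0 : 0 < x₀ := by linarith
  have hxpos : 0 < x := by linarith
  have hb := one_add_mul_self_le_rpow_one_add (s := Real.exp (x₀ * (1 - 1 / y)) - 1)
    (by linarith [Real.exp_pos (x₀ * (1 - 1 / y))]) ((one_le_div hx0).2 hx)
  rw [add_sub_cancel, ← Real.exp_mul] at hb
  have e : x₀ * (1 - 1 / y) * (x / x₀) = x * (1 - 1 / y) := by field_simp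
  rw [e] at hb
  refine le_trans ?_ hb
  have : x / x₀ * (x₀ * (y - 1)) ≤ x / x₀ * (Real.exp (x₀ * (1 - 1 / y)) - 1) :=
    mul_le_mul_of_nonneg_left (by linarith) (by positivity)
  have e2 : x / x₀ * (x₀ * (y - 1)) = x * (y - 1) := by field_simp
  linarith

/-- The coefficients of the soft bound are chosen so that the exponential majorant touches 1/c to
first order at c = 1/z; x measures its steepness. The substitution y = 1/(z c) reduces validity for
c ≥ 1/(Y z) to the preceding lemma. -/
lemma UpperCost.tangent {m N T q z x₀ Y x : ℝ} (hz : 0 < z) (hx₀ : 2 < x₀)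
    (hY : x₀ - 1 ≤ Y) (hend : 1 + x₀ * (Y - 1) ≤ Real.exp (x₀ * (1 - 1 / Y))) (hx : x₀ ≤ x)
    (hYz : 1 < Y * z) (hq : z * (1 - 1 / x) < q) :
    UpperCost m N T q (Real.exp (T - N * poissonRate (1 / (Y * z))) +
      Real.exp T / m * (z / x * Real.exp x * Real.exp (N * (Real.exp (-(x * z) / N) - 1)) /
        (q - z * (1 - 1 / x)))) := by
  have hx0 : 0 < x := by linarith
  have hY0 : 0 < Y := by linarith
  refine UpperCost.soft (x * z) (z * (1 - 1 / x)) (z / x * Real.exp x) (1 / (Y * z))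
    (by positivity) ((div_lt_one (by linarith)).2 hYz) (by positivity) hq fun c hc => ?_
  have hc0 : 0 < c := lt_of_lt_of_le (by positivity) hc
  have h := one_add_mul_le_exp_of_tangent hx₀ hY hend hx (y := 1 / (z * c)) (by positivity) (by
    rw [div_le_iff₀ (by positivity)] at hc ⊢
    linarith)
  have e1 : z / x * Real.exp x * Real.exp (-(x * z) * c) =
      z / x * Real.exp (x * (1 - 1 / (1 / (z * c)))) := by
    rw [mul_assoc, ← Real.exp_add]
    congr 2
    field_simp
    ring
  rw [e1]
  have := mul_le_mul_of_nonneg_left h (show 0 ≤ z / x by positivity)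
  have e2 : z / x * (1 + x * (1 / (z * c) - 1)) = 1 / c - z * (1 - 1 / x) := by
    field_simp
    ring
  linarith

/-! ### Costs at the sample size `N = 3 T / η ^ 2` -/

variable {m : ℕ} {η T : ℝ}

/-- The parameter κ measures the surplus of a Chernoff exponent over T: a tail of rate f then has
normalized cost at most exp(-T κ). -/
lemma sub_mul_le_neg (hη : 0 < η) (hT : 0 ≤ T) {f κ : ℝ} (h : η ^ 2 * (1 + κ) ≤ 3 * f) :
    T - 3 * T / η ^ 2 * f ≤ -(T * κ) := by
  have : T * (1 + κ) ≤ 3 * T / η ^ 2 * f := by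
    rw [div_mul_eq_mul_div, le_div_iff₀ (by positivity)]
    nlinarith
  linarith

lemma exists_lowerCost (hη : 0 < η) (hT : 0 ≤ T) {a κ : ℝ} (ha : 0 < a)
    (h : η ^ 2 * (1 + κ) ≤ m * (3 / 2 * a ^ 2)) :
    ∃ b ≤ Real.exp (-(T * κ)) / m, LowerCost m (3 * T / η ^ 2) T (1 - a) b := by
  rcases le_or_gt 1 a with h1 | h1
  · exact ⟨0, by positivity, .trivial (by linarith)⟩
  refine ⟨_, ?_, .tail (by linarith) (by linarith)⟩
  gcongr
  have hp : 0 < 1 - a := by linarith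
  have : a ^ 2 / 2 ≤ poissonRate (1 / (1 - a)) := by
    refine le_trans ?_ (le_poissonRate_inv hp)
    rw [le_div_iff₀ (by positivity)]
    nlinarith [sq_nonneg a, mul_nonneg (sq_nonneg a) ha.le,
      mul_nonneg (mul_nonneg (sq_nonneg a) ha.le) hp.le]
  rw [mul_comm (m : ℝ), mul_assoc]
  refine sub_mul_le_neg hη hT (h.trans ?_)
  nlinarith [mul_le_mul_of_nonneg_left this (Nat.cast_nonneg (α := ℝ) m)]

lemma exists_upperCost_direct (hη : 0 < η) (hT : 0 ≤ T) {q κ : ℝ} (hq : 1 < q)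
    (h : η ^ 2 * (1 + κ) ≤ 3 * poissonRate (1 / q)) :
    ∃ a ≤ Real.exp (-(T * κ)), UpperCost m (3 * T / η ^ 2) T q a :=
  ⟨_, Real.exp_le_exp.2 (sub_mul_le_neg hη hT h), .direct hq⟩

/-- Tangency at c = 1/q with x = N log q / q makes exp(-θ/N) = 1/q, the optimal Chernoff tilt. The
main term becomes the direct cost at q divided by m, at the price of the much rarer event that some
S_i falls below 1/(3q). The pair x₀ = 2.9, Y = 3 satisfies the endpoint condition, so x ≥ 2.9 is
required. -/
lemma exists_upperCost_tangent (hη : 0 < η) (hT : 0 < T) {q κ κ' : ℝ} (hq : 1 < q)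
    (hx : 2.9 * (η ^ 2 * q) ≤ 3 * T * Real.log q)
    (h : η ^ 2 * (1 + κ) ≤ 3 * poissonRate (1 / (3 * q)))
    (h' : η ^ 2 * (1 + κ') ≤ 3 * poissonRate (1 / q)) :
    ∃ a ≤ Real.exp (-(T * κ)) + Real.exp (-(T * κ')) / m,
      UpperCost m (3 * T / η ^ 2) T q a := by
  set N := 3 * T / η ^ 2 with hN
  have hN0 : 0 < N := by positivity
  set x := N * Real.log q / q with hxdef
  have hq0 : 0 < q := by linarith
  have hx29 : 2.9 ≤ x := by
    rw [hxdef, hN, le_div_iff₀ hq0, div_mul_eq_mul_div, le_div_iff₀ (by positivity)]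
    linarith
  have hx0 : 0 < x := by linarith
  have hend : (1 : ℝ) + 2.9 * (3 - 1) ≤ Real.exp (2.9 * (1 - 1 / 3)) := by
    have := Real.sum_le_exp_of_nonneg (x := 2.9 * (1 - 1 / 3)) (by norm_num) 9
    refine le_trans ?_ this
    norm_num [Finset.sum_range_succ, Nat.factorial]
  have hA : q * (1 - 1 / x) < q := by
    have := one_div_pos.2 hx0
    nlinarith
  refine ⟨_, ?_, .tangent (z := q) (x := x) hq0 (by norm_num) (by norm_num) hend hx29
    (by linarith) hA⟩
  have e1 : -(x * q) / N = -Real.log q := by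
    rw [hxdef]
    field_simp
  have e2 : Real.exp T / m * (q / x * Real.exp x * Real.exp (N * (Real.exp (-(x * q) / N) - 1)) /
      (q - q * (1 - 1 / x))) = Real.exp (T - N * poissonRate (1 / q)) / m := by
    have e3 : q - q * (1 - 1 / x) = q / x := by ring
    have e4 : T - N * poissonRate (1 / q) = T + (x + N * (1 / q - 1)) := by
      rw [poissonRate_inv hq0.ne', hxdef]
      field_simp
      ring
    rw [e1, e3, e4, Real.exp_neg, Real.exp_log hq0, Real.exp_add T, Real.exp_add x, ← one_div q]
    field_simp
  rw [e2]
  gcongr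
  · exact sub_mul_le_neg hη hT.le h
  · exact sub_mul_le_neg hη hT.le h'

lemma exists_upperCost_chord (hη : 0 < η) (hT : 0 ≤ T) {q l r ε κ₁ κ₂ κ₃ : ℝ} (hl0 : 0 < l)
    (hl1 : l < 1) (hr : 1 < r) (hε0 : 0 < ε) (hε1 : ε < 1) (hq : (l + r - 1 + ε) / (l * r) ≤ q)
    (h₁ : η ^ 2 * (1 + κ₁) ≤ 3 * poissonRate l) (h₂ : η ^ 2 * (1 + κ₂) ≤ 3 * poissonRate r)
    (h₃ : η ^ 2 * (1 + κ₃) ≤ m * (3 / 2 * ε ^ 2)) :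
    ∃ a ≤ Real.exp (-(T * κ₁)) + Real.exp (-(T * κ₂)) + Real.exp (-(T * κ₃)) / m,
      UpperCost m (3 * T / η ^ 2) T q a := by
  refine ⟨_, ?_, .chord l r ε hl0 hl1 hr hε0 hε1 hq⟩
  gcongr
  · exact sub_mul_le_neg hη hT h₁
  · exact sub_mul_le_neg hη hT h₂
  · have : ε ^ 2 / 2 ≤ poissonRate (1 - ε) := by
      refine le_trans ?_ (le_poissonRate (by linarith))
      rw [le_div_iff₀ (by linarith)]
      nlinarith [mul_nonneg (sq_nonneg ε) hε0.le]
    rw [mul_comm (m : ℝ), mul_assoc]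
    refine sub_mul_le_neg hη hT (h₃.trans ?_)
    nlinarith [mul_le_mul_of_nonneg_left this (Nat.cast_nonneg (α := ℝ) m)]

/-! ### Tools for the numerical part -/

/-- Polynomial inequalities on an interval or a box are certified below by writing the difference as
a nonnegative combination of Bernstein products; `linarith` finds the coefficients. -/
lemma bernstein_nonneg {a b x : ℝ} (ha : a ≤ x) (hb : x ≤ b) (i j : ℕ) :
    0 ≤ (x - a) ^ i * (b - x) ^ j :=
  mul_nonneg (pow_nonneg (sub_nonneg.2 ha) _) (pow_nonneg (sub_nonneg.2 hb) _)

lemma bernstein_nonneg₂ {a b c d x y : ℝ} (ha : a ≤ x) (hb : x ≤ b) (hc : c ≤ y) (hd : y ≤ d)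
    (i j k l : ℕ) : 0 ≤ (x - a) ^ i * (b - x) ^ j * ((y - c) ^ k * (d - y) ^ l) :=
  mul_nonneg (bernstein_nonneg ha hb i j) (bernstein_nonneg hc hd k l)

lemma le_three_mul_poissonRate_inv {q c : ℝ} (hq : 0 < q)
    (h : c * (q * (4 * q + 2)) ≤ 9 * (q - 1) ^ 2) : c ≤ 3 * poissonRate (1 / q) := by
  have h1 := le_poissonRate_inv hq
  rw [div_le_iff₀ (by positivity)] at h1
  have : 0 < q * (4 * q + 2) := by positivity
  exact le_of_mul_le_mul_right (by linarith) this

lemma le_three_mul_poissonRate_inv_of_log {q b L c : ℝ} (hq : 0 < q) (hb : 0 < b)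
    (hL : Real.log b ≤ L)
    (h : c * q * (b * (4 * q + 2 * b)) ≤
      3 * ((q - 1 - L) * (b * (4 * q + 2 * b)) - (q - b) * (q + 5 * b))) :
    c ≤ 3 * poissonRate (1 / q) := by
  have h1 := log_le_log_add_pade hb hq
  have hd : 0 < b * (4 * q + 2 * b) := by positivity
  rw [poissonRate_inv hq.ne', ← mul_div_assoc, le_div_iff₀ hq]
  refine le_of_mul_le_mul_right ?_ hd
  have e : (q - b) * (q + 5 * b) / (b * (4 * q + 2 * b)) * (b * (4 * q + 2 * b)) =
    (q - b) * (q + 5 * b) := div_mul_cancel₀ _ hd.ne'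
  have := mul_le_mul_of_nonneg_right (h1.trans (add_le_add_left hL _)) hd.le
  rw [add_mul, e] at this
  linarith

lemma le_three_mul_poissonRate_inv_three_mul {q : ℝ} (hq : 1 ≤ q) :
    0.855 ≤ 3 * poissonRate (1 / (3 * q)) :=
  le_three_mul_poissonRate_inv (by linarith) (by nlinarith)

lemma log_two_le : Real.log 2 ≤ 0.6931472 := by linarith [Real.log_two_lt_d9]

lemma log_four_le : Real.log 4 ≤ 2 * 0.6931472 := by
  rw [show (4 : ℝ) = 2 ^ 2 by norm_num, Real.log_pow]
  push_cast
  linarith [log_two_le]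

lemma le_log_two : 0.6931471 ≤ Real.log 2 := by linarith [Real.log_two_gt_d9]

/-- In the symmetric case this is monotonicity of α²/(1 + 3α/4). It permits replacing 1/√2 by a
rational lower bound. -/
lemma Admissible.mono {α α' p q : ℝ} (hα : 0 < α) (h : Admissible α p q) (hle : α ≤ α') :
    Admissible α' p q := by
  cases h with
  | symm a ha h =>
    refine .symm a ha ?_
    have h1 : a ^ 2 ≤ 3 / 2 * α ^ 2 := by nlinarith [mul_nonneg (sq_nonneg a) hα.le]
    have h2 : a ^ 2 * (α' - α) ≤ 3 / 2 * α ^ 2 * (α' - α) :=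
      mul_le_mul_of_nonneg_right h1 (by linarith)
    have h4 : α ^ 2 ≤ α' ^ 2 := by gcongr
    have h5 : a ^ 2 * (1 + 3 / 4 * α) * α' ^ 2 ≤ 3 / 2 * α ^ 2 * α' ^ 2 :=
      mul_le_mul_of_nonneg_right h (sq_nonneg _)
    have h6 : (1 + 3 / 4 * α') * α ^ 2 ≤ (1 + 3 / 4 * α) * α' ^ 2 := by
      nlinarith [mul_nonneg (mul_nonneg hα.le (hα.le.trans hle)) (sub_nonneg.2 hle)]
    refine le_of_mul_le_mul_right (a := α ^ 2) ?_ (by positivity)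
    nlinarith [mul_le_mul_of_nonneg_left h6 (sq_nonneg a)]
  | large p q h1 h2 h3 h4 => exact .large p q (h1.trans hle) h2 h3 (by linarith)

/-- Some admissible pair has total failure cost at most one. -/
def HasUnitCost (m : ℕ) (η T α : ℝ) : Prop :=
  ∃ p q a b, Admissible α p q ∧ UpperCost m (3 * T / η ^ 2) T q a ∧
    LowerCost m (3 * T / η ^ 2) T p b ∧ a + b ≤ 1

lemma HasUnitCost.mono {m : ℕ} {η T α α' : ℝ} (hα : 0 < α) (h : HasUnitCost m η T α)
    (hle : α ≤ α') : HasUnitCost m η T α' := by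
  obtain ⟨p, q, a, b, h, h'⟩ := h
  exact ⟨p, q, a, b, h.mono hα hle, h'⟩

lemma HasUnitCost.intro {m : ℕ} {η T α p q A B : ℝ} (h : Admissible α p q)
    (hu : ∃ a ≤ A, UpperCost m (3 * T / η ^ 2) T q a)
    (hl : ∃ b ≤ B, LowerCost m (3 * T / η ^ 2) T p b) (hAB : A + B ≤ 1) :
    HasUnitCost m η T α := by
  obtain ⟨a, ha, hu⟩ := hu
  obtain ⟨b, hb, hl⟩ := hl
  exact ⟨p, q, a, b, h, hu, hl, by linarith⟩

lemma exists_lowerCost_of_mul {m : ℕ} {η T : ℝ} (hη : 0 < η) (hT : 0 ≤ T) {a κ : ℝ} (ha : 0 < a)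
    (h : η ^ 2 * (1 + κ) * ((1 - a) * (6 - 4 * a)) ≤ m * (9 * a ^ 2)) :
    ∃ b ≤ Real.exp (-(T * κ)) / m, LowerCost m (3 * T / η ^ 2) T (1 - a) b := by
  rcases le_or_gt 1 a with h1 | h1
  · exact ⟨0, by positivity, .trivial (by linarith)⟩
  refine ⟨_, ?_, .tail (by linarith) (by linarith)⟩
  gcongr
  have hp : 0 < 1 - a := by linarith
  have h2 := le_poissonRate_inv hp
  have hd : 0 < (1 - a) * (6 - 4 * a) := mul_pos hp (by linarith)
  have e : (1 - a) * (4 * (1 - a) + 2) = (1 - a) * (6 - 4 * a) := by ring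
  rw [e, div_le_iff₀ hd] at h2
  rw [mul_comm (m : ℝ), mul_assoc]
  refine sub_mul_le_neg hη hT (le_of_mul_le_mul_right (h.trans ?_) hd)
  have := mul_le_mul_of_nonneg_left h2 (Nat.cast_nonneg (α := ℝ) m)
  linarith

lemma exists_lowerCost_zero {m : ℕ} {η T : ℝ} :
    ∃ b ≤ (0 : ℝ), LowerCost m (3 * T / η ^ 2) T 0 b := ⟨0, le_rfl, .trivial le_rfl⟩

/-! ### One or two machines -/

variable {m : ℕ} {η T : ℝ}

/-- Both costs decrease in T, so they are only compared with 1 at T = log 2, the least value allowed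
by md ≥ 2. -/
lemma hasUnitCost_of_direct {α κ κ' q : ℝ} (hη : 0 < η) (hT : Real.log 2 ≤ T)
    (hadm : Admissible α (2 - q) q) (hq : 1 < q) (hm : 0 < m) (hκ0 : 0 ≤ κ) (hκ0' : 0 ≤ κ')
    (h : η ^ 2 * (1 + κ) ≤ 3 * poissonRate (1 / q))
    (h' : η ^ 2 * (1 + κ') * ((2 - q) * (10 - 4 * q)) ≤ m * (9 * (q - 1) ^ 2))
    (hsum : Real.exp (-(0.6931471 * κ)) + Real.exp (-(0.6931471 * κ')) / m ≤ 1) :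
    HasUnitCost m η T α := by
  have hT' := le_log_two.trans hT
  have hT0 : 0 ≤ T := by linarith
  have h2 := exists_lowerCost_of_mul (m := m) (a := q - 1) (κ := κ') hη hT0 (by linarith)
    (le_of_eq_of_le (by ring) h')
  rw [show (1 : ℝ) - (q - 1) = 2 - q by ring] at h2
  refine .intro hadm (exists_upperCost_direct hη hT0 hq h) h2 (le_trans ?_ hsum)
  gcongr

/-- The lower bound p = 0 is free, so the whole budget goes to q. The constant 1.3431 is (1.25 +
1.4362)/2. -/
lemma hasUnitCost_of_direct_zero {α q : ℝ} (hη : 0 < η) (hT : Real.log 2 ≤ T) (hα : 1 / 2 ≤ α)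
    (hq : 2 ≤ q) (hqα : 1.3431 * q ≤ 1 + 2 * α) (h : η ^ 2 ≤ 3 * poissonRate (1 / q)) :
    HasUnitCost m η T α := by
  have hT0 : 0 ≤ T := by linarith [le_log_two]
  refine .intro (.large 0 q hα zero_le_one (by linarith) (by linarith))
    (exists_upperCost_direct (κ := 0) hη hT0 (by linarith) (by linarith)) exists_lowerCost_zero ?_
  simp

/-- The rational approximation of the largest symmetric radius admissible for `α`. -/
def symmRadius (α : ℝ) : ℝ := 1.22 * α / (1 + 0.375 * α)

lemma symmRadius_mul {α : ℝ} (hα : 0 ≤ α) : symmRadius α * (1 + 0.375 * α) = 1.22 * α :=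
  div_mul_cancel₀ _ (by positivity)

lemma symmRadius_pos {α : ℝ} (hα : 0 < α) : 0 < symmRadius α := by
  unfold symmRadius; positivity

/-- Here 1.22 < √(3/2), and 1 + 0.375 α bounds √(1 + 3α/4) from above. -/
lemma admissible_symmRadius {α : ℝ} (hα : 0 < α) :
    Admissible α (1 - symmRadius α) (1 + symmRadius α) := by
  refine .symm _ (symmRadius_pos hα) ?_
  have h := symmRadius_mul hα.le
  refine le_of_mul_le_mul_right (a := (1 + 0.375 * α) ^ 2) ?_ (by positivity)
  have e : symmRadius α ^ 2 * (1 + 3 / 4 * α) * (1 + 0.375 * α) ^ 2 =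
      (1.22 * α) ^ 2 * (1 + 3 / 4 * α) := by rw [← h]; ring
  rw [e]
  nlinarith [sq_nonneg α, mul_nonneg (sq_nonneg α) hα.le, mul_nonneg (sq_nonneg α) (sq_nonneg α)]

/-- The radius of a symmetric pair that is admissible through `Admissible.large`. -/
def largeRadius (α : ℝ) : ℝ := 0.6962 * (2 * α - 0.25)

/-- With midpoint 1 the condition reads 0.25 + 1.4362 r ≤ 2α, and 0.6962 is just below 1/1.4362. For
α ≤ 1/2 the same radius happens to satisfy the symmetric criterion. -/
lemma admissible_largeRadius {α : ℝ} (hα : 0.125 < α) :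
    Admissible α (1 - largeRadius α) (1 + largeRadius α) := by
  unfold largeRadius
  rcases le_total (1 / 2) α with h | h
  · exact .large _ _ h (by linarith) (by linarith) (by linarith)
  · refine .symm _ (by linarith) ?_
    have B := bernstein_nonneg hα.le h
    linarith [B 0 3, B 1 2, B 2 1, B 3 0]

lemma tangent_condition {q T T₀ : ℝ} (hq : 1 ≤ q) (hT : T₀ ≤ T) (hT₀ : 0 ≤ T₀)
    (h : 2.9 * η ^ 2 * q * (q * (2 * q + 4)) ≤ 3 * T₀ * ((q - 1) * (5 * q + 1))) :
    2.9 * (η ^ 2 * q) ≤ 3 * T * Real.log q := by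
  have hq0 : 0 < q := by linarith
  have h1 := pade_le_log hq0
  have h2 : 3 * T₀ * Real.log q ≤ 3 * T * Real.log q := by
    have := Real.log_nonneg hq
    gcongr
  refine le_trans ?_ h2
  rw [div_le_iff₀ (by positivity)] at h1
  refine le_of_mul_le_mul_right (a := q * (2 * q + 4)) ?_ (by positivity)
  nlinarith [mul_le_mul_of_nonneg_left h1 hT₀]

lemma hasUnitCost_of_direct_symmRadius {α κ κ' : ℝ} (hη : 0 < η) (hT : Real.log 2 ≤ T)
    (hα : 0 < α) (hm : 0 < m) (hκ0 : 0 ≤ κ) (hκ0' : 0 ≤ κ')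
    (h : η ^ 2 * (1 + κ) * ((1 + 1.595 * α) * (6 + 7.13 * α)) ≤ 9 * (1.22 * α) ^ 2)
    (h' : η ^ 2 * (1 + κ') * ((1 - 0.845 * α) * (6 - 2.63 * α)) ≤ m * (9 * (1.22 * α) ^ 2))
    (hsum : Real.exp (-(0.6931471 * κ)) + Real.exp (-(0.6931471 * κ')) / m ≤ 1) :
    HasUnitCost m η T α := by
  have ha := symmRadius_pos hα
  have hd : 0 < (1 + 0.375 * α) ^ 2 := by positivity
  have e := symmRadius_mul hα.le
  have hadm := admissible_symmRadius hα
  set a := symmRadius α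
  have e1 : (1 + 1.595 * α) * (6 + 7.13 * α) = (1 + a) * (6 + 4 * a) * (1 + 0.375 * α) ^ 2 := by
    have h1 : 1 + 1.595 * α = (1 + a) * (1 + 0.375 * α) := by linarith
    have h2 : 6 + 7.13 * α = (6 + 4 * a) * (1 + 0.375 * α) := by linarith
    rw [h1, h2]; ring
  have e2 : (1 - 0.845 * α) * (6 - 2.63 * α) = (1 - a) * (6 - 4 * a) * (1 + 0.375 * α) ^ 2 := by
    have h1 : 1 - 0.845 * α = (1 - a) * (1 + 0.375 * α) := by linarith
    have h2 : 6 - 2.63 * α = (6 - 4 * a) * (1 + 0.375 * α) := by linarith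
    rw [h1, h2]; ring
  rw [e1, ← e] at h
  rw [e2, ← e] at h'
  refine hasUnitCost_of_direct (q := 1 + a) hη hT ?_ (by linarith) hm hκ0 hκ0'
    (le_three_mul_poissonRate_inv (by linarith) ?_) ?_ hsum
  · convert hadm using 1; ring
  · exact le_of_mul_le_mul_right (le_of_eq_of_le (by ring) (h.trans_eq (by ring))) hd
  · exact le_of_mul_le_mul_right (le_of_eq_of_le (by ring) (h'.trans_eq (by ring))) hd

lemma hasUnitCost_one (hη0 : 0 < η) (hη1 : η < 1) (hT : Real.log 2 ≤ T) :
    HasUnitCost 1 η T (η + η ^ 2) := by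
  have hα : 0 < η + η ^ 2 := by positivity
  rcases le_total 0.6 η with h | h
  · refine hasUnitCost_of_direct_zero (q := 0.7445 * (1 + 2 * (η + η ^ 2))) hη0 hT (by nlinarith)
      (by nlinarith) (by nlinarith)
      (le_three_mul_poissonRate_inv_of_log (by positivity) two_pos log_two_le ?_)
    have B := bernstein_nonneg h hη1.le
    linarith [B 0 6, B 1 5, B 2 4, B 3 3, B 4 2, B 5 1, B 6 0]
  rcases le_total η 0.1 with h1 | h1
  · refine hasUnitCost_of_direct_symmRadius (κ := 1) (κ' := 1.2) hη0 hT hα one_pos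
      (by norm_num) (by norm_num) ?_ ?_ ?_
    · have B := bernstein_nonneg hη0.le h1
      linarith [B 0 6, B 1 5, B 2 4, B 3 3, B 4 2, B 5 1, B 6 0]
    · have B := bernstein_nonneg hη0.le h1
      push_cast
      linarith [B 0 6, B 1 5, B 2 4, B 3 3, B 4 2, B 5 1, B 6 0]
    · have h1 := exp_neg_le_of (c := 0.6931471 * 1) (b := 0.693) (r := 0.51) (by norm_num)
        (by norm_num) (by norm_num)
      have h2 := exp_neg_le_of (c := 0.6931471 * 1.2) (b := 0.83) (r := 0.44) (by norm_num)
        (by norm_num) (by norm_num)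
      norm_num at h1 h2 ⊢
      linarith
  rcases le_total η 0.3 with h2 | h2
  · refine hasUnitCost_of_direct_symmRadius (κ := 0.58) (κ' := 2) hη0 hT hα one_pos
      (by norm_num) (by norm_num) ?_ ?_ ?_
    · have B := bernstein_nonneg h1 h2
      linarith [B 0 6, B 1 5, B 2 4, B 3 3, B 4 2, B 5 1, B 6 0]
    · have B := bernstein_nonneg h1 h2
      push_cast
      linarith [B 0 6, B 1 5, B 2 4, B 3 3, B 4 2, B 5 1, B 6 0]
    · have h1 := exp_neg_le_of (c := 0.6931471 * 0.58) (b := 0.4) (r := 0.68) (by norm_num)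
        (by norm_num) (by norm_num)
      have h2 := exp_neg_le_of (c := 0.6931471 * 2) (b := 1.38) (r := 0.26) (by norm_num)
        (by norm_num) (by norm_num)
      norm_num at h1 h2 ⊢
      linarith
  · refine hasUnitCost_of_direct_symmRadius (κ := 0.05) (κ' := 5.7) hη0 hT hα one_pos
      (by norm_num) (by norm_num) ?_ ?_ ?_
    · have B := bernstein_nonneg h2 h
      linarith [B 0 6, B 1 5, B 2 4, B 3 3, B 4 2, B 5 1, B 6 0]
    · have B := bernstein_nonneg h2 h
      push_cast
      linarith [B 0 6, B 1 5, B 2 4, B 3 3, B 4 2, B 5 1, B 6 0]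
    · have h1 := exp_neg_le_of (c := 0.6931471 * 0.05) (b := 0.034) (r := 0.967) (by norm_num)
        (by norm_num) (by norm_num)
      have h2 := exp_neg_le_of (c := 0.6931471 * 5.7) (b := 3.9) (r := 0.03) (by norm_num)
        (by norm_num) (by norm_num)
      norm_num at h1 h2 ⊢
      linarith

/-- The coefficient 0.7071067 lies just below 1/√2. For small η the direct bound no longer suffices;
the tangent bound with κ' = 0 costs 1/2, leaving the rest for the other events. -/
lemma hasUnitCost_two (hη0 : 0 < η) (hη1 : η < 1) (hT : Real.log 2 ≤ T) :
    HasUnitCost 2 η T (0.7071067 * η + η ^ 2) := by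
  have hα : 0 < 0.7071067 * η + η ^ 2 := by positivity
  have hT' := le_log_two.trans hT
  rcases le_total 0.65 η with h | h
  · have hlog : Real.log 3.2 ≤ 1.16316 := by
      rw [Real.log_le_iff_le_exp (by norm_num)]
      have := Real.sum_le_exp_of_nonneg (x := 1.16316) (by norm_num) 11
      refine le_trans ?_ this
      norm_num [Finset.sum_range_succ, Nat.factorial]
    refine hasUnitCost_of_direct_zero (q := 0.7445 * (1 + 2 * (0.7071067 * η + η ^ 2))) hη0 hT
      (by nlinarith) (by nlinarith) (by nlinarith)
      (le_three_mul_poissonRate_inv_of_log (by positivity) (by norm_num) hlog ?_)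
    have B := bernstein_nonneg h hη1.le
    linarith [B 0 6, B 1 5, B 2 4, B 3 3, B 4 2, B 5 1, B 6 0]
  rcases le_total 0.43 η with h1 | h1
  · have hr : 0 < largeRadius (0.7071067 * η + η ^ 2) := by unfold largeRadius; nlinarith
    refine hasUnitCost_of_direct (q := 1 + largeRadius (0.7071067 * η + η ^ 2)) (κ := 0.03)
      (κ' := 5) hη0 hT ?_ (by linarith) two_pos (by norm_num) (by norm_num)
      (le_three_mul_poissonRate_inv (by linarith) ?_) ?_ ?_
    · convert admissible_largeRadius (α := 0.7071067 * η + η ^ 2) (by nlinarith) using 1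
      ring
    · have B := bernstein_nonneg h1 h
      unfold largeRadius
      linarith [B 0 6, B 1 5, B 2 4, B 3 3, B 4 2, B 5 1, B 6 0]
    · have B := bernstein_nonneg h1 h
      unfold largeRadius
      push_cast
      linarith [B 0 6, B 1 5, B 2 4, B 3 3, B 4 2, B 5 1, B 6 0]
    · have h1 := exp_neg_le_of (c := 0.6931471 * 0.03) (b := 0.02) (r := 0.9803) (by norm_num)
        (by norm_num) (by norm_num)
      have h2 := exp_neg_le_of (c := 0.6931471 * 5) (b := 3.4) (r := 0.037) (by norm_num)
        (by norm_num) (by norm_num)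
      norm_num at h1 h2 ⊢
      linarith
  · have ha := symmRadius_pos hα
    have hadm := admissible_symmRadius hα
    have e := symmRadius_mul hα.le
    set α := 0.7071067 * η + η ^ 2 with hαdef
    set a := symmRadius α
    have hd : 0 < (1 + 0.375 * α) ^ 2 := by positivity
    have hT0 : 0 < T := by linarith
    have B := bernstein_nonneg hη0.le h1
    refine .intro hadm (exists_upperCost_tangent (κ := 3.6) (κ' := 0) hη0 hT0 (by linarith)
      ?_ ?_ (le_three_mul_poissonRate_inv (by linarith) ?_))
      (exists_lowerCost (κ := 1.1) hη0 hT0.le ha ?_) ?_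
    · refine tangent_condition (by linarith) hT' (by norm_num) ?_
      have h3 : 2.9 * η ^ 2 * ((1 + 1.595 * α) ^ 2 * (6 + 4.69 * α)) ≤
          3 * 0.6931471 * (1.22 * α * (6 + 8.35 * α) * (1 + 0.375 * α)) := by
        rw [hαdef]
        linarith [B 0 8, B 1 7, B 2 6, B 3 5, B 4 4, B 5 3, B 6 2, B 7 1, B 8 0]
      have h4 : 1 + 1.595 * α = (1 + a) * (1 + 0.375 * α) := by linarith
      have h5 : 6 + 4.69 * α = (6 + 2 * a) * (1 + 0.375 * α) := by linarith
      have h6 : 6 + 8.35 * α = (6 + 5 * a) * (1 + 0.375 * α) := by linarith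
      rw [h4, h5, h6, ← e] at h3
      have hd : 0 < (1 + 0.375 * α) ^ 3 := by positivity
      exact le_of_mul_le_mul_right (le_of_eq_of_le (by ring) (h3.trans_eq (by ring))) hd
    · exact le_trans (by nlinarith) (le_three_mul_poissonRate_inv_three_mul (by linarith))
    · have : η ^ 2 * ((1 + 1.595 * α) * (6 + 7.13 * α)) ≤ 9 * (1.22 * α) ^ 2 := by
        rw [hαdef]
        linarith [B 0 6, B 1 5, B 2 4, B 3 3, B 4 2, B 5 1, B 6 0]
      have e1 : (1 + 1.595 * α) * (6 + 7.13 * α) =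
          (1 + a) * (6 + 4 * a) * (1 + 0.375 * α) ^ 2 := by
        have h1 : 1 + 1.595 * α = (1 + a) * (1 + 0.375 * α) := by linarith
        have h2 : 6 + 7.13 * α = (6 + 4 * a) * (1 + 0.375 * α) := by linarith
        rw [h1, h2]; ring
      rw [e1, ← e] at this
      exact le_of_mul_le_mul_right (le_of_eq_of_le (by ring) (this.trans_eq (by ring))) hd
    · have : η ^ 2 * 2.1 * (1 + 0.375 * α) ^ 2 ≤ 3 * (1.22 * α) ^ 2 := by
        rw [hαdef]
        linarith [B 0 6, B 1 5, B 2 4, B 3 3, B 4 2, B 5 1, B 6 0]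
      rw [← e] at this
      push_cast
      exact le_of_mul_le_mul_right (le_of_eq_of_le (by ring) (this.trans_eq (by ring))) hd
    · have h3 := exp_neg_le_of (c := T * 3.6) (b := 2.4) (r := 0.1) (by norm_num)
        (by linarith) (by norm_num)
      have h4 := exp_neg_le_of (c := T * 1.1) (b := 0.7) (r := 0.5) (by norm_num)
        (by linarith) (by norm_num)
      norm_num at h3 h4 ⊢
      linarith

/-! ### Three or more machines, small oversampling error -/

variable {m : ℕ} {η T y : ℝ}

lemma mul_exp_neg_mul_le {c z : ℝ} (hc : 0 < c) : z * Real.exp (-(c * z)) ≤ 1 / (c * 2.718281) := by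
  have h := Real.add_one_le_exp (c * z - 1)
  rw [Real.exp_sub, le_div_iff₀ (Real.exp_pos 1)] at h
  have h1 : z * (c * 2.718281) * Real.exp (-(c * z)) ≤ 1 := by
    rw [Real.exp_neg, ← div_eq_mul_inv, div_le_one (Real.exp_pos _)]
    rcases le_total 0 z with hz | hz
    · have := mul_le_mul_of_nonneg_left Real.exp_one_gt_d9.le (mul_nonneg hc.le hz)
      nlinarith [mul_nonneg hc.le hz]
    · have : z * (c * 2.718281) ≤ 0 := mul_nonpos_of_nonpos_of_nonneg hz (by positivity)
      linarith [Real.exp_pos (c * z)]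
  rw [le_div_iff₀ (by positivity)]
  linarith

lemma exp_div_natCast_le {c b r : ℝ} (hm : 3 ≤ m) (hb : 0 ≤ b) (hbc : b ≤ c)
    (h : (1 + b + b ^ 2 / 2 + b ^ 3 / 6 + b ^ 4 / 24 + b ^ 5 / 120 + b ^ 6 / 720)⁻¹ ≤ r) :
    Real.exp (-c) / m ≤ r / 3 := by
  have hm' : (3 : ℝ) ≤ m := by exact_mod_cast hm
  have h1 := exp_neg_le_of hb hbc h
  have := (Real.exp_pos (-c)).le.trans h1
  gcongr

lemma div_eq_mul_sq (hym : (m : ℝ) * y ^ 2 = 1) (x : ℝ) : x / m = x * y ^ 2 := by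
  have hm : (m : ℝ) ≠ 0 := by rintro h; simp [h] at hym
  rw [div_eq_iff hm, mul_assoc, mul_comm (y ^ 2), hym, mul_one]

lemma le_natCast_mul_of_sq_mul_le (hym : (m : ℝ) * y ^ 2 = 1) {a b : ℝ} (h : a * y ^ 2 ≤ b) :
    a ≤ m * b := by
  have := mul_le_mul_of_nonneg_left h (Nat.cast_nonneg (α := ℝ) m)
  have e : (m : ℝ) * (a * y ^ 2) = a := by rw [mul_left_comm, hym, mul_one]
  linarith

/-- A radius admissible when both `η` and `y = 1 / √m` are small. -/
lemma small_radius (hη0 : 0 < η) (hη : η ≤ 0.3) (hy0 : 0 < y) (hy : y ≤ 0.57736)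
    (hym : (m : ℝ) * y ^ 2 = 1) (hT : 0 ≤ T) {a : ℝ} (ha : a = 1.11 * (η * (y + η))) :
    0 < a ∧ a ≤ 0.2923 ∧ Admissible (η * (y + η)) (1 - a) (1 + a) ∧
      ∃ b ≤ Real.exp (-(T * 0.848)) / m, LowerCost m (3 * T / η ^ 2) T (1 - a) b := by
  have hs : 0 < y + η := by linarith
  have ha0 : 0 < a := by rw [ha]; positivity
  have hα : η * (y + η) ≤ 0.2633 := by nlinarith
  refine ⟨ha0, by linarith, .symm a ha0 (by rw [ha]; nlinarith [sq_nonneg (η * (y + η))]),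
    exists_lowerCost hη0 hT ha0 (le_natCast_mul_of_sq_mul_le hym ?_)⟩
  rw [ha]
  have : η ^ 2 * y ^ 2 ≤ η ^ 2 * (y + η) ^ 2 := by gcongr; linarith
  nlinarith

/-- With a = 1.11 α the quadratic rate is (3/2) a² ≈ 1.848 α². The surplus κ' = 1.848 y² - 1 is
negative and is paid for by the factor 1/m = y²: at T = 2.3 the cost is at most e^{2.3} y²
exp(-4.2504 y²), which is maximized over y. -/
lemma hasUnitCost_small_tangent (hη0 : 0 < η) (hη : η ≤ 0.3) (hm : 3 ≤ m) (hy0 : 0 < y)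
    (hy : y ≤ 0.57736) (hym : (m : ℝ) * y ^ 2 = 1) (hT : 1.0986 ≤ T)
    (hTy : Real.exp (-T) ≤ y ^ 2) (h : T ≤ 2.3) : HasUnitCost m η T (η * (y + η)) := by
  have hT0 : 0 < T := by linarith
  set a : ℝ := 1.11 * (η * (y + η)) with ha
  obtain ⟨ha0, ha1, hadm, hlow⟩ := small_radius hη0 hη hy0 hy hym hT0.le ha
  have h1 : Real.exp 2.3 ≤ 9.975 := by
    have := Real.exp_bound' (x := 0.3) (by norm_num) (by norm_num) (n := 4) (by norm_num)
    norm_num [Finset.sum_range_succ, Nat.factorial] at this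
    have h2 : Real.exp 2.3 = Real.exp 1 * Real.exp 1 * Real.exp 0.3 := by
      rw [← Real.exp_add, ← Real.exp_add]; norm_num
    rw [h2]
    have h3 : Real.exp 1 * Real.exp 1 ≤ 2.7182819 * 2.7182819 := by
      have := Real.exp_one_lt_d9.le
      gcongr <;> linarith
    norm_num at h3 this ⊢
    nlinarith [Real.exp_pos (3 / 10)]
  have hy1 : 0.316 ≤ y := by
    have h2 : Real.exp (-2.3) ≤ y ^ 2 := (Real.exp_le_exp.2 (by linarith)).trans hTy
    rw [Real.exp_neg] at h2
    have h3 : (10 : ℝ)⁻¹ ≤ (Real.exp 2.3)⁻¹ := inv_anti₀ (Real.exp_pos _) (by linarith)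
    nlinarith
  have B := bernstein_nonneg₂ hη0.le hη (hy0.le) hy
  refine .intro hadm (exists_upperCost_tangent (κ := 8.5) (κ' := 1.848 * y ^ 2 - 1) hη0 hT0
    (by linarith) (tangent_condition (by linarith) hT (by norm_num) ?_)
    (le_trans (by nlinarith) (le_three_mul_poissonRate_inv_three_mul (by linarith)))
    (le_three_mul_poissonRate_inv (by linarith) ?_)) hlow ?_
  · have : 2.9 * η * (1 + a) ^ 2 ≤ 3 * 1.0986 * (1.11 * (y + η)) := by
      rw [ha]
      linarith [B 0 5 0 2, B 0 5 1 1, B 0 5 2 0, B 1 4 0 2, B 1 4 1 1, B 1 4 2 0, B 2 3 0 2, B 2 3 1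
        1, B 2 3 2 0, B 3 2 0 2, B 3 2 1 1, B 3 2 2 0, B 4 1 0 2, B 4 1 1 1, B 4 1 2 0, B 5 0 0 2, B
        5 0 1 1, B 5 0 2 0]
    have := mul_le_mul_of_nonneg_left this hη0.le
    have := mul_le_mul_of_nonneg_right this (show 0 ≤ 6 + 2 * a by positivity)
    rw [ha] at this ⊢
    nlinarith [mul_nonneg ha0.le ha0.le]
  · have : 1.848 * y ^ 2 * ((1 + a) * (6 + 4 * a)) ≤ 9 * (1.11 * (y + η)) ^ 2 := by
      rw [ha]
      linarith [B 0 4 0 4, B 0 4 1 3, B 0 4 2 2, B 0 4 3 1, B 0 4 4 0, B 1 3 0 4, B 1 3 1 3, B 1 3 2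
        2, B 1 3 3 1, B 1 3 4 0, B 2 2 0 4, B 2 2 1 3, B 2 2 2 2, B 2 2 3 1, B 2 2 4 0, B 3 1 0 4, B
        3 1 1 3, B 3 1 2 2, B 3 1 3 1, B 3 1 4 0, B 4 0 0 4, B 4 0 1 3, B 4 0 2 2, B 4 0 3 1, B 4 0
        4 0]
    have := mul_le_mul_of_nonneg_left this (sq_nonneg η)
    rw [ha] at this ⊢
    linarith
  · have h3 := exp_neg_le_of (c := T * 8.5) (b := 8) (r := 0.002) (by norm_num)
      (by linarith) (by norm_num)
    have h4 := exp_div_natCast_le (c := T * 0.848) (b := 0.93) (r := 0.395) hm (by norm_num)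
      (by linarith) (by norm_num)
    have h5 : Real.exp (-(T * (1.848 * y ^ 2 - 1))) / m ≤ 0.8635 := by
      rw [div_eq_mul_sq hym]
      have h6 := mul_exp_neg_mul_le (c := 4.2504) (z := y ^ 2) (by norm_num)
      have h7 : Real.exp (-(T * (1.848 * y ^ 2 - 1))) ≤
          Real.exp 2.3 * Real.exp (-(4.2504 * y ^ 2)) := by
        rw [← Real.exp_add, Real.exp_le_exp]
        nlinarith [mul_nonneg (sub_nonneg.2 h) (show 0 ≤ 1 - 1.848 * y ^ 2 by nlinarith)]
      have h8 := mul_le_mul h1 h6 (by positivity) (by norm_num)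
      have h9 : 9.975 * (1 / (4.2504 * 2.718281)) ≤ (0.8635 : ℝ) := by norm_num
      calc _ ≤ Real.exp 2.3 * Real.exp (-(4.2504 * y ^ 2)) * y ^ 2 := by gcongr
        _ = Real.exp 2.3 * (y ^ 2 * Real.exp (-(4.2504 * y ^ 2))) := by ring
        _ ≤ 0.8635 := h8.trans h9
    linarith

/-- On [1 - η, 1 + η] the chord bound is (1 + ε)/(1 - η²), and ε ≈ η y is the pooled fluctuation, so
q - 1 is close to α. -/
lemma hasUnitCost_small_chord (hη0 : 0 < η) (hη : η ≤ 0.3) (hm : 3 ≤ m) (hy0 : 0 < y)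
    (hy : y ≤ 0.57736) (hym : (m : ℝ) * y ^ 2 = 1) (h : 2.3 ≤ T) :
    HasUnitCost m η T (η * (y + η)) := by
  have hT0 : 0 < T := by linarith
  set a : ℝ := 1.11 * (η * (y + η)) with ha
  obtain ⟨ha0, ha1, hadm, hlow⟩ := small_radius hη0 hη hy0 hy hym hT0.le ha
  refine .intro hadm (exists_upperCost_chord (l := 1 - η) (r := 1 + η) (ε := 1.01 * (η * y))
    (κ₁ := 0.5) (κ₂ := 0.36) (κ₃ := 0.53) hη0 hT0.le (by linarith) (by linarith) (by linarith)
    (by positivity) (by nlinarith) ?_ ?_ ?_ ?_) hlow ?_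
  · rw [div_le_iff₀ (by nlinarith), ha]
    nlinarith [mul_nonneg ha0.le (show 0 ≤ 0.09 - η ^ 2 by nlinarith), mul_pos hη0 hy0,
      sq_nonneg η]
  · have := le_poissonRate (x := 1 - η) (by linarith)
    rw [div_le_iff₀ (by linarith)] at this
    nlinarith
  · have := le_poissonRate (x := 1 + η) (by linarith)
    rw [div_le_iff₀ (by linarith)] at this
    nlinarith
  · exact le_natCast_mul_of_sq_mul_le hym (by nlinarith [sq_nonneg (η * y)])
  · have h1 := exp_neg_le_of (c := T * 0.5) (b := 1.15) (r := 0.317) (by norm_num)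
      (by linarith) (by norm_num)
    have h2 := exp_neg_le_of (c := T * 0.36) (b := 0.82) (r := 0.441) (by norm_num)
      (by linarith) (by norm_num)
    have h3 := exp_div_natCast_le (c := T * 0.53) (b := 1.2) (r := 0.302) hm (by norm_num)
      (by linarith) (by norm_num)
    have h4 := exp_div_natCast_le (c := T * 0.848) (b := 1.9) (r := 0.16) hm (by norm_num)
      (by linarith) (by norm_num)
    linarith

/-! ### Three or more machines, large oversampling error -/

/-- The Padé bound recentred at x = 1/2. -/
lemma le_poissonRate_of_half {x : ℝ} (hx : 0 < x) :
    1 - x - x * 0.6931472 - (1 - 2 * x) * (1 + 10 * x) / (8 * (1 + x)) ≤ poissonRate x := by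
  have h := log_le_log_add_pade two_pos (inv_pos.2 hx)
  rw [Real.log_inv] at h
  have e : x * ((x⁻¹ - 2) * (x⁻¹ + 5 * 2) / (2 * (4 * x⁻¹ + 2 * 2))) =
      (1 - 2 * x) * (1 + 10 * x) / (8 * (1 + x)) := by
    field_simp
    ring
  have := mul_le_mul_of_nonneg_left (h.trans (add_le_add_left log_two_le _)) hx.le
  rw [mul_add, e] at this
  unfold poissonRate
  linarith

lemma le_poissonRate_of_two {x : ℝ} (hx : 0 < x) :
    x * 0.6931471 - (2 - x) * (2 + 5 * x) / (2 * (4 + x)) - x + 1 ≤ poissonRate x := by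
  have h := log_le_log_add_pade (c := 1 / 2) (by norm_num) (inv_pos.2 hx)
  rw [Real.log_inv, one_div, Real.log_inv] at h
  have e : x * ((x⁻¹ - 2⁻¹) * (x⁻¹ + 5 * 2⁻¹) / (2⁻¹ * (4 * x⁻¹ + 2 * 2⁻¹))) =
      (2 - x) * (2 + 5 * x) / (2 * (4 + x)) := by
    field_simp
  have := mul_le_mul_of_nonneg_left (h.trans (add_le_add_left (neg_le_neg le_log_two) _)) hx.le
  rw [mul_add, e] at this
  unfold poissonRate
  linarith

/-- Both criteria are nearly tight at α = 1/2, which fixes 1.044. -/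
lemma admissible_linearRadius {α : ℝ} (hα : 0 < α) :
    Admissible α (1 - 1.044 * α) (1 + 1.044 * α) := by
  rcases le_total (1 / 2) α with h | h
  · exact .large _ _ h (by linarith) (by linarith) (by linarith)
  · exact .symm _ (by linarith) (by nlinarith [mul_nonneg (sq_nonneg α) (sub_nonneg.2 h)])

variable {m : ℕ} {η T y : ℝ}

lemma exists_lowerCost_linearRadius (hη : 0.3 ≤ η) (hy0 : 0 < y) (hy : y ≤ 0.57736)
    (hym : (m : ℝ) * y ^ 2 = 1) (hT : 0 ≤ T) :
    ∃ b ≤ Real.exp (-(T * 2)) / m,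
      LowerCost m (3 * T / η ^ 2) T (1 - 1.044 * (η * (y + η))) b := by
  have hη0 : 0 < η := by linarith
  refine exists_lowerCost hη0 hT (by positivity) (le_natCast_mul_of_sq_mul_le hym ?_)
  have h1 : 1.4143 * (η * y) ≤ 1.044 * (η * (y + η)) := by nlinarith
  have h2 : (1.4143 * (η * y)) ^ 2 ≤ (1.044 * (η * (y + η))) ^ 2 := by gcongr
  nlinarith

lemma exists_lowerCost_largeRadius (hη : 0.58 ≤ η) (hy0 : 0 < y)
    (hy : y ≤ 0.57736) (hym : (m : ℝ) * y ^ 2 = 1) (hT : 0 ≤ T) :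
    ∃ b ≤ Real.exp (-(T * 2)) / m,
      LowerCost m (3 * T / η ^ 2) T (1 - largeRadius (η * (y + η))) b := by
  have hη0 : 0 < η := by linarith
  have h1 : 1.4143 * (η * y) ≤ largeRadius (η * (y + η)) := by unfold largeRadius; nlinarith
  have h0 : 0 < 1.4143 * (η * y) := by positivity
  refine exists_lowerCost hη0 hT (by linarith) (le_natCast_mul_of_sq_mul_le hym ?_)
  have h2 : (1.4143 * (η * y)) ^ 2 ≤ largeRadius (η * (y + η)) ^ 2 := by gcongr
  nlinarith

lemma exists_lowerCost_half (hη0 : 0 < η) (hη1 : η ≤ 1) (hm : 3 ≤ m) (hT : 0 ≤ T) :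
    ∃ b ≤ Real.exp (-(T * 2)) / m, LowerCost m (3 * T / η ^ 2) T 0.5 b := by
  have hm' : (3 : ℝ) ≤ m := by exact_mod_cast hm
  have := exists_lowerCost_of_mul (m := m) (a := 0.5) (κ := 2) hη0 hT (by norm_num) (by nlinarith)
  convert this using 4
  norm_num

/-- The upper end of an interval `[1 / 2, q]` admissible for `α ≥ 1 / 2`. -/
def upperEnd (α : ℝ) : ℝ := 0.7445 * (1.0465 + 2 * α)

/-- With p = 1/2 the condition becomes 1.3431 q ≤ 2α + 1.04655, and 0.7445 is just below 1/1.3431.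
-/
lemma admissible_upperEnd {α : ℝ} (hα : 0.6 ≤ α) : Admissible α 0.5 (upperEnd α) := by
  unfold upperEnd
  exact .large _ _ (by linarith) (by norm_num) (by linarith) (by linarith)

lemma exp_neg_mul_div_le (hη : 0 < η) (h : 9 * η ≤ T) {k b r : ℝ} (hk : 0 ≤ k) (hb : 0 ≤ b)
    (hbk : b ≤ 9 * k)
    (hr : (1 + b + b ^ 2 / 2 + b ^ 3 / 6 + b ^ 4 / 24 + b ^ 5 / 120 + b ^ 6 / 720)⁻¹ ≤ r) :
    Real.exp (-(T * (k / η))) ≤ r := by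
  refine exp_neg_le_of hb (hbk.trans ?_) hr
  rw [← mul_div_assoc, le_div_iff₀ hη]
  nlinarith

/-- Surpluses have the form k/η, because T ≥ 9η then bounds each cost by exp(-9k). The pooled error
uses k = 0.1; with the lower tail it takes under 0.139, which leaves 0.861 for the two worker
events. -/
lemma hasUnitCost_of_chord (hη : 0.3 ≤ η) (hη1 : η ≤ 1) (hm : 3 ≤ m) (hy0 : 0 < y)
    (hy : y ≤ 0.57736) (hym : (m : ℝ) * y ^ 2 = 1) (hT : 9 * η ≤ T) {α p q l k₁ k₂ r₁ r₂ : ℝ}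
    (hadm : Admissible α p q)
    (hlow : ∃ b ≤ Real.exp (-(T * 2)) / m, LowerCost m (3 * T / η ^ 2) T p b)
    (hl0 : 0 < l) (hl1 : l < 1) (hq : l + η + (0.82 * η + 0.04) * y ≤ q * (l * (1 + η)))
    (h₁ : η ^ 2 + k₁ * η ≤ 3 * poissonRate l) (h₂ : η ^ 2 + k₂ * η ≤ 3 * poissonRate (1 + η))
    (hr₁ : Real.exp (-(T * (k₁ / η))) ≤ r₁) (hr₂ : Real.exp (-(T * (k₂ / η))) ≤ r₂)
    (hr : r₁ + r₂ ≤ 0.861) : HasUnitCost m η T α := by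
  have hη0 : 0 < η := by linarith
  have hT0 : 0 < T := by linarith
  have e : ∀ k : ℝ, η ^ 2 * (1 + k / η) = η ^ 2 + k * η := fun k => by field_simp
  refine .intro hadm (exists_upperCost_chord (l := l) (r := 1 + η) (ε := (0.82 * η + 0.04) * y)
    (κ₁ := k₁ / η) (κ₂ := k₂ / η) (κ₃ := 0.1 / η) hη0 hT0.le hl0 hl1 (by linarith)
    (by positivity) (by nlinarith) ?_ (by rwa [e]) (by rwa [e]) ?_) hlow ?_
  · rw [div_le_iff₀ (by positivity)]
    linarith
  · refine le_natCast_mul_of_sq_mul_le hym ?_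
    rw [e, mul_pow, ← mul_assoc]
    gcongr
    nlinarith
  · have h3 : Real.exp (-(T * (0.1 / η))) / m ≤ 0.4067 / 3 := by
      refine exp_div_natCast_le (b := 0.9) hm (by norm_num) ?_ (by norm_num)
      rw [← mul_div_assoc, le_div_iff₀ hη0]
      nlinarith
    have h4 := exp_div_natCast_le (c := T * 2) (b := 5) (r := 0.01) hm (by norm_num)
      (by linarith) (by norm_num)
    linarith

lemma hasUnitCost_chord_linearRadius (hη : 0.3 ≤ η) (hη1 : η ≤ 0.65) (hm : 3 ≤ m) (hy0 : 0 < y)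
    (hy : y ≤ 0.57736) (hym : (m : ℝ) * y ^ 2 = 1) (hT : 9 * η ≤ T) :
    HasUnitCost m η T (η * (y + η)) := by
  have hη0 : 0 < η := by linarith
  have hD : 1 < 1 + η + 0.95 * η ^ 2 := by nlinarith
  set D := 1 + η + 0.95 * η ^ 2 with hDdef
  have hq : 1 / D + η + (0.82 * η + 0.04) * y ≤
      (1 + 1.044 * (η * (y + η))) * (1 / D * (1 + η)) := by
    have h1 : 1 + D * (η + (0.82 * η + 0.04) * y) ≤ (1 + 1.044 * (η * (y + η))) * (1 + η) := by
      have B := bernstein_nonneg₂ hη hη1 hy0.le hy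
      rw [hDdef]
      linarith [B 0 3 0 1, B 0 3 1 0, B 1 2 0 1, B 1 2 1 0, B 2 1 0 1, B 2 1 1 0, B 3 0 0 1, B 3 0 1
        0]
    refine le_of_mul_le_mul_right (a := D) (le_of_eq_of_le ?_ (h1.trans_eq ?_)) (by linarith)
    · field_simp
      ring
    · field_simp
  have h2 : ∀ k, 9 * η ≥ (6 + 2 * η) * (η + k) → η ^ 2 + k * η ≤ 3 * poissonRate (1 + η) := by
    intro k hk
    have := le_poissonRate (x := 1 + η) (by linarith)
    rw [div_le_iff₀ (by linarith)] at this
    refine le_of_mul_le_mul_right (a := 4 + 2 * (1 + η)) ?_ (by linarith)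
    nlinarith
  have main := fun k₁ k₂ r₁ r₂ => hasUnitCost_of_chord (k₁ := k₁) (k₂ := k₂) (r₁ := r₁) (r₂ := r₂)
    hη (by linarith) hm hy0 hy hym hT
    (admissible_linearRadius (by positivity))
    (exists_lowerCost_linearRadius hη hy0 hy hym (by linarith)) (by positivity)
    ((div_lt_one (by linarith)).2 hD) hq
  rcases le_total η 0.45 with h | h
  · refine main 0.12 0.1 0.35 0.41 (le_three_mul_poissonRate_inv (by linarith) ?_)
      (h2 _ (by nlinarith))
      (exp_neg_mul_div_le (b := 1.08) hη0 hT (by norm_num) (by norm_num) (by norm_num)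
        (by norm_num))
      (exp_neg_mul_div_le (b := 0.9) hη0 hT (by norm_num) (by norm_num) (by norm_num)
        (by norm_num)) (by norm_num)
    have B := bernstein_nonneg hη h
    rw [hDdef]
    linarith [B 0 6, B 1 5, B 2 4, B 3 3, B 4 2, B 5 1, B 6 0]
  · refine main 0.08 0.13 0.49 0.32 (le_three_mul_poissonRate_inv (by linarith) ?_)
      (h2 _ (by nlinarith))
      (exp_neg_mul_div_le (b := 0.72) hη0 hT (by norm_num) (by norm_num) (by norm_num)
        (by norm_num))
      (exp_neg_mul_div_le (b := 1.17) hη0 hT (by norm_num) (by norm_num) (by norm_num)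
        (by norm_num)) (by norm_num)
    have B := bernstein_nonneg h hη1
    rw [hDdef]
    linarith [B 0 6, B 1 5, B 2 4, B 3 3, B 4 2, B 5 1, B 6 0]

lemma hasUnitCost_chord_of_le (hη : 0.65 ≤ η) (hη1 : η < 1) (hm : 3 ≤ m) (hy0 : 0 < y)
    (hy : y ≤ 0.57736) (hym : (m : ℝ) * y ^ 2 = 1) (hT : 9 * η ≤ T) :
    HasUnitCost m η T (η * (y + η)) := by
  have hη0 : 0 < η := by linarith
  have B := bernstein_nonneg hη hη1.le
  have h1 : η ^ 2 + 0.06 * η ≤ 3 * poissonRate (0.8667 - 0.581 * η) := by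
    have hl : 0 < 0.8667 - 0.581 * η := by linarith
    have h := le_poissonRate_of_half hl
    set l := 0.8667 - 0.581 * η with hldef
    have hd : 0 < 8 * (1 + l) := by linarith
    refine le_trans ?_ (mul_le_mul_of_nonneg_left h (by norm_num))
    refine le_of_mul_le_mul_right (a := 8 * (1 + l)) ?_ hd
    have e : 3 * (1 - l - l * 0.6931472 - (1 - 2 * l) * (1 + 10 * l) / (8 * (1 + l))) *
        (8 * (1 + l)) =
        3 * ((1 - l - l * 0.6931472) * (8 * (1 + l)) - (1 - 2 * l) * (1 + 10 * l)) := by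
      rw [mul_assoc, sub_mul, div_mul_cancel₀ _ hd.ne']
    rw [e, hldef]
    linarith [B 0 5, B 1 4, B 2 3, B 3 2, B 4 1, B 5 0]
  have h2 : η ^ 2 + 0.15 * η ≤ 3 * poissonRate (1 + η) := by
    have h := le_poissonRate_of_two (x := 1 + η) (by linarith)
    have hd : 0 < 2 * (4 + (1 + η)) := by linarith
    refine le_trans ?_ (mul_le_mul_of_nonneg_left h (by norm_num))
    refine le_of_mul_le_mul_right ?_ hd
    have e : 3 * ((1 + η) * 0.6931471 - (2 - (1 + η)) * (2 + 5 * (1 + η)) / (2 * (4 + (1 + η))) -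
        (1 + η) + 1) * (2 * (4 + (1 + η))) =
        3 * (((1 + η) * 0.6931471 - (1 + η) + 1) * (2 * (4 + (1 + η))) -
          (2 - (1 + η)) * (2 + 5 * (1 + η))) := by
      field_simp
      ring
    rw [e]
    linarith [B 0 3, B 1 2, B 2 1, B 3 0]
  have hr1 := exp_neg_mul_div_le (k := 0.06) (b := 0.54) (r := 0.583) hη0 hT (by norm_num)
    (by norm_num) (by norm_num) (by norm_num)
  have hr2 := exp_neg_mul_div_le (k := 0.15) (b := 1.35) (r := 0.26) hη0 hT (by norm_num)
    (by norm_num) (by norm_num) (by norm_num)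
  rcases le_total η 0.95 with h | h
  · refine hasUnitCost_of_chord (by linarith) hη1.le hm hy0 hy hym hT
      (admissible_largeRadius (by nlinarith))
      (exists_lowerCost_largeRadius (by linarith) hy0 hy hym (by linarith))
      (by linarith) (by linarith) ?_ h1 h2 hr1 hr2 (by norm_num)
    have B := bernstein_nonneg₂ hη h hy0.le hy
    unfold largeRadius
    linarith [B 0 4 0 1, B 0 4 1 0, B 1 3 0 1, B 1 3 1 0, B 2 2 0 1, B 2 2 1 0, B 3 1 0 1, B 3 1 1
      0, B 4 0 0 1, B 4 0 1 0]
  · refine hasUnitCost_of_chord (by linarith) hη1.le hm hy0 hy hym hT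
      (admissible_upperEnd (by nlinarith))
      (exists_lowerCost_half hη0 hη1.le hm (by linarith))
      (by linarith) (by linarith) ?_ h1 h2 hr1 hr2 (by norm_num)
    have B := bernstein_nonneg₂ h hη1.le hy0.le hy
    unfold upperEnd
    linarith [B 0 4 0 1, B 0 4 1 0, B 1 3 0 1, B 1 3 1 0, B 2 2 0 1, B 2 2 1 0, B 3 1 0 1, B 3 1 1
      0, B 4 0 0 1, B 4 0 1 0]

/-! ### Tangent bounds when T ≤ 9η -/

variable {m : ℕ} {η T y : ℝ}

/-- The surplus (0.6349 y - c)/η is not positive, as c ≥ 0.3666, so T = 9η is the worst case. There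
the cost is e^{9c} (y exp(-2.85705 y))², and maximizing over y gives the factor 0.01658. -/
lemma hasUnitCost_of_tangent {T₀ κ c r₁ r₂ : ℝ} (hη : 0.3 ≤ η) (hm : 3 ≤ m) (hy0 : 0 < y)
    (hy : y ≤ 0.57736) (hym : (m : ℝ) * y ^ 2 = 1) (hT : T ≤ 9 * η) (hT₀ : 0 < T₀)
    (hT' : T₀ ≤ T) {α p q : ℝ} (hadm : Admissible α p q)
    (hlow : ∃ b ≤ Real.exp (-(T * 2)) / m, LowerCost m (3 * T / η ^ 2) T p b) (hq : 1 < q)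
    (hx : 2.9 * (η ^ 2 * q) ≤ 3 * T * Real.log q) (hκ : 0 ≤ κ)
    (h : η ^ 2 * (1 + κ) ≤ 3 * poissonRate (1 / (3 * q))) (hc : 0.3666 ≤ c)
    (h' : η ^ 2 + η * (0.6349 * y - c) ≤ 3 * poissonRate (1 / q))
    (hr₁ : Real.exp (-(T₀ * κ)) + Real.exp (-(T₀ * 2)) / 3 ≤ r₁)
    (hr₂ : Real.exp (9 * c) ≤ r₂) (hr : r₁ + 0.01658 * r₂ ≤ 1) : HasUnitCost m η T α := by
  have hη0 : 0 < η := by linarith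
  have hT0 : 0 < T := by linarith
  have hm' : (3 : ℝ) ≤ m := by exact_mod_cast hm
  refine .intro hadm (exists_upperCost_tangent (κ := κ) (κ' := (0.6349 * y - c) / η) hη0 hT0 hq hx
    h (le_of_eq_of_le (by field_simp) h')) hlow ?_
  have h1 : Real.exp (-(T * κ)) ≤ Real.exp (-(T₀ * κ)) := by gcongr
  have h2 : Real.exp (-(T * 2)) / m ≤ Real.exp (-(T₀ * 2)) / 3 := by gcongr
  have h3 : Real.exp (-(T * ((0.6349 * y - c) / η))) / m ≤ 0.01658 * r₂ := by
    have h4 : Real.exp (-(T * ((0.6349 * y - c) / η))) ≤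
        Real.exp (9 * c) * Real.exp (-(2.85705 * y)) ^ 2 := by
      rw [← Real.exp_nat_mul, ← Real.exp_add, Real.exp_le_exp, ← mul_div_assoc, neg_le_iff_add_nonneg,
        ← sub_le_iff_le_add', zero_sub, le_div_iff₀ hη0]
      push_cast
      nlinarith [mul_nonneg (sub_nonneg.2 hT) (show 0 ≤ c - 0.6349 * y by linarith)]
    have h5 := mul_exp_neg_mul_le (c := 2.85705) (z := y) (by norm_num)
    have h6 : (y * Real.exp (-(2.85705 * y))) ^ 2 ≤ 0.01658 := by
      calc _ ≤ (1 / (2.85705 * 2.718281) : ℝ) ^ 2 := by gcongr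
        _ ≤ _ := by norm_num
    rw [div_eq_mul_sq hym]
    calc _ ≤ Real.exp (9 * c) * Real.exp (-(2.85705 * y)) ^ 2 * y ^ 2 := by gcongr
      _ = (y * Real.exp (-(2.85705 * y))) ^ 2 * Real.exp (9 * c) := by ring
      _ ≤ 0.01658 * r₂ := by gcongr
  linarith

lemma exp_nine_mul_le {c b r : ℝ} (hb : 0 ≤ b) (hbc : b ≤ 4 - 9 * c)
    (h : 54.5982 * (1 + b + b ^ 2 / 2 + b ^ 3 / 6 + b ^ 4 / 24 + b ^ 5 / 120 + b ^ 6 / 720)⁻¹ ≤ r) :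
    Real.exp (9 * c) ≤ r := by
  have h1 : Real.exp (9 * c) = Real.exp 1 ^ 4 * Real.exp (-(4 - 9 * c)) := by
    rw [← Real.exp_nat_mul, ← Real.exp_add]; congr 1; push_cast; ring
  have h2 : Real.exp 1 ^ 4 ≤ 54.5982 := by
    calc _ ≤ (2.7182818286 : ℝ) ^ 4 := by
          have := Real.exp_one_lt_d9.le
          gcongr
      _ ≤ _ := by norm_num
  rw [h1]
  refine le_trans ?_ h
  have := exp_neg_le_of hb hbc le_rfl
  gcongr

/-- The tangent of -2 log y near y = 1/√3, with 0.549 ≈ log √3; it makes T ≥ log m usable in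
polynomial certificates. -/
lemma linear_le_of_exp_neg_le_sq (hy0 : 0 < y) (hTy : Real.exp (-T) ≤ y ^ 2) :
    3.098 - 3.4642 * y ≤ T := by
  have h1 : Real.exp (-(T / 2)) ≤ y := by
    refine le_of_sq_le_sq ?_ hy0.le
    have e : Real.exp (-(T / 2)) ^ 2 = Real.exp (-T) := by
      rw [← Real.exp_nat_mul]; congr 1; push_cast; ring
    rwa [e]
  have h2 : Real.exp 0.549 ≤ 1.7321 := by
    have := Real.exp_bound' (x := 0.549) (by norm_num) (by norm_num) (n := 6) (by norm_num)
    refine this.trans ?_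
    norm_num [Finset.sum_range_succ, Nat.factorial]
  have h3 := Real.add_one_le_exp (0.549 - T / 2)
  have h4 : Real.exp (0.549 - T / 2) = Real.exp 0.549 * Real.exp (-(T / 2)) := by
    rw [← Real.exp_add]; rfl
  have h5 : Real.exp 0.549 * Real.exp (-(T / 2)) ≤ 1.7321 * y := by gcongr
  linarith

lemma hasUnitCost_tangent_linearRadius (hη : 0.3 ≤ η) (hη1 : η ≤ 0.58) (hm : 3 ≤ m) (hy0 : 0 < y)
    (hy : y ≤ 0.57736) (hym : (m : ℝ) * y ^ 2 = 1) (hT : 1.0986 ≤ T)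
    (hTy : Real.exp (-T) ≤ y ^ 2) (hTη : T ≤ 9 * η) : HasUnitCost m η T (η * (y + η)) := by
  have hη0 : 0 < η := by linarith
  have B := bernstein_nonneg₂ hη hη1 hy0.le hy
  have hq : 1 < 1 + 1.044 * (η * (y + η)) := by
    have : 0 < 1.044 * (η * (y + η)) := by positivity
    linarith
  refine hasUnitCost_of_tangent (T₀ := 1.0986) (κ := 2.5) (c := 0.4413) (r₁ := 0.115) (r₂ := 53.1)
    hη hm hy0 hy hym hTη (by norm_num) hT (admissible_linearRadius (by positivity))
    (exists_lowerCost_linearRadius hη hy0 hy hym (by linarith)) hq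
    (tangent_condition hq.le (linear_le_of_exp_neg_le_sq hy0 hTy) (by linarith) ?_) (by norm_num)
    (le_three_mul_poissonRate_inv_of_log (b := 4) (L := 2 * 0.6931472) (by linarith)
      (by norm_num) log_four_le ?_)
    (by norm_num) (le_three_mul_poissonRate_inv (by linarith) ?_) ?_
    (exp_nine_mul_le (b := 0.028) (by norm_num) (by norm_num) (by norm_num)) (by norm_num)
  · linarith [B 0 8 0 3, B 0 8 1 2, B 0 8 2 1, B 0 8 3 0, B 1 7 0 3, B 1 7 1 2, B 1 7 2 1, B 1 7 3
      0, B 2 6 0 3, B 2 6 1 2, B 2 6 2 1, B 2 6 3 0, B 3 5 0 3, B 3 5 1 2, B 3 5 2 1, B 3 5 3 0, B 4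
      4 0 3, B 4 4 1 2, B 4 4 2 1, B 4 4 3 0, B 5 3 0 3, B 5 3 1 2, B 5 3 2 1, B 5 3 3 0, B 6 2 0 3,
      B 6 2 1 2, B 6 2 2 1, B 6 2 3 0, B 7 1 0 3, B 7 1 1 2, B 7 1 2 1, B 7 1 3 0, B 8 0 0 3, B 8 0
      1 2, B 8 0 2 1, B 8 0 3 0]
  · linarith [B 0 6 0 2, B 0 6 1 1, B 0 6 2 0, B 1 5 0 2, B 1 5 1 1, B 1 5 2 0, B 2 4 0 2, B 2 4 1
      1, B 2 4 2 0, B 3 3 0 2, B 3 3 1 1, B 3 3 2 0, B 4 2 0 2, B 4 2 1 1, B 4 2 2 0, B 5 1 0 2, B 5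
      1 1 1, B 5 1 2 0, B 6 0 0 2, B 6 0 1 1, B 6 0 2 0]
  · rcases le_total η 0.44 with h | h
    · have B := bernstein_nonneg₂ hη h hy0.le hy
      linarith [B 0 6 0 3, B 0 6 1 2, B 0 6 2 1, B 0 6 3 0, B 1 5 0 3, B 1 5 1 2, B 1 5 2 1, B 1 5 3
        0, B 2 4 0 3, B 2 4 1 2, B 2 4 2 1, B 2 4 3 0, B 3 3 0 3, B 3 3 1 2, B 3 3 2 1, B 3 3 3 0, B
        4 2 0 3, B 4 2 1 2, B 4 2 2 1, B 4 2 3 0, B 5 1 0 3, B 5 1 1 2, B 5 1 2 1, B 5 1 3 0, B 6 0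
        0 3, B 6 0 1 2, B 6 0 2 1, B 6 0 3 0]
    · have B := bernstein_nonneg₂ h hη1 hy0.le hy
      linarith [B 0 6 0 3, B 0 6 1 2, B 0 6 2 1, B 0 6 3 0, B 1 5 0 3, B 1 5 1 2, B 1 5 2 1, B 1 5 3
        0, B 2 4 0 3, B 2 4 1 2, B 2 4 2 1, B 2 4 3 0, B 3 3 0 3, B 3 3 1 2, B 3 3 2 1, B 3 3 3 0, B
        4 2 0 3, B 4 2 1 2, B 4 2 2 1, B 4 2 3 0, B 5 1 0 3, B 5 1 1 2, B 5 1 2 1, B 5 1 3 0, B 6 0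
        0 3, B 6 0 1 2, B 6 0 2 1, B 6 0 3 0]
  · have h1 := exp_neg_le_of (c := 1.0986 * 2.5) (b := 2.74) (r := 0.068) (by norm_num)
      (by norm_num) (by norm_num)
    have h2 := exp_neg_le_of (c := 1.0986 * 2) (b := 2.19) (r := 0.1135) (by norm_num)
      (by norm_num) (by norm_num)
    linarith

lemma hasUnitCost_tangent_largeRadius (hη : 0.58 ≤ η) (hη1 : η ≤ 0.8) (hm : 3 ≤ m) (hy0 : 0 < y)
    (hy : y ≤ 0.57736) (hym : (m : ℝ) * y ^ 2 = 1) (hT : 2.75 ≤ T) (hTη : T ≤ 9 * η) :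
    HasUnitCost m η T (η * (y + η)) := by
  have hη0 : 0 < η := by linarith
  have B := bernstein_nonneg₂ hη hη1 hy0.le hy
  have hq : 1 < 1 + largeRadius (η * (y + η)) := by unfold largeRadius; nlinarith
  refine hasUnitCost_of_tangent (T₀ := 2.75) (κ := 1.2) (c := 0.4413) (r₁ := 0.103) (r₂ := 53.1)
    (by linarith) hm hy0 hy hym hTη (by norm_num) hT (admissible_largeRadius (by nlinarith))
    (exists_lowerCost_largeRadius hη hy0 hy hym (by linarith)) hq
    (tangent_condition hq.le hT (by linarith) ?_) (by norm_num)
    (le_three_mul_poissonRate_inv_of_log (b := 4) (L := 2 * 0.6931472) (by linarith)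
      (by norm_num) log_four_le ?_)
    (by norm_num) (le_three_mul_poissonRate_inv (by linarith) ?_) ?_
    (exp_nine_mul_le (b := 0.028) (by norm_num) (by norm_num) (by norm_num)) (by norm_num)
  · unfold largeRadius
    linarith [B 0 8 0 3, B 0 8 1 2, B 0 8 2 1, B 0 8 3 0, B 1 7 0 3, B 1 7 1 2, B 1 7 2 1, B 1 7 3
      0, B 2 6 0 3, B 2 6 1 2, B 2 6 2 1, B 2 6 3 0, B 3 5 0 3, B 3 5 1 2, B 3 5 2 1, B 3 5 3 0, B 4
      4 0 3, B 4 4 1 2, B 4 4 2 1, B 4 4 3 0, B 5 3 0 3, B 5 3 1 2, B 5 3 2 1, B 5 3 3 0, B 6 2 0 3,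
      B 6 2 1 2, B 6 2 2 1, B 6 2 3 0, B 7 1 0 3, B 7 1 1 2, B 7 1 2 1, B 7 1 3 0, B 8 0 0 3, B 8 0
      1 2, B 8 0 2 1, B 8 0 3 0]
  · unfold largeRadius
    linarith [B 0 6 0 2, B 0 6 1 1, B 0 6 2 0, B 1 5 0 2, B 1 5 1 1, B 1 5 2 0, B 2 4 0 2, B 2 4 1
      1, B 2 4 2 0, B 3 3 0 2, B 3 3 1 1, B 3 3 2 0, B 4 2 0 2, B 4 2 1 1, B 4 2 2 0, B 5 1 0 2, B 5
      1 1 1, B 5 1 2 0, B 6 0 0 2, B 6 0 1 1, B 6 0 2 0]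
  · unfold largeRadius
    rcases le_total η 0.69 with h | h
    · have B := bernstein_nonneg₂ hη h hy0.le hy
      linarith [B 0 6 0 3, B 0 6 1 2, B 0 6 2 1, B 0 6 3 0, B 1 5 0 3, B 1 5 1 2, B 1 5 2 1, B 1 5 3
        0, B 2 4 0 3, B 2 4 1 2, B 2 4 2 1, B 2 4 3 0, B 3 3 0 3, B 3 3 1 2, B 3 3 2 1, B 3 3 3 0, B
        4 2 0 3, B 4 2 1 2, B 4 2 2 1, B 4 2 3 0, B 5 1 0 3, B 5 1 1 2, B 5 1 2 1, B 5 1 3 0, B 6 0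
        0 3, B 6 0 1 2, B 6 0 2 1, B 6 0 3 0]
    · have B := bernstein_nonneg₂ h hη1 hy0.le hy
      linarith [B 0 6 0 3, B 0 6 1 2, B 0 6 2 1, B 0 6 3 0, B 1 5 0 3, B 1 5 1 2, B 1 5 2 1, B 1 5 3
        0, B 2 4 0 3, B 2 4 1 2, B 2 4 2 1, B 2 4 3 0, B 3 3 0 3, B 3 3 1 2, B 3 3 2 1, B 3 3 3 0, B
        4 2 0 3, B 4 2 1 2, B 4 2 2 1, B 4 2 3 0, B 5 1 0 3, B 5 1 1 2, B 5 1 2 1, B 5 1 3 0, B 6 0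
        0 3, B 6 0 1 2, B 6 0 2 1, B 6 0 3 0]
  · have h1 := exp_neg_le_of (c := 2.75 * 1.2) (b := 3.3) (r := 0.04) (by norm_num)
      (by norm_num) (by norm_num)
    have h2 := exp_neg_le_of (c := 2.75 * 2) (b := 5) (r := 0.01) (by norm_num)
      (by norm_num) (by norm_num)
    linarith

lemma hasUnitCost_tangent_upperEnd (hη : 0.8 ≤ η) (hη1 : η ≤ 1) (hm : 3 ≤ m) (hy0 : 0 < y)
    (hy : y ≤ 0.57736) (hym : (m : ℝ) * y ^ 2 = 1) (hT : 2.75 ≤ T) (hTη : T ≤ 9 * η) :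
    HasUnitCost m η T (η * (y + η)) := by
  have hη0 : 0 < η := by linarith
  have B := bernstein_nonneg₂ hη hη1 hy0.le hy
  have hq : 1 < upperEnd (η * (y + η)) := by unfold upperEnd; nlinarith
  refine hasUnitCost_of_tangent (T₀ := 2.75) (κ := 0.7) (c := 0.435) (r₁ := 0.15) (r₂ := 50.4)
    (by linarith) hm hy0 hy hym hTη (by norm_num) hT (admissible_upperEnd (by nlinarith))
    (exists_lowerCost_half hη0 hη1 hm (by linarith)) hq
    (tangent_condition hq.le hT (by linarith) ?_) (by norm_num)
    (le_three_mul_poissonRate_inv_of_log (b := 4) (L := 2 * 0.6931472) (by linarith)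
      (by norm_num) log_four_le ?_)
    (by norm_num) (le_three_mul_poissonRate_inv_of_log (b := 2) (L := 0.6931472) (by linarith)
      (by norm_num) log_two_le ?_) ?_
    (exp_nine_mul_le (b := 0.084) (by norm_num) (by norm_num) (by norm_num)) (by norm_num)
  · unfold upperEnd
    linarith [B 0 8 0 3, B 0 8 1 2, B 0 8 2 1, B 0 8 3 0, B 1 7 0 3, B 1 7 1 2, B 1 7 2 1, B 1 7 3
      0, B 2 6 0 3, B 2 6 1 2, B 2 6 2 1, B 2 6 3 0, B 3 5 0 3, B 3 5 1 2, B 3 5 2 1, B 3 5 3 0, B 4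
      4 0 3, B 4 4 1 2, B 4 4 2 1, B 4 4 3 0, B 5 3 0 3, B 5 3 1 2, B 5 3 2 1, B 5 3 3 0, B 6 2 0 3,
      B 6 2 1 2, B 6 2 2 1, B 6 2 3 0, B 7 1 0 3, B 7 1 1 2, B 7 1 2 1, B 7 1 3 0, B 8 0 0 3, B 8 0
      1 2, B 8 0 2 1, B 8 0 3 0]
  · unfold upperEnd
    linarith [B 0 6 0 2, B 0 6 1 1, B 0 6 2 0, B 1 5 0 2, B 1 5 1 1, B 1 5 2 0, B 2 4 0 2, B 2 4 1
      1, B 2 4 2 0, B 3 3 0 2, B 3 3 1 1, B 3 3 2 0, B 4 2 0 2, B 4 2 1 1, B 4 2 2 0, B 5 1 0 2, B 5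
      1 1 1, B 5 1 2 0, B 6 0 0 2, B 6 0 1 1, B 6 0 2 0]
  · unfold upperEnd
    linarith [B 0 6 0 3, B 0 6 1 2, B 0 6 2 1, B 0 6 3 0, B 1 5 0 3, B 1 5 1 2, B 1 5 2 1, B 1 5 3
      0, B 2 4 0 3, B 2 4 1 2, B 2 4 2 1, B 2 4 3 0, B 3 3 0 3, B 3 3 1 2, B 3 3 2 1, B 3 3 3 0, B 4
      2 0 3, B 4 2 1 2, B 4 2 2 1, B 4 2 3 0, B 5 1 0 3, B 5 1 1 2, B 5 1 2 1, B 5 1 3 0, B 6 0 0 3,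
      B 6 0 1 2, B 6 0 2 1, B 6 0 3 0]
  · have h1 := exp_neg_le_of (c := 2.75 * 0.7) (b := 1.92) (r := 0.1475) (by norm_num)
      (by norm_num) (by norm_num)
    have h2 := exp_neg_le_of (c := 2.75 * 2) (b := 5.5) (r := 0.006) (by norm_num)
      (by norm_num) (by norm_num)
    linarith

/-! ### The soft bound for large η and T ≤ 2.75 -/

lemma convex_exp_perspective {u v a b c : ℝ} (hu : 0 < u) (hv : 0 < v) (ha : 0 ≤ a) (hb : 0 ≤ b)
    (hab : a + b = 1) : (a * u + b * v) * Real.exp (-c / (a * u + b * v)) ≤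
      a * (u * Real.exp (-c / u)) + b * (v * Real.exp (-c / v)) := by
  have hs : 0 < a * u + b * v := by
    rcases ha.eq_or_lt with rfl | ha
    · simpa [show b = 1 by linarith] using hv
    · have := mul_pos ha hu
      have := mul_nonneg hb hv.le
      linarith
  have hw₁ : 0 ≤ a * u / (a * u + b * v) := by positivity
  have hw₂ : 0 ≤ b * v / (a * u + b * v) := by positivity
  have h := convexOn_exp.2 (Set.mem_univ (-c / u)) (Set.mem_univ (-c / v)) hw₁ hw₂
    (by rw [← add_div, div_self hs.ne'])
  have e : a * u / (a * u + b * v) * (-c / u) + b * v / (a * u + b * v) * (-c / v) =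
      -c / (a * u + b * v) := by
    have : -c / (a * u + b * v) = (a + b) * (-c) / (a * u + b * v) := by rw [hab, one_mul]
    rw [this]
    field_simp
    ring
  simp only [smul_eq_mul] at h
  rw [e] at h
  have := mul_le_mul_of_nonneg_left h hs.le
  refine this.trans_eq ?_
  field_simp

/-- The exponent of the soft bound with slope `c`, at `N = 3 T / η ^ 2`. -/
def softExponent (η c T : ℝ) : ℝ := T + 3 * T / η ^ 2 * (Real.exp (-c / (3 * T / η ^ 2)) - 1)

variable {m : ℕ} {η T y : ℝ}

/-- Perspectives of convex functions are convex. With a slope that does not depend on T, estimates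
are therefore needed only at the two ends of the range of T. -/
lemma softExponent_convex {c u v a b : ℝ} (hη : 0 < η) (hu : 0 < u) (hv : 0 < v) (ha : 0 ≤ a)
    (hb : 0 ≤ b) (hab : a + b = 1) :
    softExponent η c (a * u + b * v) ≤ a * softExponent η c u + b * softExponent η c v := by
  have h := convex_exp_perspective (u := 3 * u / η ^ 2) (v := 3 * v / η ^ 2) (c := c)
    (by positivity) (by positivity) ha hb hab
  have e : 3 * (a * u + b * v) / η ^ 2 = a * (3 * u / η ^ 2) + b * (3 * v / η ^ 2) := by ring
  unfold softExponent
  rw [e]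
  linarith

lemma softExponent_le {c s r t : ℝ} (hη : 0 < η) (hT : 0 < T) (ht : t = c / (3 * T / η ^ 2))
    (h : Real.exp (-t) ≤ 1 - s * t + r * t ^ 2) :
    softExponent η c T ≤ T - c * s + c * r * t := by
  have hN : 0 < 3 * T / η ^ 2 := by positivity
  have e : -c / (3 * T / η ^ 2) = -t := by rw [ht, neg_div]
  have e2 : 3 * T / η ^ 2 * t = c := by rw [ht]; field_simp
  unfold softExponent
  rw [e]
  have := mul_le_mul_of_nonneg_left h hN.le
  have e3 : 3 * T / η ^ 2 * (r * t ^ 2) = c * r * t := by rw [← e2]; ring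
  have e4 : 3 * T / η ^ 2 * (s * t) = c * s := by rw [← e2]; ring
  linarith

lemma exp_le_of_le_log_pade {v w c L : ℝ} (hw : 0 < w) (hc : 0 < c) (hL : L ≤ Real.log c)
    (h : (v - L) * (w * (2 * w + 4 * c)) ≤ (w - c) * (5 * w + c)) : Real.exp v ≤ w := by
  rw [← Real.le_log_iff_exp_le hw]
  have h1 := pade_le_log (div_pos hw hc)
  rw [Real.log_div hw.ne' hc.ne'] at h1
  have e : (w / c - 1) * (5 * (w / c) + 1) / (w / c * (2 * (w / c) + 4)) =
      (w - c) * (5 * w + c) / (w * (2 * w + 4 * c)) := by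
    field_simp
  rw [e, div_le_iff₀ (by positivity)] at h1
  have : v - L ≤ Real.log w - Real.log c :=
    le_of_mul_le_mul_right (h.trans h1) (by positivity)
  linarith

lemma le_log_four : 1.3862942 ≤ Real.log 4 := by
  rw [show (4 : ℝ) = 2 ^ 2 by norm_num, Real.log_pow]
  push_cast
  linarith [le_log_two]

/-- A quadratic majorant of exp(-t) on the range of t = 5.95 η²/(3T) makes the exponent quadratic in
η; the recentred Padé bound at 4 then reduces the claim to a polynomial inequality. -/
lemma exp_softExponent_le_left (hη : 0.58 ≤ η) (hη1 : η ≤ 1) :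
    17 / 35 * Real.exp 3.5 * Real.exp (softExponent η 5.95 1.0986) * 0.57736 ^ 2 ≤
      0.6 * (0.6962 * (2 * (η * (0.57736 + η)) - 0.25) - 3 / 14) := by
  have hη0 : 0 < η := by linarith
  obtain ⟨t, ht⟩ : ∃ t, t = 5.95 / (3 * 1.0986 / η ^ 2) := ⟨_, rfl⟩
  have ht' : t * (3 * 1.0986) = 5.95 * η ^ 2 := by rw [ht]; field_simp
  have h0 : 0.606 ≤ t := by nlinarith
  have h1 : t ≤ 1.807 := by nlinarith
  have hexp : Real.exp (-t) ≤ 1 - 0.792 * t + 0.1856 * t ^ 2 := by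
    refine (exp_neg_le (by linarith)).trans ?_
    rw [inv_le_iff_one_le_mul₀ (by positivity)]
    have B := bernstein_nonneg h0 h1
    linarith [B 0 8, B 1 7, B 2 6, B 3 5, B 4 4, B 5 3, B 6 2, B 7 1, B 8 0]
  have h2 := softExponent_le hη0 (by norm_num) ht hexp
  have B := bernstein_nonneg hη hη1
  have hw : 0 < 0.6962 * (2 * (η * (0.57736 + η)) - 0.25) - 3 / 14 := by nlinarith
  have h3 : Real.exp (3.5 + (1.0986 - 5.95 * 0.792 + 5.95 * 0.1856 * (5.95 / (3 * 1.0986)) * η ^ 2)) ≤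
      3.7057 * (0.6962 * (2 * (η * (0.57736 + η)) - 0.25) - 3 / 14) := by
    refine exp_le_of_le_log_pade (by positivity) four_pos le_log_four ?_
    linarith [B 0 6, B 1 5, B 2 4, B 3 3, B 4 2, B 5 1, B 6 0]
  have h4 : Real.exp 3.5 * Real.exp (softExponent η 5.95 1.0986) ≤
      3.7057 * (0.6962 * (2 * (η * (0.57736 + η)) - 0.25) - 3 / 14) := by
    rw [← Real.exp_add]
    refine (Real.exp_le_exp.2 ?_).trans h3
    linarith
  linarith

lemma exp_softExponent_le_right (hη : 0.58 ≤ η) (hη1 : η ≤ 1) :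
    17 / 35 * Real.exp 3.5 * Real.exp (softExponent η 5.95 2.75) * 0.57736 ^ 2 ≤
      0.84 * (0.6962 * (2 * (η * (0.57736 + η)) - 0.25) - 3 / 14) := by
  have hη0 : 0 < η := by linarith
  obtain ⟨t, ht⟩ : ∃ t, t = 5.95 / (3 * 2.75 / η ^ 2) := ⟨_, rfl⟩
  have ht' : t * (3 * 2.75) = 5.95 * η ^ 2 := by rw [ht]; field_simp
  have h0 : 0.242 ≤ t := by nlinarith
  have h1 : t ≤ 0.722 := by nlinarith
  have hexp : Real.exp (-t) ≤ 1 - 0.976 * t + 0.385 * t ^ 2 := by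
    refine (exp_neg_le (by linarith)).trans ?_
    rw [inv_le_iff_one_le_mul₀ (by positivity)]
    have B := bernstein_nonneg h0 h1
    linarith [B 0 8, B 1 7, B 2 6, B 3 5, B 4 4, B 5 3, B 6 2, B 7 1, B 8 0]
  have h2 := softExponent_le hη0 (by norm_num) ht hexp
  have B := bernstein_nonneg hη hη1
  have hw : 0 < 0.6962 * (2 * (η * (0.57736 + η)) - 0.25) - 3 / 14 := by nlinarith
  have h3 : Real.exp (3.5 + (2.75 - 5.95 * 0.976 + 5.95 * 0.385 * (5.95 / (3 * 2.75)) * η ^ 2)) ≤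
      5.188 * (0.6962 * (2 * (η * (0.57736 + η)) - 0.25) - 3 / 14) := by
    refine exp_le_of_le_log_pade (by positivity) four_pos le_log_four ?_
    linarith [B 0 6, B 1 5, B 2 4, B 3 3, B 4 2, B 5 1, B 6 0]
  have h4 : Real.exp 3.5 * Real.exp (softExponent η 5.95 2.75) ≤
      5.188 * (0.6962 * (2 * (η * (0.57736 + η)) - 0.25) - 3 / 14) := by
    rw [← Real.exp_add]
    refine (Real.exp_le_exp.2 ?_).trans h3
    linarith
  linarith

/-- Tangency is fixed at z = 1.7, x = 3.5, so θ = 5.95 and q - A is the radius minus 3/14. The costs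
are interpolated between T = 1.0986 and T = 2.75, with budgets 0.6 + 0.345 and 0.84 + 0.07, besides
the lower tail. -/
lemma hasUnitCost_soft (hη : 0.58 ≤ η) (hη1 : η ≤ 1) (hm : 3 ≤ m) (hy0 : 0 < y)
    (hy : y ≤ 0.57736) (hym : (m : ℝ) * y ^ 2 = 1) (hT : 1.0986 ≤ T) (hT' : T ≤ 2.75) :
    HasUnitCost m η T (η * (y + η)) := by
  have hη0 : 0 < η := by linarith
  have hT0 : 0 < T := by linarith
  have hm' : (3 : ℝ) ≤ m := by exact_mod_cast hm
  have hend : 1 + 3.5 * (5.8 - 1) ≤ Real.exp (3.5 * (1 - 1 / 5.8)) := by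
    have := Real.sum_le_exp_of_nonneg (x := 3.5 * (1 - 1 / 5.8)) (by norm_num) 12
    refine le_trans ?_ this
    norm_num [Finset.sum_range_succ, Nat.factorial]
  set u := largeRadius (η * (y + η)) - 3 / 14 with hu
  set u₀ := 0.6962 * (2 * (η * (0.57736 + η)) - 0.25) - 3 / 14 with hu₀
  have hu0 : 0 < u := by rw [hu]; unfold largeRadius; nlinarith
  have hu₀0 : 0 < u₀ := by nlinarith
  -- The ratio y²/u is largest at y = 0.57736, so only that value of y has to be estimated.
  have hucmp : y ^ 2 * u₀ ≤ 0.57736 ^ 2 * u := by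
    have h1 : 0 ≤ 0.6962 * (2 * η ^ 2 - 0.25) - 3 / 14 := by nlinarith
    have h2 : y ^ 2 ≤ 0.57736 ^ 2 := by gcongr
    have h3 : 0 ≤ 1.3924 * η * 0.57736 * y * (0.57736 - y) := by
      have := sub_nonneg.2 hy
      positivity
    rw [hu, hu₀]
    unfold largeRadius
    nlinarith [mul_le_mul_of_nonneg_right h2 h1]
  have hmain : ∀ {E r : ℝ}, 17 / 35 * Real.exp 3.5 * Real.exp E * 0.57736 ^ 2 ≤ r * u₀ →
      17 / 35 * Real.exp 3.5 * Real.exp E * y ^ 2 ≤ r * u := fun {E r} h => by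
    refine le_of_mul_le_mul_right ?_ hu₀0
    have h1 := mul_le_mul_of_nonneg_left hucmp
      (show 0 ≤ 17 / 35 * Real.exp 3.5 * Real.exp E by positivity)
    have h2 := mul_le_mul_of_nonneg_right h hu0.le
    linarith
  obtain ⟨a, ha⟩ : ∃ a, a = (2.75 - T) / 1.6514 := ⟨_, rfl⟩
  obtain ⟨b, hb⟩ : ∃ b, b = (T - 1.0986) / 1.6514 := ⟨_, rfl⟩
  have ha0 : 0 ≤ a := by rw [ha]; exact div_nonneg (by linarith) (by norm_num)
  have hb0 : 0 ≤ b := by rw [hb]; exact div_nonneg (by linarith) (by norm_num)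
  have hab : a + b = 1 := by rw [ha, hb]; ring
  have hTab : T = a * 1.0986 + b * 2.75 := by rw [ha, hb]; ring
  have hjensen : ∀ s t : ℝ, Real.exp (a * s + b * t) ≤ a * Real.exp s + b * Real.exp t :=
    fun s t => convexOn_exp.2 (Set.mem_univ s) (Set.mem_univ t) ha0 hb0 hab
  have hsoft : 17 / 35 * Real.exp 3.5 * Real.exp (softExponent η 5.95 T) * y ^ 2 ≤
      (a * 0.6 + b * 0.84) * u := by
    have h1 := softExponent_convex (η := η) (c := 5.95) (u := 1.0986) (v := 2.75) hη0 (by norm_num)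
      (by norm_num) ha0 hb0 hab
    rw [← hTab] at h1
    have h2 := (Real.exp_le_exp.2 h1).trans (hjensen _ _)
    have h3 := mul_le_mul_of_nonneg_left h2
      (show 0 ≤ 17 / 35 * Real.exp 3.5 * y ^ 2 by positivity)
    have h4 := mul_le_mul_of_nonneg_left (hmain (exp_softExponent_le_left hη hη1)) ha0
    have h5 := mul_le_mul_of_nonneg_left (hmain (exp_softExponent_le_right hη hη1)) hb0
    linarith
  have hhard : Real.exp (T - 3 * T / η ^ 2 * poissonRate (1 / (5.8 * 1.7))) ≤
      a * 0.345 + b * 0.07 := by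
    have hlog : Real.log 8 ≤ 3 * 0.6931472 := by
      rw [show (8 : ℝ) = 2 ^ 3 by norm_num, Real.log_pow]
      push_cast
      linarith [log_two_le]
    have h1 : η ^ 2 * (1 + 0.98) ≤ 3 * poissonRate (1 / (5.8 * 1.7)) :=
      le_trans (by nlinarith) (le_three_mul_poissonRate_inv_of_log (c := 1.98) (b := 8)
        (by norm_num) (by norm_num) hlog (by norm_num))
    refine (Real.exp_le_exp.2 (sub_mul_le_neg hη0 hT0.le h1)).trans ?_
    have h2 := hjensen (-(1.0986 * 0.98)) (-(2.75 * 0.98))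
    rw [show a * -(1.0986 * 0.98) + b * -(2.75 * 0.98) = -(T * 0.98) by rw [hTab]; ring] at h2
    have h3 := exp_neg_le_of (c := 1.0986 * 0.98) (b := 1.07) (r := 0.345) (by norm_num)
      (by norm_num) (by norm_num)
    have h4 := exp_neg_le_of (c := 2.75 * 0.98) (b := 2.69) (r := 0.07) (by norm_num)
      (by norm_num) (by norm_num)
    have h5 := mul_le_mul_of_nonneg_left h3 ha0
    have h6 := mul_le_mul_of_nonneg_left h4 hb0
    linarith
  have hlow := exp_div_natCast_le (c := T * 2) (b := 2.19) (r := 0.1135) hm (by norm_num)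
    (by linarith) (by norm_num)
  refine .intro (admissible_largeRadius (by nlinarith))
    ⟨_, le_rfl, UpperCost.tangent (z := 1.7) (x₀ := 3.5) (x := 3.5) (Y := 5.8) (by norm_num)
      (by norm_num) (by norm_num) hend le_rfl (by norm_num) (by linarith)⟩
    (exists_lowerCost_largeRadius hη hy0 hy hym hT0.le) ?_
  have e : Real.exp T / m * (1.7 / 3.5 * Real.exp 3.5 * Real.exp (3 * T / η ^ 2 *
      (Real.exp (-(3.5 * 1.7) / (3 * T / η ^ 2)) - 1)) /
        (1 + largeRadius (η * (y + η)) - 1.7 * (1 - 1 / 3.5))) =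
      17 / 35 * Real.exp 3.5 * Real.exp (softExponent η 5.95 T) * y ^ 2 / u := by
    rw [div_eq_mul_sq hym, softExponent, Real.exp_add, hu,
      show (-(3.5 * 1.7) : ℝ) = -5.95 by norm_num,
      show 1 + largeRadius (η * (y + η)) - 1.7 * (1 - 1 / 3.5) =
        largeRadius (η * (y + η)) - 3 / 14 by ring]
    ring
  rw [e]
  have := (div_le_iff₀ hu0).2 hsoft
  linarith

lemma hasUnitCost_of_three_le {m : ℕ} {η T y : ℝ} (hη0 : 0 < η) (hη1 : η < 1) (hm : 3 ≤ m)
    (hy0 : 0 < y) (hym : (m : ℝ) * y ^ 2 = 1) (hTm : Real.log m ≤ T) :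
    HasUnitCost m η T (η * (y + η)) := by
  have hm' : (3 : ℝ) ≤ m := by exact_mod_cast hm
  have hy : y ≤ 0.57736 := by nlinarith
  have hT : 1.0986 ≤ T := by
    refine le_trans ?_ ((Real.log_le_log (by norm_num) hm').trans hTm)
    rw [Real.le_log_iff_exp_le (by norm_num)]
    have h := Real.exp_bound' (x := 0.0986) (by norm_num) (by norm_num) (n := 5) (by norm_num)
    have h2 := mul_le_mul Real.exp_one_lt_d9.le h (Real.exp_pos _).le (by norm_num)
    rw [← Real.exp_add, show (1 : ℝ) + 0.0986 = 1.0986 by norm_num] at h2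
    refine h2.trans ?_
    norm_num [Finset.sum_range_succ, Nat.factorial]
  have hTy : Real.exp (-T) ≤ y ^ 2 := by
    have h := (Real.log_le_iff_le_exp (by linarith)).1 hTm
    rw [Real.exp_neg, inv_le_iff_one_le_mul₀ (Real.exp_pos _), ← hym]
    have := mul_le_mul_of_nonneg_right h (sq_nonneg y)
    linarith
  rcases le_total η 0.3 with h | h
  · rcases le_total T 2.3 with h' | h'
    · exact hasUnitCost_small_tangent hη0 h hm hy0 hy hym hT hTy h'
    · exact hasUnitCost_small_chord hη0 h hm hy0 hy hym h'
  rcases le_total (9 * η) T with h9 | h9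
  · rcases le_total η 0.65 with h' | h'
    · exact hasUnitCost_chord_linearRadius h h' hm hy0 hy hym h9
    · exact hasUnitCost_chord_of_le h' hη1 hm hy0 hy hym h9
  rcases le_total η 0.58 with h1 | h1
  · exact hasUnitCost_tangent_linearRadius h h1 hm hy0 hy hym hT hTy h9
  rcases le_total T 2.75 with h2 | h2
  · exact hasUnitCost_soft h1 hη1.le hm hy0 hy hym hT h2
  rcases le_total η 0.8 with h3 | h3
  · exact hasUnitCost_tangent_largeRadius h1 h3 hm hy0 hy hym h2 h9
  · exact hasUnitCost_tangent_upperEnd h3 hη1.le hm hy0 hy hym h2 h9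

lemma exists_costs {m : ℕ} (hm : 0 < m) {η T : ℝ} (hη : η ∈ Set.Ioo (0 : ℝ) 1)
    (hT2 : Real.log 2 ≤ T) (hTm : Real.log m ≤ T) :
    ∃ p q a b, Admissible (η / √(m : ℝ) + η ^ 2) p q ∧ UpperCost m (3 * T / η ^ 2) T q a ∧
      LowerCost m (3 * T / η ^ 2) T p b ∧ a + b ≤ 1 := by
  obtain ⟨hη0, hη1⟩ := hη
  change HasUnitCost m η T _
  rcases Nat.lt_or_ge m 3 with h | h
  · interval_cases m
    · simpa using hasUnitCost_one hη0 hη1 hT2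
    · refine (hasUnitCost_two hη0 hη1 hT2).mono (by positivity) ?_
      have h2 : 0.7071067 ≤ 1 / √(2 : ℝ) := by
        rw [le_div_iff₀ (by positivity)]
        have h3 : √(2 : ℝ) ≤ 1.4142137 := by
          rw [Real.sqrt_le_left (by norm_num)]; norm_num
        linarith
      have := mul_le_mul_of_nonneg_right h2 hη0.le
      push_cast
      rw [div_mul_eq_mul_div, one_mul] at this
      linarith
  · have hm0 : (0 : ℝ) < m := by exact_mod_cast hm
    convert hasUnitCost_of_three_le (y := 1 / √(m : ℝ)) hη0 hη1 h (by positivity) ?_ hTm using 1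
    · ring
    · rw [div_pow, Real.sq_sqrt hm0.le]
      field_simp

end Giant

end

theorem corollary1
    {n d m s : ℕ} (hmd : 2 ≤ m * d) (hs : 0 < s)
    -- the empirical risk: convex, twice differentiable losses; strongly convex objective
    (ℓ : Fin n → ℝ → ℝ) (x : Fin n → EuclideanSpace ℝ (Fin d)) (γ : ℝ) (hγ : 0 ≤ γ)
    (hconv : ∀ j, ConvexOn ℝ Set.univ (ℓ j))
    (hdiff : ∀ j, Differentiable ℝ (ℓ j))
    (hdiff2 : ∀ j, Differentiable ℝ (deriv (ℓ j)))
    (hstrong : ∃ c : ℝ, 0 < c ∧ StrongConvexOn Set.univ c (Giant.objective ℓ x γ))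
    -- the minimizer and the current iterate
    (wstar : EuclideanSpace ℝ (Fin d))
    (hwstar : IsMinOn (Giant.objective ℓ x γ) Set.univ wstar)
    (w : EuclideanSpace ℝ (Fin d))
    -- the Hessian is `L`-Lipschitz
    (L : ℝ)
    (hLip : ∀ u v : EuclideanSpace ℝ (Fin d),
      ‖Giant.hessian (Giant.objective ℓ x γ) u - Giant.hessian (Giant.objective ℓ x γ) v‖
        ≤ L * ‖u - v‖)
    -- the current iterate is close to the minimizer
    (hclose : 3 * L * ‖w - wstar‖
      ≤ Giant.sigmaMin (Giant.hessian (Giant.objective ℓ x γ) wstar))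
    -- the local sample size
    (η δ : ℝ) (hη : η ∈ Set.Ioo (0 : ℝ) 1) (hδ : δ ∈ Set.Ioo (0 : ℝ) 1)
    (hsize : 3 * Giant.rowCoherence (Giant.scaledData ℓ x w) * d / η ^ 2
      * Real.log (m * d / δ) ≤ s)
    -- worker `i` holds `s` samples, all drawn independently and uniformly
    {Ω : Type*} [MeasurableSpace Ω] (P : Measure Ω) [IsProbabilityMeasure P]
    (J : Fin m → Fin s → Ω → Fin n)
    (hJmeas : ∀ i k, Measurable (J i k))
    (hJindep : iIndepFun (fun p : Fin m × Fin s => J p.1 p.2) P)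
    (hJunif : ∀ i k j, P.real {ω | J i k ω = j} = 1 / (n : ℝ)) :
    1 - δ ≤ P.real {ω |
      (∀ i, IsUnit (Giant.localHessian ℓ x γ w (fun k => J i k ω))) ∧
      ‖Giant.giantStep ℓ x γ w (fun i k => J i k ω) - wstar‖
        ≤ max
          (2 * (η / √(m : ℝ) + η ^ 2)
            * √(Giant.condNumber (Giant.hessian (Giant.objective ℓ x γ) wstar))
            * ‖w - wstar‖)
          (3 * L / Giant.sigmaMin (Giant.hessian (Giant.objective ℓ x γ) wstar)
            * ‖w - wstar‖ ^ 2)} := by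
  obtain ⟨hη0, hη1⟩ := hη
  obtain ⟨hδ0, hδ1⟩ := hδ
  have hm : 0 < m := Nat.pos_of_ne_zero (by rintro rfl; omega)
  have hd : 0 < d := Nat.pos_of_ne_zero (by rintro rfl; omega)
  have hm1 : (1 : ℝ) ≤ m := by exact_mod_cast hm
  have hd1 : (1 : ℝ) ≤ d := by exact_mod_cast hd
  -- A probability space has a point, and the index drawn there shows n > 0.
  obtain ⟨ω⟩ := P.nonempty_of_neZero
  have hn : 0 < n := (J ⟨0, hm⟩ ⟨0, hs⟩ ω).pos
  have hn0 : (n : ℝ) ≠ 0 := by positivity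
  set T := Real.log (m * d / δ) with hT
  have hmd' : (2 : ℝ) ≤ m * d := by exact_mod_cast hmd
  have hle : ∀ a : ℝ, 0 < a → a ≤ m * d → Real.log a ≤ T := fun a ha h =>
    Real.log_le_log ha (h.trans (le_div_self (by positivity) hδ0 hδ1.le))
  have hT2 : Real.log 2 ≤ T := hle 2 two_pos hmd'
  have hTm : Real.log m ≤ T := hle m (by positivity) (le_mul_of_one_le_right (by positivity) hd1)
  have hT0 : 0 < T := (Real.log_pos one_lt_two).trans_le hT2
  obtain ⟨p, q, a, b, hadm, hup, hlow, hab⟩ := Giant.exists_costs hm ⟨hη0, hη1⟩ hT2 hTm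
  set N := 3 * T / η ^ 2 with hN
  have hN0 : 0 < N := by positivity
  have hs0 : (0 : ℝ) < s := by exact_mod_cast hs
  set A := Giant.scaledData ℓ x w with hA
  -- The coherence bound is set to s/N, so that N R = s exactly; the sample size hypothesis is
  -- precisely the bound on the rows.
  have hsamp : Giant.IsSampling (Giant.columnBasis A) (s / N) :=
    { nonempty := ⟨⟨0, hn⟩⟩
      isotropic := Giant.sum_vecMulVec_columnBasis A
      pos := by positivity
      bound := fun j => by
        rw [le_div_iff₀ hN0, Fintype.card_fin]
        refine le_trans ?_ hsize
        refine (mul_le_mul_of_nonneg_right (Giant.card_mul_sq_columnBasis_le A hd j)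
          hN0.le).trans (le_of_eq ?_)
        rw [hN]
        ring }
  have hNs : N * (s / N) ≤ s := (mul_div_cancel₀ _ hN0.ne').le
  have h1 := hup.failCount_le hsamp hm hN0 hNs
  have h2 := hlow.failCount_le hsamp hm hN0 hNs
  have h3 := (Giant.failCount_and_le _ _).trans (add_le_add h1 h2)
  have hδe : (m : ℝ) * d * Real.exp (-T) = δ := by
    rw [Real.exp_neg, hT, Real.exp_log (by positivity)]
    field_simp
  -- The Chernoff prefactor is the rank of A, at most d; this is where T = log(md/δ) absorbs the
  -- union over machines and dimensions.
  have hk : (m : ℝ) * Module.finrank ℝ (Giant.columnSpace A) * Real.exp (-T) ≤ δ := by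
    rw [← hδe]
    have : (Module.finrank ℝ (Giant.columnSpace A) : ℝ) ≤ d := by
      exact_mod_cast Giant.finrank_columnSpace_le A
    gcongr
  have h4 := Giant.one_sub_failCount_le (P := P) (fun p : Fin m × Fin s => J p.1 p.2) hJindep
    (fun p => hJunif p.1 p.2) (fun j => Giant.UpperGood (Giant.columnBasis A) q j ∧
      Giant.LowerGood (Giant.columnBasis A) p j)
  have h5 : Giant.failCount (fun j : Fin m × Fin s → Fin n =>
      Giant.UpperGood (Giant.columnBasis A) q j ∧ Giant.LowerGood (Giant.columnBasis A) p j) *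
      (1 / (n : ℝ)) ^ Fintype.card (Fin m × Fin s) ≤ δ := by
    rw [Fintype.card_prod, Fintype.card_fin, Fintype.card_fin]
    simp only [Fintype.card_fin] at h3
    calc _ ≤ _ := mul_le_mul_of_nonneg_right h3 (by positivity)
      _ = (n * (1 / (n : ℝ))) ^ (m * s) *
          (m * Module.finrank ℝ (Giant.columnSpace A) * Real.exp (-T)) * (a + b) := by
          rw [mul_pow]; ring
      _ = (m * Module.finrank ℝ (Giant.columnSpace A) * Real.exp (-T)) * (a + b) := by
          rw [mul_one_div_cancel hn0, one_pow, one_mul]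
      _ ≤ (m * Module.finrank ℝ (Giant.columnSpace A) * Real.exp (-T)) * 1 :=
          mul_le_mul_of_nonneg_left hab (by positivity)
      _ ≤ δ := by rw [mul_one]; exact hk
  refine (sub_le_sub_left h5 1).trans (h4.trans (measureReal_mono ?_))
  rintro ω ⟨hω1, hω2⟩
  exact Giant.giantStep_bound hm hd hn ℓ x γ hγ hconv hdiff hdiff2 hstrong wstar hwstar w L hLip
    hclose (by positivity) hadm (fun p => J p.1 p.2 ω) hω1 hω2
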